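/- **Setting.** Let $m\ge 0$ and $n=(2m+1)^2$. An elevation grid $Z$ has rows and columns numbered $-m,\dots,m$ (rows from north to south, columns from west to east). The grid point $p(i,j)$ has horizontal position $(j,-i)$ and elevation $Z_{ij}\in\mathbb R$, and the viewpoint $v$ is the origin of space. For $(i,j)\ne(0,0)$ put $\mathrm{Dist}(i,j)=\sqrt{i^2+j^2}$ and $\mathrm{Elev}(i,j)=\arctan(Z_{ij}/\mathrm{Dist}(i,j))$, and let $\mathrm{Azim}(i,j)\in[0,2\pi)$ be the direction of $(j,-i)$, counter-clockwise from east. Let $D(i,j)$ be the closed unit square (the *cell*) centred at $(j,-i)$. In *Van Kreveld's model* $p(i,j)$ is visible if every grid point $(i',j')\notin\{(i,j),(0,0)\}$ whose cell intersects the segment from $(0,0)$ to $(j,-i)$ satisfies $\mathrm{Elev}(i',j')<\mathrm{Elev}(i,j)$. **Algorithm (centrifugal sweep).** An array $S[0..32m-1]$ (the discretized horizon) is initialised with $-\infty$; slot $k$ stands for the azimuth angles from $2\pi k/(32m)$ to $2\pi(k+1)/(32m)$. Let $s$ be the smallest power of two with $s\ge 2m+1$. A recursive procedure is called on the square tile with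 upper left point $(-m,-m)$ and width $s$. On a tile of width larger than one, it calls itself on the four quadrants in order of increasing distance ($L_1$ distance from $v$ to the closest grid point of the quadrant). On a tile that is a single grid point $(i,j)\ne(0,0)$, it sets $V_{ij}=1$ if $\mathrm{Elev}(i,j)>S[\lfloor 32m\,\mathrm{Azim}(i,j)/2\pi\rfloor]$ and $V_{ij}=0$ otherwise; then it replaces $S[k]$ by $\max(S[k],\mathrm{Elev}(i,j))$ for $k=\lfloor 32m\,\alpha^- /2\pi\rfloor,\dots,\lceil 32m\,\alpha^+/2\pi\rceil-1$, with indices modulo $32m$, where $\alpha^-$ and $\alpha^+$ are the smallest and the largest azimuth angle of a corner of $D(i,j)$ (for cells across the direction of azimuth $0$, the angles in $(\pi,2\pi)$ are decreased by $2\pi$). The viewpoint's own grid point is recorded as visible and does not enter the horizon; points of the tile outside the grid are skipped. The grids $Z$ and $V$ (both stored row by row), the array $S$ and the recursion stack are stored consecutively in external memory. The time is the number of instructions of a random access machine with unit-cost exact real arithmetic (including square root, arctangent, azimuth angle, floor and ceiling). The number of I/Os, for a main memory of $M$ words and blocks of $B\ge1$ words, is the number of blocks loaded or written back when main memory, initially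 empty, holds $\lfloor M/B\rfloor$ blocks under least-recently-used replacement. Put $\mathrm{scan}(n)=\lceil n/B\rceil$. **Theorem.** The centrifugal sweep, which does not use $M$ or $B$, has the following properties for all $m$ and all $Z$. 1. *Time.* It runs in $O(n)$ time, with an absolute constant. 2. *I/Os, cache-obliviously.* For every $c>0$ there is a constant $C$, depending only on $c$, such that for all $m$, $Z$ and all $M$ and $B\ge1$ with the tall-cache property $M\ge cB^2$ it uses at most $C\cdot\mathrm{scan}(n)$ I/Os. 3. *Output.* It computes the visibility map in Van Kreveld's model at the angular resolution of the horizon array: $V_{00}=1$, and for every grid point $(i,j)\neq(0,0)$, with $k=\lfloor 32m\,\mathrm{Azim}(i,j)/2\pi\rfloor$, the output $V_{ij}$ is $1$ if for every $\theta$ strictly between $2\pi k/(32m)$ and $2\pi(k+1)/(32m)$ all grid points $(i',j')\notin\{(i,j),(0,0)\}$ whose cells intersect the segment of direction $\theta$ and length $\mathrm{Dist}(i,j)$ that starts at $(0,0)$ satisfy $\mathrm{Elev}(i',j')<\mathrm{Elev}(i,j)$, and $V_{ij}$ is $0$ otherwise. Moreover, if $V_{ij}=1$, then $p(i,j)$ is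 visible in Van Kreveld's model with cells replaced by their interiors, and, if $|i|\ne|j|$, also with closed cells. -/

import Mathlib

namespace CentrifugalSweep

/-! ### Geometry of the terrain

The grid has rows and columns `-m, …, m`; the point in row `i` and column `j` has horizontal
coordinates `(j, -i)` and elevation `Z i j`.  The viewpoint is the origin of space. -/

/-- Azimuth angle of `(x, y)` as seen from the origin: counter-clockwise from east, in `[0, 2π)`. -/
noncomputable def azim (x y : ℝ) : ℝ :=
  if (Complex.mk x y).arg < 0 then (Complex.mk x y).arg + 2 * Real.pi else (Complex.mk x y).arg

/-- `(i, j)` is the row and column of a grid point. -/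
def InGrid (m : ℕ) (i j : ℤ) : Prop := |i| ≤ (m : ℤ) ∧ |j| ≤ (m : ℤ)

/-- Horizontal distance from the viewpoint to the grid point `(i, j)`. -/
noncomputable def dist (i j : ℤ) : ℝ := Real.sqrt ((j : ℝ) ^ 2 + (i : ℝ) ^ 2)

/-- Elevation angle of the grid point `(i, j)` (meaningful away from the viewpoint). -/
noncomputable def elev (Z : ℤ → ℤ → ℝ) (i j : ℤ) : ℝ := Real.arctan (Z i j / dist i j)

/-- The (closed) unit square centred at the grid point `(i, j)`. -/
def cell (i j : ℤ) : Set (ℝ × ℝ) := {p | |p.1 - (j : ℝ)| ≤ 1 / 2 ∧ |p.2 + (i : ℝ)| ≤ 1 / 2}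

/-- No cell of the terrain other than that of `(i, j)` and that of the viewpoint meets the
horizontal segment from the viewpoint to `e` while appearing at least as high as `(i, j)`.
`D` says which plane region each grid point stands for. -/
def Unobstructed (D : ℤ → ℤ → Set (ℝ × ℝ)) (m : ℕ) (Z : ℤ → ℤ → ℝ) (i j : ℤ) (e : ℝ × ℝ) : Prop :=
  ∀ i' j' : ℤ, InGrid m i' j' → (i', j') ≠ (i, j) → (i', j') ≠ (0, 0) →
    (D i' j' ∩ segment ℝ ((0, 0) : ℝ × ℝ) e).Nonempty → elev Z i' j' < elev Z i j

/-- Visibility of the grid point `(i, j)` in Van Kreveld's model. -/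
def KreveldVisible (D : ℤ → ℤ → Set (ℝ × ℝ)) (m : ℕ) (Z : ℤ → ℤ → ℝ) (i j : ℤ) : Prop :=
  Unobstructed D m Z i j ((j : ℝ), -(i : ℝ))

/-- The horizon slot that contains the azimuth angle of the grid point `(i, j)`; slot `k` covers
the azimuth angles from `k * 2π / (32 m)` to `(k + 1) * 2π / (32 m)`. -/
noncomputable def slotOf (m : ℕ) (i j : ℤ) : ℤ :=
  ⌊azim (j : ℝ) (-(i : ℝ)) / (2 * Real.pi) * (32 * (m : ℝ))⌋

/-- Visibility in Van Kreveld's model at the angular resolution of the horizon array: the line of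
sight to `(i, j)` is unobstructed also when it is turned about the viewpoint into any direction
in the interior of the slot of `(i, j)`. -/
def SlotVisible (m : ℕ) (Z : ℤ → ℤ → ℝ) (i j : ℤ) : Prop :=
  ∀ θ : ℝ, (slotOf m i j : ℝ) * (2 * Real.pi / (32 * (m : ℝ))) < θ →
    θ < ((slotOf m i j : ℝ) + 1) * (2 * Real.pi / (32 * (m : ℝ))) →
    Unobstructed cell m Z i j (dist i j * Real.cos θ, dist i j * Real.sin θ)

/-! ### The machine: a unit-cost random access machine with exact real arithmetic -/

/-- The external memory, one word per address.  The words are extended reals, since the horizon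
array is initialised with `-∞`. -/
abbrev Mem := ℤ → EReal

/-- The instructions, each of unit cost.  `load`, `store` and `spill` are the ones that access
the memory. -/
inductive Instr : Type → Type
  -- integer arithmetic
  | iadd (a b : ℤ) : Instr ℤ
  | isub (a b : ℤ) : Instr ℤ
  | imul (a b : ℤ) : Instr ℤ
  | idiv (a b : ℤ) : Instr ℤ
  | imod (a b : ℤ) : Instr ℤ
  | iabs (a : ℤ) : Instr ℤ
  | imin (a b : ℤ) : Instr ℤ
  | ile (a b : ℤ) : Instr Bool
  | ieq (a b : ℤ) : Instr Bool
  -- real arithmetic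
  | ofInt (a : ℤ) : Instr ℝ
  | radd (x y : ℝ) : Instr ℝ
  | rsub (x y : ℝ) : Instr ℝ
  | rmul (x y : ℝ) : Instr ℝ
  | rdiv (x y : ℝ) : Instr ℝ
  | rmin (x y : ℝ) : Instr ℝ
  | rmax (x y : ℝ) : Instr ℝ
  | rlt (x y : ℝ) : Instr Bool
  | rsqrt (x : ℝ) : Instr ℝ
  | rarctan (x : ℝ) : Instr ℝ
  | razim (x y : ℝ) : Instr ℝ
  | rfloor (x : ℝ) : Instr ℤ
  | rceil (x : ℝ) : Instr ℤ
  -- memory words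
  | wreal (w : EReal) : Instr ℝ
  | wmax (v w : EReal) : Instr EReal
  | wlt (v w : EReal) : Instr Bool
  | load (a : ℤ) : Instr EReal
  | store (a : ℤ) (w : EReal) : Instr Unit
  -- access to a word of the recursion stack; its contents are the local variables of a
  -- suspended call, which the host language keeps
  | spill (a : ℤ) : Instr Unit

/-- The value returned by an instruction. -/
noncomputable def Instr.value : {β : Type} → Instr β → Mem → β
  | _, .iadd a b, _ => a + b
  | _, .isub a b, _ => a - b
  | _, .imul a b, _ => a * b
  | _, .idiv a b, _ => a / b
  | _, .imod a b, _ => a % b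
  | _, .iabs a, _ => |a|
  | _, .imin a b, _ => min a b
  | _, .ile a b, _ => decide (a ≤ b)
  | _, .ieq a b, _ => decide (a = b)
  | _, .ofInt a, _ => (a : ℝ)
  | _, .radd x y, _ => x + y
  | _, .rsub x y, _ => x - y
  | _, .rmul x y, _ => x * y
  | _, .rdiv x y, _ => x / y
  | _, .rmin x y, _ => min x y
  | _, .rmax x y, _ => max x y
  | _, .rlt x y, _ => decide (x < y)
  | _, .rsqrt x, _ => Real.sqrt x
  | _, .rarctan x, _ => Real.arctan x
  | _, .razim x y, _ => azim x y
  | _, .rfloor x, _ => ⌊x⌋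
  | _, .rceil x, _ => ⌈x⌉
  | _, .wreal w, _ => w.toReal
  | _, .wmax v w, _ => max v w
  | _, .wlt v w, _ => decide (v < w)
  | _, .load a, μ => μ a
  | _, .store _ _, _ => ()
  | _, .spill _, _ => ()

/-- The memory after an instruction. -/
noncomputable def Instr.memory : {β : Type} → Instr β → Mem → Mem
  | _, .store a w, μ => Function.update μ a w
  | _, _, μ => μ

/-- The memory accesses of an instruction: the address, and whether the word is written. -/
def Instr.accesses : {β : Type} → Instr β → List (ℤ × Bool)
  | _, .load a => [(a, false)]
  | _, .store a _ => [(a, true)]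
  | _, .spill a => [(a, true)]
  | _, _ => []

/-- Programs: sequences of instructions, each of which may depend on the values returned by the
earlier ones. -/
inductive Prog (α : Type) : Type 1
  | ret (a : α) : Prog α
  | step {β : Type} (i : Instr β) (k : β → Prog α) : Prog α

/-- Sequential composition. -/
def Prog.bind {α β : Type} : Prog α → (α → Prog β) → Prog β
  | .ret a, f => f a
  | .step i k, f => .step i (fun b => (k b).bind f)

instance : Monad Prog where
  pure := Prog.ret
  bind := Prog.bind

/-- A single instruction as a program. -/
def op {β : Type} (i : Instr β) : Prog β := .step i .ret

/-- Result of an execution: value, final memory, number of instructions executed, and the memory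
accesses in chronological order. -/
structure Outcome (α : Type) where
  val : α
  mem : Mem
  time : ℕ
  trace : List (ℤ × Bool)

/-- Execution of a program from a given memory. -/
noncomputable def Prog.exec {α : Type} : Prog α → Mem → Outcome α
  | .ret a, μ => ⟨a, μ, 0, []⟩
  | .step i k, μ =>
    let o := (k (i.value μ)).exec (i.memory μ)
    ⟨o.val, o.mem, o.time + 1, i.accesses ++ o.trace⟩

/-! ### Block transfers -/

/-- Number of block transfers caused by a sequence of block accesses (block number, and whether
the block is modified) in a main memory that holds `cap` blocks and evicts the least recently used
one.  The first argument lists the blocks in memory, most recently used first, each with the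
information whether it was modified since it was loaded.  Loading a block counts one; so does
copying a modified block back, when it is evicted or at the end. -/
def lruTransfers (cap : ℕ) : List (ℤ × Bool) → List (ℤ × Bool) → ℕ
  | cache, [] => (cache.filter (fun e => e.2)).length
  | cache, (b, w) :: rest =>
    match cache.find? (fun e => e.1 == b) with
    | some e => lruTransfers cap ((b, e.2 || w) :: cache.filter (fun e' => e'.1 != b)) rest
    | none =>
      1 + ((((b, w) :: cache).drop cap).filter (fun e => e.2)).length +
        lruTransfers cap (((b, w) :: cache).take cap) rest

/-- Number of block transfers of a sequence of memory accesses, for a main memory of `M` words,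
initially empty, and blocks of `B` consecutive words. -/
def blockTransfers (M B : ℕ) (trace : List (ℤ × Bool)) : ℕ :=
  lruTransfers (M / B) [] (trace.map (fun e => (e.1 / (B : ℤ), e.2)))

/-- Number of blocks of `B` words needed for `n` consecutive words. -/
noncomputable def scan (n B : ℕ) : ℕ := ⌈(n : ℝ) / (B : ℝ)⌉₊

/-! ### The algorithm

The memory holds, one after the other from address `0`: the elevation grid, the visibility grid
(both row by row), the horizon array, and the recursion stack. -/

/-- The quantities that the program computes once and keeps in registers. -/
structure Consts where
  m : ℤ
  /-- number of rows and of columns -/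
  side : ℤ
  /-- number of slots of the horizon array -/
  slots : ℤ
  /-- address of the visibility grid -/
  vBase : ℤ
  /-- address of the horizon array -/
  sBase : ℤ

/-- Offset of row `i` and column `j` in a grid stored row by row. -/
def cellIndex (c : Consts) (i j : ℤ) : Prog ℤ := do
  let i' ← op (.iadd i c.m)
  let r ← op (.imul i' c.side)
  let j' ← op (.iadd j c.m)
  op (.iadd r j')

/-- The azimuth angle `α` in units of one slot. -/
noncomputable def inSlots (c : Consts) (α : ℝ) : Prog ℝ := do
  let u ← op (.rdiv α (2 * Real.pi))
  let w ← op (.ofInt c.slots)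
  op (.rmul u w)

/-- Azimuth angle of the corner `(x, y)` of a cell.  If the cell lies across the direction of
azimuth zero, then `2π` is subtracted for the corners below that direction. -/
noncomputable def cornerAzim (across : Bool) (x y : ℝ) : Prog ℝ := do
  let a ← op (.razim x y)
  if across then
    let below ← op (.rlt Real.pi a)
    if below then op (.rsub a (2 * Real.pi)) else pure a
  else pure a

/-- `for k to hi do S[k] ← max (S[k], β)`, the slots being numbered cyclically.  The first
explicit natural number bounds the number of iterations. -/
def raiseSlots (c : Consts) (β : ℝ) (hi : ℤ) : ℕ → ℤ → Prog Unit
  | 0, _ => pure ()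
  | fuel + 1, k => do
    let more ← op (.ile k hi)
    if more then
      let r ← op (.imod k c.slots)
      let a ← op (.iadd c.sBase r)
      let h ← op (.load a)
      let h' ← op (.wmax h (β : EReal))
      op (.store a h')
      let k' ← op (.iadd k 1)
      raiseSlots c β hi fuel k'
    else pure ()

/-- Treatment of a grid point other than the viewpoint. -/
noncomputable def sweepPoint (c : Consts) (i j : ℤ) : Prog Unit := do
  let a ← cellIndex c i j
  let x ← op (.ofInt j)
  let i' ← op (.isub 0 i)
  let y ← op (.ofInt i')
  -- azimuth and elevation angle
  let α ← op (.razim x y)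
  let w ← op (.load a)
  let z ← op (.wreal w)
  let xx ← op (.rmul x x)
  let yy ← op (.rmul y y)
  let dd ← op (.radd xx yy)
  let d ← op (.rsqrt dd)
  let q ← op (.rdiv z d)
  let β ← op (.rarctan q)
  -- visibility
  let p ← inSlots c α
  let k ← op (.rfloor p)
  let ka ← op (.iadd c.sBase k)
  let h ← op (.load ka)
  let vis ← op (.wlt h (β : EReal))
  let va ← op (.iadd c.vBase a)
  op (.store va (if vis then 1 else 0))
  -- azimuth range of the cell
  let rowZero ← op (.ieq i 0)
  let east ← op (.ile 1 j)
  let across := rowZero && east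
  let x₁ ← op (.rsub x (1 / 2))
  let x₂ ← op (.radd x (1 / 2))
  let y₁ ← op (.rsub y (1 / 2))
  let y₂ ← op (.radd y (1 / 2))
  let a₁ ← cornerAzim across x₁ y₁
  let a₂ ← cornerAzim across x₁ y₂
  let a₃ ← cornerAzim across x₂ y₁
  let a₄ ← cornerAzim across x₂ y₂
  let min₁ ← op (.rmin a₁ a₂)
  let min₂ ← op (.rmin a₃ a₄)
  let αmin ← op (.rmin min₁ min₂)
  let max₁ ← op (.rmax a₁ a₂)
  let max₂ ← op (.rmax a₃ a₄)
  let αmax ← op (.rmax max₁ max₂)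
  -- update of the horizon
  let pmin ← inSlots c αmin
  let lo ← op (.rfloor pmin)
  let pmax ← inSlots c αmax
  let up ← op (.rceil pmax)
  let hi ← op (.isub up 1)
  raiseSlots c β hi (up - lo + 1).toNat lo

/-- Treatment of a tile of width one.  Nothing is done outside the grid; the viewpoint, which has
no azimuth and no elevation angle, is recorded as visible and does not enter the horizon. -/
noncomputable def sweepCell (c : Consts) (i j : ℤ) : Prog Unit := do
  let rowIn ← op (.ile i c.m)
  let colIn ← op (.ile j c.m)
  if rowIn && colIn then
    let rowZero ← op (.ieq i 0)
    let colZero ← op (.ieq j 0)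
    if rowZero && colZero then
      let a ← cellIndex c i j
      let va ← op (.iadd c.vBase a)
      op (.store va 1)
    else sweepPoint c i j
  else pure ()

/-- Distance (in the `L₁` metric) from the viewpoint to the closest grid point of the tile with
upper left point `(i, j)` and width `s`. -/
def tileDist (i j s : ℤ) : Prog ℤ := do
  let ie ← op (.iadd i s)
  let ib ← op (.isub ie 1)
  let je ← op (.iadd j s)
  let jb ← op (.isub je 1)
  let ai ← op (.iabs i)
  let aib ← op (.iabs ib)
  let aj ← op (.iabs j)
  let ajb ← op (.iabs jb)
  let r₁ ← op (.ile i 0)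
  let r₂ ← op (.ile 0 ib)
  let c₁ ← op (.ile j 0)
  let c₂ ← op (.ile 0 jb)
  if (r₁ && r₂) && (c₁ && c₂) then pure 0
  else if r₁ && r₂ then op (.imin aj ajb)
  else if c₁ && c₂ then op (.imin ai aib)
  else
    let d₁ ← op (.iadd ai aj)
    let d₂ ← op (.iadd ai ajb)
    let d₃ ← op (.iadd aib aj)
    let d₄ ← op (.iadd aib ajb)
    let e₁ ← op (.imin d₁ d₂)
    let e₂ ← op (.imin d₃ d₄)
    op (.imin e₁ e₂)

/-- A quadrant: its upper left point, and its distance from the viewpoint. -/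
structure Tile where
  row : ℤ
  col : ℤ
  key : ℤ

/-- Insertion into a list sorted by increasing distance. -/
def insertTile (t : Tile) : List Tile → Prog (List Tile)
  | [] => pure [t]
  | u :: us => do
    let before ← op (.ile t.key u.key)
    if before then pure (t :: u :: us)
    else
      let vs ← insertTile t us
      pure (u :: vs)

/-- Number of words of a frame of the recursion stack: the parameters of a call, and its four
quadrants with their distances. -/
def frameSize : ℕ := 16

/-- Access to the first `t` words of the frame at address `F`. -/
def touchFrame : ℕ → ℤ → Prog Unit
  | 0, _ => pure ()
  | t + 1, F => do
    let a ← op (.iadd F t)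
    op (.spill a)
    touchFrame t F

/-- Execute `body` for the elements of a list, in order. -/
def forEach (body : Tile → Prog Unit) : List Tile → Prog Unit
  | [] => pure ()
  | t :: ts => do
    body t
    forEach body ts

/-- The recursive sweep of the tile with upper left point `(i, j)` and width `s`, with its stack
frame at address `F`.  The natural number bounds the depth of the recursion. -/
noncomputable def sweepRec (c : Consts) : ℕ → ℤ → ℤ → ℤ → ℤ → Prog Unit
  | 0, _, _, _, _ => pure ()
  | depth + 1, i, j, s, F => do
    touchFrame frameSize F
    let single ← op (.ieq s 1)
    if single then sweepCell c i j
    else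
      let h ← op (.idiv s 2)
      let i' ← op (.iadd i h)
      let j' ← op (.iadd j h)
      let d₁ ← tileDist i j h
      let d₂ ← tileDist i' j h
      let d₃ ← tileDist i j' h
      let d₄ ← tileDist i' j' h
      let q₁ ← insertTile ⟨i, j, d₁⟩ []
      let q₂ ← insertTile ⟨i', j, d₂⟩ q₁
      let q₃ ← insertTile ⟨i, j', d₃⟩ q₂
      let q₄ ← insertTile ⟨i', j', d₄⟩ q₃
      let F' ← op (.iadd F (frameSize : ℤ))
      forEach (fun t => do
        sweepRec c depth t.row t.col h F'
        touchFrame frameSize F) q₄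

/-- `for k to slots - 1 do S[k] ← -∞`; the natural number bounds the number of iterations. -/
noncomputable def clearSlots (c : Consts) : ℕ → ℤ → Prog Unit
  | 0, _ => pure ()
  | fuel + 1, k => do
    let done ← op (.ile c.slots k)
    if done then pure ()
    else
      let a ← op (.iadd c.sBase k)
      op (.store a ⊥)
      let k' ← op (.iadd k 1)
      clearSlots c fuel k'

/-- Double `s` until it is at least `side`; the natural number bounds the number of iterations. -/
def double (side : ℤ) : ℕ → ℤ → Prog ℤ
  | 0, s => pure s
  | fuel + 1, s => do
    let done ← op (.ile side s)
    if done then pure s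
    else
      let s' ← op (.imul 2 s)
      double side fuel s'

/-- The centrifugal sweep of a grid of `2m + 1` rows and columns.  The bounds given to the loops
and to the recursion are never reached; they only make the definitions terminate. -/
noncomputable def centrifugalSweep (m : ℕ) : Prog Unit := do
  let m2 ← op (.imul 2 (m : ℤ))
  let side ← op (.iadd m2 1)
  let n ← op (.imul side side)
  let n2 ← op (.imul 2 n)
  let slots ← op (.imul 32 (m : ℤ))
  let stack ← op (.iadd n2 slots)
  let c : Consts := ⟨(m : ℤ), side, slots, n, n2⟩
  clearSlots c (32 * m + 1) 0
  let s ← double side (2 * m + 2) 1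
  let first ← op (.isub 0 (m : ℤ))
  sweepRec c (2 * m + 2) first first s stack

/-- Address of the elevation of the grid point `(i, j)`. -/
def elevAddr (m : ℕ) (i j : ℤ) : ℤ := (i + m) * (2 * m + 1) + (j + m)

/-- Address of the visibility value of the grid point `(i, j)`. -/
def visAddr (m : ℕ) (i j : ℤ) : ℤ := (2 * m + 1) ^ 2 + elevAddr m i j

/-- The memory contains the elevation grid `Z`; all its other words are arbitrary. -/
def HoldsTerrain (m : ℕ) (Z : ℤ → ℤ → ℝ) (μ : Mem) : Prop :=
  ∀ i j : ℤ, InGrid m i j → μ (elevAddr m i j) = (Z i j : EReal)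

end CentrifugalSweep

namespace CentrifugalSweep

/-! ### Execution of composite programs -/

@[simp] lemma exec_pure {α : Type} (a : α) (μ : Mem) :
    (pure a : Prog α).exec μ = ⟨a, μ, 0, []⟩ := rfl

lemma exec_bind {α β : Type} (p : Prog α) (f : α → Prog β) (μ : Mem) :
    (p >>= f).exec μ =
      ⟨((f (p.exec μ).val).exec (p.exec μ).mem).val, ((f (p.exec μ).val).exec (p.exec μ).mem).mem,
        (p.exec μ).time + ((f (p.exec μ).val).exec (p.exec μ).mem).time,
        (p.exec μ).trace ++ ((f (p.exec μ).val).exec (p.exec μ).mem).trace⟩ := by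
  change (Prog.bind p f).exec μ = _
  induction p generalizing μ with
  | ret a => simp [Prog.bind, Prog.exec]
  | step i k ih =>
    simp only [Prog.bind, Prog.exec, ih]
    simp only [List.append_assoc, Outcome.mk.injEq, and_true, true_and]
    omega

lemma exec_op {β : Type} (i : Instr β) (μ : Mem) :
    (op i).exec μ = ⟨i.value μ, i.memory μ, 1, i.accesses⟩ := by
  simp [op, Prog.exec]

lemma exec_op_bind {α β : Type} (i : Instr β) (f : β → Prog α) (μ : Mem) :
    (op i >>= f).exec μ =
      ⟨((f (i.value μ)).exec (i.memory μ)).val, ((f (i.value μ)).exec (i.memory μ)).mem,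
        1 + ((f (i.value μ)).exec (i.memory μ)).time,
        i.accesses ++ ((f (i.value μ)).exec (i.memory μ)).trace⟩ := by
  rw [exec_bind, exec_op]

/-- The program computes `v` in at most `t` steps, without accessing the memory. -/
def Computes {α : Type} (p : Prog α) (v : α) (t : ℕ) : Prop :=
  ∀ μ, (p.exec μ).val = v ∧ (p.exec μ).mem = μ ∧ (p.exec μ).time ≤ t ∧ (p.exec μ).trace = []

lemma Computes.val {α : Type} {p : Prog α} {v : α} {t : ℕ} (h : Computes p v t) (μ : Mem) :
    (p.exec μ).val = v := (h μ).1
lemma Computes.mem {α : Type} {p : Prog α} {v : α} {t : ℕ} (h : Computes p v t) (μ : Mem) :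
    (p.exec μ).mem = μ := (h μ).2.1
lemma Computes.time {α : Type} {p : Prog α} {v : α} {t : ℕ} (h : Computes p v t) (μ : Mem) :
    (p.exec μ).time ≤ t := (h μ).2.2.1
lemma Computes.trace {α : Type} {p : Prog α} {v : α} {t : ℕ} (h : Computes p v t) (μ : Mem) :
    (p.exec μ).trace = [] := (h μ).2.2.2

/-- The constants of the sweep of a grid with `2m + 1` rows and columns. -/
def consts (m : ℕ) : Consts :=
  ⟨m, 2 * m + 1, 32 * m, (2 * m + 1) * (2 * m + 1), 2 * ((2 * m + 1) * (2 * m + 1))⟩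

lemma computes_cellIndex (m : ℕ) (i j : ℤ) : Computes (cellIndex (consts m) i j) (elevAddr m i j) 4 := by
  intro μ
  simp [cellIndex, exec_op_bind, exec_op, Instr.value, Instr.memory, Instr.accesses, consts, elevAddr]

lemma computes_inSlots (m : ℕ) (α : ℝ) :
    Computes (inSlots (consts m) α) (α / (2 * Real.pi) * (32 * (m : ℝ))) 3 := by
  intro μ
  simp [inSlots, exec_op_bind, exec_op, Instr.value, Instr.memory, Instr.accesses, consts]

/-- Azimuth angle of a corner of a cell, in `(-π, π]` if the cell lies across the direction of
azimuth zero. -/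
noncomputable def cornerAngle (across : Bool) (x y : ℝ) : ℝ :=
  if across = true ∧ Real.pi < azim x y then azim x y - 2 * Real.pi else azim x y

lemma computes_cornerAzim (b : Bool) (x y : ℝ) :
    Computes (cornerAzim b x y) (cornerAngle b x y) 3 := by
  intro μ
  by_cases h : Real.pi < azim x y <;> cases b <;>
  simp [cornerAzim, exec_op_bind, exec_op, Instr.value, Instr.memory, Instr.accesses, cornerAngle, h]

/-- Whether the cell of `(i, j)` lies across the direction of azimuth zero. -/
def isAcross (i j : ℤ) : Bool := decide (i = 0) && decide (1 ≤ j)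

/-- The smallest azimuth angle of a corner of a cell. -/
noncomputable def minAngle (i j : ℤ) : ℝ :=
  min (min (cornerAngle (isAcross i j) ((j : ℝ) - 1 / 2) (-(i : ℝ) - 1 / 2))
      (cornerAngle (isAcross i j) ((j : ℝ) - 1 / 2) (-(i : ℝ) + 1 / 2)))
    (min (cornerAngle (isAcross i j) ((j : ℝ) + 1 / 2) (-(i : ℝ) - 1 / 2))
      (cornerAngle (isAcross i j) ((j : ℝ) + 1 / 2) (-(i : ℝ) + 1 / 2)))

/-- The largest azimuth angle of a corner of a cell. -/
noncomputable def maxAngle (i j : ℤ) : ℝ :=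
  max (max (cornerAngle (isAcross i j) ((j : ℝ) - 1 / 2) (-(i : ℝ) - 1 / 2))
      (cornerAngle (isAcross i j) ((j : ℝ) - 1 / 2) (-(i : ℝ) + 1 / 2)))
    (max (cornerAngle (isAcross i j) ((j : ℝ) + 1 / 2) (-(i : ℝ) - 1 / 2))
      (cornerAngle (isAcross i j) ((j : ℝ) + 1 / 2) (-(i : ℝ) + 1 / 2)))

/-- The first slot of a cell, before reduction modulo the number of slots. -/
noncomputable def firstSlot (m : ℕ) (i j : ℤ) : ℤ :=
  ⌊minAngle i j / (2 * Real.pi) * (32 * (m : ℝ))⌋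

/-- One more than the last slot of a cell, before reduction modulo the number of slots. -/
noncomputable def endSlot (m : ℕ) (i j : ℤ) : ℤ :=
  ⌈maxAngle i j / (2 * Real.pi) * (32 * (m : ℝ))⌉

/-- Address of a slot of the horizon array. -/
def slotAddr (m : ℕ) (k : ℤ) : ℤ := 2 * ((2 * m + 1) * (2 * m + 1)) + k % (32 * m)

/-! ### The parts of the sweep -/

lemma raiseSlots_spec (m : ℕ) (β : ℝ) (hi : ℤ) (fuel : ℕ) (k : ℤ) (hf : hi - k + 1 ≤ fuel) (μ : Mem) :
    (∀ a, ((raiseSlots (consts m) β hi fuel k).exec μ).mem a =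
      open scoped Classical in
      if ∃ l, k ≤ l ∧ l ≤ hi ∧ a = slotAddr m l then max (μ a) (β : EReal) else μ a) ∧
    ((raiseSlots (consts m) β hi fuel k).exec μ).time ≤ 7 * fuel ∧
    (∀ e ∈ ((raiseSlots (consts m) β hi fuel k).exec μ).trace,
      ∃ l, k ≤ l ∧ l ≤ hi ∧ e.1 = slotAddr m l) := by
  classical
  induction fuel generalizing k μ with
  | zero =>
    refine ⟨fun a => ?_, by simp [raiseSlots], by simp [raiseSlots]⟩
    rw [if_neg]
    · simp [raiseSlots]
    · rintro ⟨l, h1, h2, -⟩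
      push_cast at hf
      omega
  | succ fuel ih =>
    by_cases hk : k ≤ hi
    · have hf' : hi - (k + 1) + 1 ≤ (fuel : ℤ) := by push_cast at hf; omega
      obtain ⟨h1, h2, h3⟩ := ih (k + 1) hf'
        (Function.update μ (slotAddr m k) (max (μ (slotAddr m k)) (β : EReal)))
      have e1 : (consts m).sBase + k % (consts m).slots = slotAddr m k := rfl
      simp only [raiseSlots, exec_op_bind, Instr.value, Instr.memory, Instr.accesses, hk,
        decide_true, if_true, e1]
      refine ⟨fun a => ?_, by omega, ?_⟩
      · rw [h1]
        by_cases ha : a = slotAddr m k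
        · subst ha
          rw [if_pos (⟨k, le_rfl, hk, rfl⟩ : ∃ l, k ≤ l ∧ l ≤ hi ∧ slotAddr m k = slotAddr m l)]
          simp
        · simp only [Function.update_of_ne ha]
          refine if_congr ⟨?_, ?_⟩ rfl rfl
          · rintro ⟨l, h1, h2, h3⟩
            exact ⟨l, by omega, h2, h3⟩
          · rintro ⟨l, h1, h2, h3⟩
            refine ⟨l, ?_, h2, h3⟩
            rcases h1.eq_or_lt with rfl | h
            · exact absurd h3 ha
            · omega
      · intro e he
        simp only [List.nil_append, List.cons_append, List.mem_cons] at he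
        rcases he with rfl | rfl | he
        · exact ⟨k, le_rfl, hk, rfl⟩
        · exact ⟨k, le_rfl, hk, rfl⟩
        · obtain ⟨l, h1, h2, h3⟩ := h3 e he
          exact ⟨l, by omega, h2, h3⟩
    · simp only [raiseSlots, exec_op_bind, Instr.value, Instr.memory, Instr.accesses, hk,
        decide_false, Bool.false_eq_true, if_false, exec_pure]
      refine ⟨fun a => ?_, by omega, by simp⟩
      rw [if_neg]
      rintro ⟨l, h1, h2, -⟩
      omega

/-- The memory after the visibility test of a grid point. -/
noncomputable def visStep (m : ℕ) (i j : ℤ) (μ : Mem) : Mem :=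
  open scoped Classical in
  Function.update μ (visAddr m i j)
    (if μ (2 * ((2 * m + 1) * (2 * m + 1)) + slotOf m i j) <
      (Real.arctan ((μ (elevAddr m i j)).toReal / dist i j) : EReal) then 1 else 0)

/-- The horizon update of a grid point. -/
noncomputable def horizonStep (m : ℕ) (i j : ℤ) (β : ℝ) : Prog Unit :=
  raiseSlots (consts m) β (endSlot m i j - 1) (endSlot m i j - firstSlot m i j + 1).toNat
    (firstSlot m i j)

lemma sweepPoint_exec (m : ℕ) (i j : ℤ) (μ : Mem) :
    let o := (horizonStep m i j
      (Real.arctan ((μ (elevAddr m i j)).toReal / dist i j))).exec (visStep m i j μ)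
    ((sweepPoint (consts m) i j).exec μ).mem = o.mem ∧
    ((sweepPoint (consts m) i j).exec μ).time ≤ 70 + o.time ∧
    ((sweepPoint (consts m) i j).exec μ).trace = [(elevAddr m i j, false),
      (2 * ((2 * m + 1) * (2 * m + 1)) + slotOf m i j, false), (visAddr m i j, true)] ++
        o.trace := by
  classical
  have hd : Real.sqrt ((j : ℝ) * j + -(i : ℝ) * -(i : ℝ)) = dist i j := by
    rw [dist]; congr 1; ring
  have hb : (decide (i = 0) && decide (1 ≤ j)) = isAcross i j := rfl
  have hs : ⌊azim (j : ℝ) (-(i : ℝ)) / (2 * Real.pi) * (32 * (m : ℝ))⌋ = slotOf m i j := rfl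
  have hv : (consts m).vBase + elevAddr m i j = visAddr m i j := by
    simp only [consts, visAddr]; ring
  have hsb : (consts m).sBase = 2 * ((2 * m + 1) * (2 * m + 1)) := rfl
  have hmin : min (min (cornerAngle (isAcross i j) ((j : ℝ) - 1 / 2) (-(i : ℝ) - 1 / 2))
      (cornerAngle (isAcross i j) ((j : ℝ) - 1 / 2) (-(i : ℝ) + 1 / 2)))
    (min (cornerAngle (isAcross i j) ((j : ℝ) + 1 / 2) (-(i : ℝ) - 1 / 2))
      (cornerAngle (isAcross i j) ((j : ℝ) + 1 / 2) (-(i : ℝ) + 1 / 2))) = minAngle i j := rfl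
  have hmax : max (max (cornerAngle (isAcross i j) ((j : ℝ) - 1 / 2) (-(i : ℝ) - 1 / 2))
      (cornerAngle (isAcross i j) ((j : ℝ) - 1 / 2) (-(i : ℝ) + 1 / 2)))
    (max (cornerAngle (isAcross i j) ((j : ℝ) + 1 / 2) (-(i : ℝ) - 1 / 2))
      (cornerAngle (isAcross i j) ((j : ℝ) + 1 / 2) (-(i : ℝ) + 1 / 2))) = maxAngle i j := rfl
  have hlo : ⌊minAngle i j / (2 * Real.pi) * (32 * (m : ℝ))⌋ = firstSlot m i j := rfl
  have hup : ⌈maxAngle i j / (2 * Real.pi) * (32 * (m : ℝ))⌉ = endSlot m i j := rfl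
  have hvis : Function.update μ (visAddr m i j)
    (if μ (2 * ((2 * m + 1) * (2 * m + 1)) + slotOf m i j) <
      (Real.arctan ((μ (elevAddr m i j)).toReal / dist i j) : EReal) then 1 else 0) =
        visStep m i j μ := rfl
  simp only [sweepPoint, exec_op_bind, exec_bind (cellIndex _ _ _), exec_bind (inSlots _ _),
    exec_bind (cornerAzim _ _ _), (computes_cellIndex m i j).val, (computes_cellIndex m i j).mem,
    (computes_cellIndex m i j).trace, (computes_inSlots m _).val, (computes_inSlots m _).mem,
    (computes_inSlots m _).trace, (computes_cornerAzim _ _ _).val, (computes_cornerAzim _ _ _).mem,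
    (computes_cornerAzim _ _ _).trace, Instr.value, Instr.memory, Instr.accesses, List.nil_append,
    zero_sub, Int.cast_neg, hd, hb, hs, hv, hsb, decide_eq_true_eq]
  simp only [hmax, hmin, hlo, hup, hvis]
  have t₁ := (computes_cellIndex m i j).time μ
  have t₂ := (computes_inSlots m (azim (j : ℝ) (-(i : ℝ)))).time μ
  have t₃ := (computes_inSlots m (minAngle i j)).time (visStep m i j μ)
  have t₄ := (computes_inSlots m (maxAngle i j)).time (visStep m i j μ)
  have t₆ := (computes_cornerAzim (isAcross i j) ((j : ℝ) - 1 / 2) (-(i : ℝ) - 1 / 2)).time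
    (visStep m i j μ)
  have t₇ := (computes_cornerAzim (isAcross i j) ((j : ℝ) - 1 / 2) (-(i : ℝ) + 1 / 2)).time
    (visStep m i j μ)
  have t₈ := (computes_cornerAzim (isAcross i j) ((j : ℝ) + 1 / 2) (-(i : ℝ) - 1 / 2)).time
    (visStep m i j μ)
  have t₉ := (computes_cornerAzim (isAcross i j) ((j : ℝ) + 1 / 2) (-(i : ℝ) + 1 / 2)).time
    (visStep m i j μ)
  simp only [horizonStep, List.cons_append, List.nil_append, true_and, and_true]
  clear hd hb hs hv hsb hmin hmax hlo hup hvis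
  generalize ((cornerAzim _ _ _).exec (visStep m i j μ)).time = n₆ at *
  generalize ((cornerAzim _ _ _).exec (visStep m i j μ)).time = n₇ at *
  generalize ((cornerAzim _ _ _).exec (visStep m i j μ)).time = n₈ at *
  generalize ((cornerAzim _ _ _).exec (visStep m i j μ)).time = n₉ at *
  generalize ((inSlots _ _).exec μ).time = n₂ at *
  generalize ((inSlots _ (minAngle i j)).exec (visStep m i j μ)).time = n₃ at *
  generalize ((inSlots _ (maxAngle i j)).exec (visStep m i j μ)).time = n₄ at *
  generalize ((raiseSlots _ _ _ _ _).exec (visStep m i j μ)).time = n at *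
  linarith

lemma sweepCell_exec_of_not_inGrid (m : ℕ) (i j : ℤ) (h : ¬ (i ≤ m ∧ j ≤ m)) (μ : Mem) :
    ((sweepCell (consts m) i j).exec μ).mem = μ ∧ ((sweepCell (consts m) i j).exec μ).time ≤ 2 ∧
    ((sweepCell (consts m) i j).exec μ).trace = [] := by
  have h' : (decide (i ≤ (consts m).m) && decide (j ≤ (consts m).m)) = false := by
    rw [← Bool.decide_and, decide_eq_false_iff_not]; exact h
  simp [sweepCell, exec_op_bind, Instr.value, Instr.memory, Instr.accesses, h', -Bool.and_eq_true]

lemma sweepCell_exec_zero (m : ℕ) (μ : Mem) :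
    ((sweepCell (consts m) 0 0).exec μ).mem = Function.update μ (visAddr m 0 0) 1 ∧
    ((sweepCell (consts m) 0 0).exec μ).time ≤ 10 ∧
    ((sweepCell (consts m) 0 0).exec μ).trace = [(visAddr m 0 0, true)] := by
  have h' : (decide ((0 : ℤ) ≤ (consts m).m)) = true := by simp [consts]
  have hv : (consts m).vBase + elevAddr m 0 0 = visAddr m 0 0 := by
    simp only [consts, visAddr]; ring
  have := (computes_cellIndex m 0 0).time μ
  simp only [sweepCell, exec_op_bind, Instr.value, Instr.memory, Instr.accesses, h', Bool.and_self,
    if_true, decide_true, exec_bind (cellIndex _ _ _), (computes_cellIndex m 0 0).val,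
    (computes_cellIndex m 0 0).mem, (computes_cellIndex m 0 0).trace, exec_op, hv]
  refine ⟨trivial, by omega, rfl⟩

lemma sweepCell_exec_of_inGrid (m : ℕ) (i j : ℤ) (hi : i ≤ m) (hj : j ≤ m) (h : (i, j) ≠ (0, 0))
    (μ : Mem) :
    ((sweepCell (consts m) i j).exec μ).mem = ((sweepPoint (consts m) i j).exec μ).mem ∧
    ((sweepCell (consts m) i j).exec μ).time = 4 + ((sweepPoint (consts m) i j).exec μ).time ∧
    ((sweepCell (consts m) i j).exec μ).trace = ((sweepPoint (consts m) i j).exec μ).trace := by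
  have h' : (decide (i ≤ (consts m).m) && decide (j ≤ (consts m).m)) = true := by
    simp [consts, hi, hj]
  have h'' : (decide (i = 0) && decide (j = 0)) = false := by
    simpa using h
  simp only [sweepCell, exec_op_bind, Instr.value, Instr.memory, Instr.accesses, h', h'', if_true,
    Bool.false_eq_true, if_false]
  refine ⟨trivial, by omega, rfl⟩

/-- Distance from zero to the closest of the integers `a, …, a + s - 1`. -/
def intervalDist (a s : ℤ) : ℤ := if a ≤ 0 ∧ 0 ≤ a + s - 1 then 0 else min |a| |a + s - 1|

lemma computes_tileDist (i j s : ℤ) :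
    Computes (tileDist i j s) (intervalDist i s + intervalDist j s) 20 := by
  intro μ
  by_cases hi : i ≤ 0 ∧ 0 ≤ i + s - 1 <;> by_cases hj : j ≤ 0 ∧ 0 ≤ j + s - 1
  all_goals
    have hi' : (decide (i ≤ 0) && decide (0 ≤ i + s - 1)) = decide (i ≤ 0 ∧ 0 ≤ i + s - 1) := by
      simp
    have hj' : (decide (j ≤ 0) && decide (0 ≤ j + s - 1)) = decide (j ≤ 0 ∧ 0 ≤ j + s - 1) := by
      simp
    simp only [tileDist, exec_op_bind, exec_op, exec_pure, Instr.value, Instr.memory,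
      Instr.accesses, hi', hj', hi, hj, intervalDist, decide_true, decide_false, Bool.and_self,
      Bool.and_false, Bool.and_true, Bool.false_eq_true, if_true, if_false, and_self]
    refine ⟨?_, trivial, by omega, rfl⟩
    omega

/-- Order of the quadrants by distance. -/
def Tile.Le (t u : Tile) : Prop := t.key ≤ u.key

instance : DecidableRel Tile.Le := fun t u => inferInstanceAs (Decidable (t.key ≤ u.key))

instance : Std.Total Tile.Le := ⟨fun t u => le_total t.key u.key⟩

instance : IsTrans Tile Tile.Le := ⟨fun _ _ _ h h' => le_trans (α := ℤ) h h'⟩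

lemma computes_insertTile (t : Tile) (l : List Tile) :
    Computes (insertTile t l) (l.orderedInsert Tile.Le t) l.length := by
  induction l with
  | nil => intro μ; simp [insertTile]
  | cons u us ih =>
    intro μ
    by_cases h : t.key ≤ u.key
    · have h' : t.Le u := h
      simp [insertTile, exec_op_bind, Instr.value, Instr.memory, Instr.accesses, h, h']
    · have h' : ¬ t.Le u := h
      obtain ⟨h1, h2, h3, h4⟩ := ih μ
      simp only [insertTile, exec_op_bind, exec_bind (insertTile t us), Instr.value, Instr.memory,
        Instr.accesses, h, decide_false, Bool.false_eq_true, if_false, exec_pure, h1, h2, h4,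
        List.orderedInsert_cons, h', List.length_cons, List.append_nil, true_and, and_true]
      omega

/-- The quadrants of a tile with halved width `h`, in the order in which they are swept. -/
def quadrants (i j h : ℤ) : List Tile :=
  List.orderedInsert Tile.Le ⟨i + h, j + h, intervalDist (i + h) h + intervalDist (j + h) h⟩
    (List.orderedInsert Tile.Le ⟨i, j + h, intervalDist i h + intervalDist (j + h) h⟩
      (List.orderedInsert Tile.Le ⟨i + h, j, intervalDist (i + h) h + intervalDist j h⟩
        (List.orderedInsert Tile.Le ⟨i, j, intervalDist i h + intervalDist j h⟩ [])))

lemma touchFrame_exec (t : ℕ) (F : ℤ) (μ : Mem) :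
    ((touchFrame t F).exec μ).mem = μ ∧ ((touchFrame t F).exec μ).time = 2 * t ∧
    ∀ e ∈ ((touchFrame t F).exec μ).trace, F ≤ e.1 ∧ e.1 < F + t := by
  induction t with
  | zero => simp [touchFrame]
  | succ t ih =>
    obtain ⟨h1, h2, h3⟩ := ih
    simp only [touchFrame, exec_op_bind, Instr.value, Instr.memory, Instr.accesses]
    refine ⟨h1, by omega, ?_⟩
    intro e he
    simp only [List.nil_append, List.cons_append, List.mem_cons] at he
    push_cast
    rcases he with rfl | he
    · simp
    · have := h3 e he
      omega

lemma clearSlots_spec (m : ℕ) (fuel : ℕ) (k : ℤ) (hk : 0 ≤ k) (hf : 32 * m - k + 1 ≤ fuel) (μ : Mem) :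
    (∀ a, ((clearSlots (consts m) fuel k).exec μ).mem a =
      open scoped Classical in
      if ∃ l, k ≤ l ∧ l < 32 * m ∧ a = slotAddr m l then ⊥ else μ a) ∧
    ((clearSlots (consts m) fuel k).exec μ).time ≤ 4 * fuel ∧
    (∀ e ∈ ((clearSlots (consts m) fuel k).exec μ).trace,
      ∃ l, k ≤ l ∧ l < 32 * m ∧ e.1 = slotAddr m l) := by
  classical
  induction fuel generalizing k μ with
  | zero =>
    refine ⟨fun a => ?_, by simp [clearSlots], by simp [clearSlots]⟩
    rw [if_neg]
    · simp [clearSlots]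
    · rintro ⟨l, h1, h2, -⟩
      push_cast at hf
      omega
  | succ fuel ih =>
    by_cases hk' : k < 32 * m
    · have hf' : 32 * m - (k + 1) + 1 ≤ (fuel : ℤ) := by push_cast at hf; omega
      obtain ⟨h1, h2, h3⟩ := ih (k + 1) (by omega) hf' (Function.update μ (slotAddr m k) ⊥)
      have e1 : (consts m).sBase + k = slotAddr m k := by
        rw [slotAddr, Int.emod_eq_of_lt hk hk']; rfl
      have e2 : ¬ (consts m).slots ≤ k := by simpa [consts] using hk'
      simp only [clearSlots, exec_op_bind, Instr.value, Instr.memory, Instr.accesses, e2,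
        decide_false, Bool.false_eq_true, if_false, e1]
      refine ⟨fun a => ?_, by omega, ?_⟩
      · rw [h1]
        by_cases ha : a = slotAddr m k
        · subst ha
          rw [if_pos (⟨k, le_rfl, hk', rfl⟩ : ∃ l, k ≤ l ∧ l < 32 * m ∧ slotAddr m k = slotAddr m l)]
          simp
        · simp only [Function.update_of_ne ha]
          refine if_congr ⟨?_, ?_⟩ rfl rfl
          · rintro ⟨l, h1, h2, h3⟩
            exact ⟨l, by omega, h2, h3⟩
          · rintro ⟨l, h1, h2, h3⟩
            refine ⟨l, ?_, h2, h3⟩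
            rcases h1.eq_or_lt with rfl | h
            · exact absurd h3 ha
            · omega
      · intro e he
        simp only [List.nil_append, List.cons_append, List.mem_cons] at he
        rcases he with rfl | he
        · exact ⟨k, le_rfl, hk', rfl⟩
        · obtain ⟨l, h1, h2, h3⟩ := h3 e he
          exact ⟨l, by omega, h2, h3⟩
    · have e2 : (consts m).slots ≤ k := by simpa [consts] using hk'
      simp only [clearSlots, exec_op_bind, Instr.value, Instr.memory, Instr.accesses, e2,
        decide_true, if_true, exec_pure]
      refine ⟨fun a => ?_, by omega, by simp⟩
      rw [if_neg]
      rintro ⟨l, h1, h2, -⟩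
      omega

lemma double_spec (m : ℕ) (fuel : ℕ) (d : ℕ) (hd : 2 ^ d < 2 * (2 * m + 1))
    (hf : 2 * m + 1 ≤ 2 ^ d * 2 ^ fuel) :
    ∃ e, 2 ^ e < 2 * (2 * m + 1) ∧ 2 * m + 1 ≤ 2 ^ e ∧
      Computes (double (2 * m + 1) fuel (2 ^ d)) (2 ^ e) (2 * fuel) := by
  induction fuel generalizing d with
  | zero => exact ⟨d, hd, by simpa using hf, fun μ => by simp [double]⟩
  | succ fuel ih =>
    by_cases h : 2 * m + 1 ≤ 2 ^ d
    · refine ⟨d, hd, h, fun μ => ?_⟩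
      have h' : (2 * (m : ℤ) + 1) ≤ 2 ^ d := by exact_mod_cast h
      simp only [double, exec_op_bind, Instr.value, Instr.memory, Instr.accesses, h', decide_true,
        if_true, exec_pure]
      refine ⟨trivial, trivial, by omega, rfl⟩
    · obtain ⟨e, h1, h2, h3⟩ := ih (d + 1) (by rw [pow_succ]; omega) (by
        rw [pow_succ] at hf ⊢; linarith)
      refine ⟨e, h1, h2, fun μ => ?_⟩
      have h' : ¬ (2 * (m : ℤ) + 1) ≤ 2 ^ d := by exact_mod_cast h
      obtain ⟨h4, h5, h6, h7⟩ := h3 μ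
      simp only [double, exec_op_bind, Instr.value, Instr.memory, Instr.accesses, h', decide_false,
        Bool.false_eq_true, if_false, ← pow_succ']
      refine ⟨h4, h5, by omega, ?_⟩
      rw [h7]; rfl

/-! ### Least-recently-used replacement -/

/-- One block access: the new cache, and the number of blocks loaded. -/
def lruStep (cap : ℕ) (cache : List (ℤ × Bool)) (e : ℤ × Bool) : List (ℤ × Bool) × ℕ :=
  match cache.find? (fun e' => e'.1 == e.1) with
  | some e' => ((e.1, e'.2 || e.2) :: cache.filter (fun e' => e'.1 != e.1), 0)
  | none => (((e.1, e.2) :: cache).take cap, 1)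

/-- The cache after a sequence of block accesses, and the number of blocks loaded. -/
def lruRun (cap : ℕ) : List (ℤ × Bool) → List (ℤ × Bool) → List (ℤ × Bool) × ℕ
  | cache, [] => (cache, 0)
  | cache, e :: l =>
    ((lruRun cap (lruStep cap cache e).1 l).1,
      (lruStep cap cache e).2 + (lruRun cap (lruStep cap cache e).1 l).2)

lemma lruRun_append (cap : ℕ) (cache l l' : List (ℤ × Bool)) :
    lruRun cap cache (l ++ l') = ((lruRun cap (lruRun cap cache l).1 l').1,
      (lruRun cap cache l).2 + (lruRun cap (lruRun cap cache l).1 l').2) := by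
  induction l generalizing cache with
  | nil => simp [lruRun]
  | cons e l ih => simp [lruRun, ih, add_assoc]

lemma lruTransfers_le (cap : ℕ) (cache l : List (ℤ × Bool)) :
    lruTransfers cap cache l ≤ cache.length + 2 * (lruRun cap cache l).2 := by
  induction l generalizing cache with
  | nil => simpa [lruTransfers, lruRun] using List.length_filter_le _ _
  | cons e l ih =>
    obtain ⟨b, w⟩ := e
    rw [lruTransfers, lruRun, lruStep]
    cases h : cache.find? (fun e' => e'.1 == b) with
    | some e' =>
      have h1 := ih ((b, e'.2 || w) :: cache.filter (fun e' => e'.1 != b))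
      have h2 : (cache.filter (fun e' => e'.1 != b)).length < cache.length := by
        refine List.length_filter_lt_length_iff_exists.2 ⟨e', List.mem_of_find?_eq_some h, ?_⟩
        have := List.find?_some h
        simpa using this
      simp only [List.length_cons] at h1
      simp only
      omega
    | none =>
      have h1 := ih (((b, w) :: cache).take cap)
      have h2 := List.length_filter_le (fun e : ℤ × Bool => e.2) (((b, w) :: cache).drop cap)
      have h3 : (((b, w) :: cache).take cap).length + (((b, w) :: cache).drop cap).length =
          cache.length + 1 := by
        rw [← List.length_append, List.take_append_drop, List.length_cons]
      simp only
      omega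

/-- From every cache, the sequence of accesses loads at most `N` blocks. -/
def Loads (cap B : ℕ) (l : List (ℤ × Bool)) (N : ℝ) : Prop :=
  ∀ cache, ((lruRun cap cache (l.map (fun e => (e.1 / (B : ℤ), e.2)))).2 : ℝ) ≤ N

lemma Loads.mono {cap B : ℕ} {l : List (ℤ × Bool)} {N N' : ℝ} (h : Loads cap B l N) (hN : N ≤ N') :
    Loads cap B l N' := fun cache => (h cache).trans hN

lemma Loads.append {cap B : ℕ} {l l' : List (ℤ × Bool)} {N N' : ℝ} (h : Loads cap B l N)
    (h' : Loads cap B l' N') : Loads cap B (l ++ l') (N + N') := by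
  intro cache
  rw [List.map_append, lruRun_append]
  push_cast
  exact add_le_add (h _) (h' _)

lemma lruRun_le_length (cap : ℕ) (cache l : List (ℤ × Bool)) :
    (lruRun cap cache l).2 ≤ l.length := by
  induction l generalizing cache with
  | nil => simp [lruRun]
  | cons e l ih =>
    have : (lruStep cap cache e).2 ≤ 1 := by
      rw [lruStep]; split <;> simp
    have := ih (lruStep cap cache e).1
    simp only [lruRun, List.length_cons]
    omega

lemma loads_length (cap B : ℕ) (l : List (ℤ × Bool)) : Loads cap B l l.length := by
  intro cache
  have := lruRun_le_length cap cache (l.map (fun e => (e.1 / (B : ℤ), e.2)))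
  rw [List.length_map] at this
  exact_mod_cast this

lemma loads_nil (cap B : ℕ) : Loads cap B [] 0 := by
  simpa using loads_length cap B []

lemma lruRun_add_length_le (cap : ℕ) (A : Finset ℤ) (hA : A.card ≤ cap) (l₁ l₂ l : List (ℤ × Bool))
    (h₁ : (l₁.map Prod.fst).Nodup) (h₁A : ∀ e ∈ l₁, e.1 ∈ A) (hl : ∀ e ∈ l, e.1 ∈ A) :
    (lruRun cap (l₁ ++ l₂) l).2 + l₁.length ≤ A.card := by
  have key : ∀ l' : List (ℤ × Bool), (l'.map Prod.fst).Nodup → (∀ e ∈ l', e.1 ∈ A) →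
      l'.length ≤ A.card := by
    intro l' h h'
    rw [← List.length_map (f := Prod.fst), ← List.toFinset_card_of_nodup h]
    refine Finset.card_le_card fun x hx => ?_
    simp only [List.mem_toFinset, List.mem_map] at hx
    obtain ⟨e, he, rfl⟩ := hx
    exact h' e he
  induction l generalizing l₁ l₂ with
  | nil => simpa [lruRun] using key l₁ h₁ h₁A
  | cons e l ih =>
    have heA : e.1 ∈ A := hl e (by simp)
    have hlA : ∀ e ∈ l, e.1 ∈ A := fun e he => hl e (by simp [he])
    rw [lruRun, lruStep]
    cases h : (l₁ ++ l₂).find? (fun e' => e'.1 == e.1) with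
    | some e' =>
      simp only [List.filter_append, ← List.cons_append, zero_add]
      have hn : (((e.1, e'.2 || e.2) :: l₁.filter (fun e' => e'.1 != e.1)).map Prod.fst).Nodup := by
        simp only [List.map_cons, List.nodup_cons]
        refine ⟨by simp, ?_⟩
        exact h₁.sublist (List.filter_sublist.map _)
      have := ih _ (l₂.filter (fun e' => e'.1 != e.1)) hn (by
        intro x hx
        rcases List.mem_cons.1 hx with rfl | hx
        · exact heA
        · exact h₁A x (List.mem_of_mem_filter hx)) hlA
      refine le_trans ?_ this
      gcongr
      rw [List.length_cons]
      have hc : l₁.length = (l₁.filter (fun e' => e'.1 != e.1)).length +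
          (l₁.filter (fun e' => !(e'.1 != e.1))).length :=
        List.length_eq_length_filter_add _
      have : (l₁.filter (fun e' => !(e'.1 != e.1))).length ≤ 1 := by
        have h2 : ((l₁.filter (fun e' => !(e'.1 != e.1))).map Prod.fst).Nodup :=
          h₁.sublist (List.filter_sublist.map _)
        rw [← List.length_map (f := Prod.fst), ← List.toFinset_card_of_nodup h2,
          ← Finset.card_singleton e.1]
        refine Finset.card_le_card fun x hx => ?_
        simp only [List.mem_toFinset, List.mem_map, List.mem_filter] at hx
        obtain ⟨y, ⟨-, hy⟩, rfl⟩ := hx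
        simpa using hy
      omega
    | none =>
      have hne : ∀ x ∈ l₁, x.1 ≠ e.1 := by
        intro x hx
        have := List.find?_eq_none.1 h x (by simp [hx])
        simpa using this
      have hn : ((e :: l₁).map Prod.fst).Nodup := by
        simp only [List.map_cons, List.nodup_cons]
        refine ⟨?_, h₁⟩
        intro hx
        obtain ⟨x, hx, hxe⟩ := List.mem_map.1 hx
        exact hne x hx hxe
      have hA' : ∀ x ∈ e :: l₁, x.1 ∈ A := by
        intro x hx
        rcases List.mem_cons.1 hx with rfl | hx
        · exact heA
        · exact h₁A x hx
      have hlen := (key _ hn hA').trans hA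
      have := ih (e :: l₁) (l₂.take (cap - (e :: l₁).length)) hn hA' hlA
      have ht : (e :: (l₁ ++ l₂)).take cap = (e :: l₁) ++ l₂.take (cap - (e :: l₁).length) := by
        rw [← List.cons_append, List.take_append, List.take_of_length_le hlen]
      simp only [ht]
      have hc : (e :: l₁).length = l₁.length + 1 := rfl
      rw [hc] at this ⊢
      omega

lemma loads_of_card_le {cap B : ℕ} {l : List (ℤ × Bool)} (A : Finset ℤ) (hA : A.card ≤ cap)
    (h : ∀ e ∈ l, e.1 / (B : ℤ) ∈ A) : Loads cap B l A.card := by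
  intro cache
  have := lruRun_add_length_le cap A hA [] cache (l.map (fun e => (e.1 / (B : ℤ), e.2))) (by simp)
    (by simp) (by
      intro e he
      obtain ⟨x, hx, rfl⟩ := List.mem_map.1 he
      exact h x hx)
  simp only [List.nil_append, List.length_nil, add_zero] at this
  exact_mod_cast this

lemma Loads.blockTransfers_le {M B : ℕ} {l : List (ℤ × Bool)} {N : ℝ} (h : Loads (M / B) B l N) :
    (blockTransfers M B l : ℝ) ≤ 2 * N := by
  have h1 := lruTransfers_le (M / B) [] (l.map (fun e => (e.1 / (B : ℤ), e.2)))
  have h2 := h []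
  rw [List.length_nil, zero_add] at h1
  have h3 : (blockTransfers M B l : ℝ) ≤
      2 * ((lruRun (M / B) [] (l.map (fun e => (e.1 / (B : ℤ), e.2)))).2 : ℝ) := by
    exact_mod_cast h1
  linarith

/-- An interval of `L` addresses meets at most `L / B + 2` blocks. -/
lemma exists_finset_blocks (B : ℕ) (hB : 1 ≤ B) (a : ℤ) (L : ℕ) :
    ∃ A : Finset ℤ, (A.card : ℝ) ≤ L / B + 2 ∧ ∀ x, a ≤ x → x < a + L → x / (B : ℤ) ∈ A := by
  refine ⟨Finset.Icc (a / B) ((a + L) / B), ?_, fun x h1 h2 => ?_⟩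
  · have hB' : (0 : ℤ) < B := by exact_mod_cast hB
    have hBr : (0 : ℝ) < B := by exact_mod_cast hB
    rw [Int.card_Icc]
    have h1 : a / B ≤ (a + L) / B := Int.ediv_le_ediv hB' (by omega)
    have h2 : (((a + L) / B + 1 - a / B).toNat : ℝ) = ((a + L) / B + 1 - a / B : ℤ) := by
      have : ((((a + L) / B + 1 - a / B).toNat : ℤ) : ℝ) = ((a + L) / B + 1 - a / B : ℤ) := by
        rw [Int.toNat_of_nonneg (by omega)]
      exact_mod_cast this
    rw [h2]
    have h3 : ((a + L) / B) * B ≤ a + L := Int.ediv_mul_le _ hB'.ne'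
    have h4 : a < (a / B + 1) * B := Int.lt_ediv_add_one_mul_self _ hB'
    have h5 : ((a + L) / B + 1 - a / B - 2) * B ≤ (L : ℤ) := by nlinarith
    have h6 : (((a + L) / B + 1 - a / B : ℤ) - 2 : ℝ) * B ≤ L := by exact_mod_cast h5
    have := (le_div_iff₀ hBr).2 h6
    linarith
  · have hB' : (0 : ℤ) < B := by exact_mod_cast hB
    rw [Finset.mem_Icc]
    exact ⟨Int.ediv_le_ediv hB' h1, Int.ediv_le_ediv hB' h2.le⟩

/-! ### Azimuth angles -/

lemma azim_nonneg (x y : ℝ) : 0 ≤ azim x y := by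
  have := Complex.neg_pi_lt_arg ⟨x, y⟩
  rw [azim]; split_ifs <;> linarith [Real.pi_pos]

lemma azim_lt (x y : ℝ) : azim x y < 2 * Real.pi := by
  have := Complex.arg_le_pi ⟨x, y⟩
  rw [azim]; split_ifs <;> linarith [Real.pi_pos]

lemma cos_azim (x y : ℝ) : Real.cos (azim x y) = Real.cos (Complex.arg ⟨x, y⟩) := by
  rw [azim]; split_ifs <;> simp

lemma sin_azim (x y : ℝ) : Real.sin (azim x y) = Real.sin (Complex.arg ⟨x, y⟩) := by
  rw [azim]; split_ifs <;> simp

lemma norm_mk (x y : ℝ) : ‖(⟨x, y⟩ : ℂ)‖ = Real.sqrt (x ^ 2 + y ^ 2) := by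
  rw [Complex.norm_def, Complex.normSq_mk]; ring_nf

lemma sqrt_mul_cos_azim (x y : ℝ) : Real.sqrt (x ^ 2 + y ^ 2) * Real.cos (azim x y) = x := by
  rw [cos_azim, ← norm_mk, Complex.norm_mul_cos_arg]

lemma sqrt_mul_sin_azim (x y : ℝ) : Real.sqrt (x ^ 2 + y ^ 2) * Real.sin (azim x y) = y := by
  rw [sin_azim, ← norm_mk, Complex.norm_mul_sin_arg]

lemma sqrt_mul_cos_cornerAngle (b : Bool) (x y : ℝ) :
    Real.sqrt (x ^ 2 + y ^ 2) * Real.cos (cornerAngle b x y) = x := by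
  rw [cornerAngle]; split_ifs
  · rw [Real.cos_sub_two_pi, sqrt_mul_cos_azim]
  · rw [sqrt_mul_cos_azim]

lemma sqrt_mul_sin_cornerAngle (b : Bool) (x y : ℝ) :
    Real.sqrt (x ^ 2 + y ^ 2) * Real.sin (cornerAngle b x y) = y := by
  rw [cornerAngle]; split_ifs
  · rw [Real.sin_sub_two_pi, sqrt_mul_sin_azim]
  · rw [sqrt_mul_sin_azim]

lemma abs_lt_pi_div_two_of_cos_pos {φ : ℝ} (h : 0 < Real.cos φ)
    (h₁ : |φ| ≤ 3 * Real.pi / 2) : |φ| < Real.pi / 2 := by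
  by_contra! hc
  have := Real.cos_nonpos_of_pi_div_two_le_of_le hc (by linarith)
  rw [Real.cos_abs] at this
  linarith

/-- The directions of the points of a cell other than that of the viewpoint lie in an open
half-plane, and the azimuth angles that are computed for its corners in an interval of length
`π`. -/
lemma exists_window (i j : ℤ) (h : (i, j) ≠ (0, 0)) : ∃ w : ℝ, ∀ x y : ℝ,
    |x - j| ≤ 1 / 2 → |y + i| ≤ 1 / 2 → 0 < x * Real.cos w + y * Real.sin w ∧
      |cornerAngle (isAcross i j) x y - w| < Real.pi / 2 := by
  have hπ := Real.pi_pos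
  have key : ∀ (w x y : ℝ), 0 < x * Real.cos w + y * Real.sin w →
      |cornerAngle (isAcross i j) x y - w| ≤ 3 * Real.pi / 2 →
      |cornerAngle (isAcross i j) x y - w| < Real.pi / 2 := by
    intro w x y h1 h2
    refine abs_lt_pi_div_two_of_cos_pos ?_ h2
    rw [Real.cos_sub]
    have e1 := sqrt_mul_cos_cornerAngle (isAcross i j) x y
    have e2 := sqrt_mul_sin_cornerAngle (isAcross i j) x y
    have h3 : 0 < Real.sqrt (x ^ 2 + y ^ 2) * (Real.cos (cornerAngle (isAcross i j) x y) * Real.cos w +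
        Real.sin (cornerAngle (isAcross i j) x y) * Real.sin w) := by
      rw [mul_add, ← mul_assoc, ← mul_assoc, e1, e2]; exact h1
    exact pos_of_mul_pos_right h3 (Real.sqrt_nonneg _)
  have hne : isAcross i j = false → ∀ x y, cornerAngle (isAcross i j) x y = azim x y := by
    intro h x y; simp [cornerAngle, h]
  rcases lt_trichotomy i 0 with hi | hi | hi
  · have hb : isAcross i j = false := by simp [isAcross, hi.ne]
    have hi' : (i : ℝ) ≤ -1 := by exact_mod_cast (by omega : i ≤ -1)
    refine ⟨Real.pi / 2, fun x y hx hy => ?_⟩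
    have h1 : 0 < x * Real.cos (Real.pi / 2) + y * Real.sin (Real.pi / 2) := by
      simp only [Real.cos_pi_div_two, Real.sin_pi_div_two]
      linarith [(abs_le.1 hy).1]
    refine ⟨h1, key _ _ _ h1 ?_⟩
    rw [hne hb, abs_le]
    constructor <;> linarith [azim_nonneg x y, azim_lt x y]
  · have hj : j ≠ 0 := by rintro rfl; exact h (by rw [hi])
    rcases lt_or_gt_of_ne hj with hj | hj
    · have hb : isAcross i j = false := by simp [isAcross]; omega
      have hj' : (j : ℝ) ≤ -1 := by exact_mod_cast (by omega : j ≤ -1)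
      refine ⟨Real.pi, fun x y hx hy => ?_⟩
      have h1 : 0 < x * Real.cos Real.pi + y * Real.sin Real.pi := by
        simp only [Real.cos_pi, Real.sin_pi]
        linarith [(abs_le.1 hx).2]
      refine ⟨h1, key _ _ _ h1 ?_⟩
      rw [hne hb, abs_le]
      constructor <;> linarith [azim_nonneg x y, azim_lt x y]
    · have hb : isAcross i j = true := by simp [isAcross]; omega
      have hj' : (1 : ℝ) ≤ j := by exact_mod_cast (by omega : 1 ≤ j)
      refine ⟨0, fun x y hx hy => ?_⟩
      have h1 : 0 < x * Real.cos 0 + y * Real.sin 0 := by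
        simp only [Real.cos_zero, Real.sin_zero]
        linarith [(abs_le.1 hx).1]
      refine ⟨h1, key _ _ _ h1 ?_⟩
      rw [cornerAngle, abs_le]
      split_ifs with h2
      · constructor <;> linarith [h2.2, azim_lt x y]
      · have h3 : azim x y ≤ Real.pi := by
          by_contra! h4
          exact h2 ⟨hb, h4⟩
        constructor <;> linarith [azim_nonneg x y]
  · have hb : isAcross i j = false := by simp [isAcross, hi.ne']
    have hi' : (1 : ℝ) ≤ i := by exact_mod_cast (by omega : 1 ≤ i)
    refine ⟨Real.pi / 2 + Real.pi, fun x y hx hy => ?_⟩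
    have h1 : 0 < x * Real.cos (Real.pi / 2 + Real.pi) + y * Real.sin (Real.pi / 2 + Real.pi) := by
      simp only [Real.cos_add_pi, Real.sin_add_pi, Real.cos_pi_div_two, Real.sin_pi_div_two]
      linarith [(abs_le.1 hy).2]
    refine ⟨h1, key _ _ _ h1 ?_⟩
    rw [hne hb, abs_le]
    constructor <;> linarith [azim_nonneg x y, azim_lt x y]

/-- `(x, y)` is a corner of the cell of `(i, j)`. -/
def IsCorner (i j : ℤ) (x y : ℝ) : Prop :=
  (x = j - 1 / 2 ∨ x = j + 1 / 2) ∧ (y = -i - 1 / 2 ∨ y = -i + 1 / 2)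

lemma IsCorner.mem_cell {i j : ℤ} {x y : ℝ} (h : IsCorner i j x y) : (x, y) ∈ cell i j := by
  obtain ⟨rfl | rfl, rfl | rfl⟩ := h <;> constructor <;> simp only [abs_le] <;>
    constructor <;> linarith

lemma minAngle_le {i j : ℤ} {x y : ℝ} (h : IsCorner i j x y) :
    minAngle i j ≤ cornerAngle (isAcross i j) x y := by
  obtain ⟨rfl | rfl, rfl | rfl⟩ := h <;> simp [minAngle]

lemma le_maxAngle {i j : ℤ} {x y : ℝ} (h : IsCorner i j x y) :
    cornerAngle (isAcross i j) x y ≤ maxAngle i j := by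
  obtain ⟨rfl | rfl, rfl | rfl⟩ := h <;> simp [maxAngle]

lemma exists_corner_minAngle (i j : ℤ) :
    ∃ x y, IsCorner i j x y ∧ minAngle i j = cornerAngle (isAcross i j) x y := by
  rw [minAngle]
  rcases min_choice (min (cornerAngle (isAcross i j) ((j : ℝ) - 1 / 2) (-(i : ℝ) - 1 / 2))
      (cornerAngle (isAcross i j) ((j : ℝ) - 1 / 2) (-(i : ℝ) + 1 / 2)))
    (min (cornerAngle (isAcross i j) ((j : ℝ) + 1 / 2) (-(i : ℝ) - 1 / 2))
      (cornerAngle (isAcross i j) ((j : ℝ) + 1 / 2) (-(i : ℝ) + 1 / 2))) with h | h <;> rw [h]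
  · rcases min_choice (cornerAngle (isAcross i j) ((j : ℝ) - 1 / 2) (-(i : ℝ) - 1 / 2))
      (cornerAngle (isAcross i j) ((j : ℝ) - 1 / 2) (-(i : ℝ) + 1 / 2)) with h | h <;> rw [h]
    · exact ⟨_, _, ⟨.inl rfl, .inl rfl⟩, rfl⟩
    · exact ⟨_, _, ⟨.inl rfl, .inr rfl⟩, rfl⟩
  · rcases min_choice (cornerAngle (isAcross i j) ((j : ℝ) + 1 / 2) (-(i : ℝ) - 1 / 2))
      (cornerAngle (isAcross i j) ((j : ℝ) + 1 / 2) (-(i : ℝ) + 1 / 2)) with h | h <;> rw [h]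
    · exact ⟨_, _, ⟨.inr rfl, .inl rfl⟩, rfl⟩
    · exact ⟨_, _, ⟨.inr rfl, .inr rfl⟩, rfl⟩

lemma exists_corner_maxAngle (i j : ℤ) :
    ∃ x y, IsCorner i j x y ∧ maxAngle i j = cornerAngle (isAcross i j) x y := by
  rw [maxAngle]
  rcases max_choice (max (cornerAngle (isAcross i j) ((j : ℝ) - 1 / 2) (-(i : ℝ) - 1 / 2))
      (cornerAngle (isAcross i j) ((j : ℝ) - 1 / 2) (-(i : ℝ) + 1 / 2)))
    (max (cornerAngle (isAcross i j) ((j : ℝ) + 1 / 2) (-(i : ℝ) - 1 / 2))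
      (cornerAngle (isAcross i j) ((j : ℝ) + 1 / 2) (-(i : ℝ) + 1 / 2))) with h | h <;> rw [h]
  · rcases max_choice (cornerAngle (isAcross i j) ((j : ℝ) - 1 / 2) (-(i : ℝ) - 1 / 2))
      (cornerAngle (isAcross i j) ((j : ℝ) - 1 / 2) (-(i : ℝ) + 1 / 2)) with h | h <;> rw [h]
    · exact ⟨_, _, ⟨.inl rfl, .inl rfl⟩, rfl⟩
    · exact ⟨_, _, ⟨.inl rfl, .inr rfl⟩, rfl⟩
  · rcases max_choice (cornerAngle (isAcross i j) ((j : ℝ) + 1 / 2) (-(i : ℝ) - 1 / 2))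
      (cornerAngle (isAcross i j) ((j : ℝ) + 1 / 2) (-(i : ℝ) + 1 / 2)) with h | h <;> rw [h]
    · exact ⟨_, _, ⟨.inr rfl, .inl rfl⟩, rfl⟩
    · exact ⟨_, _, ⟨.inr rfl, .inr rfl⟩, rfl⟩

lemma half_ne_intCast (j : ℤ) : (j : ℝ) - 1 / 2 ≠ 0 := by
  intro h
  have h1 : 2 * (j : ℝ) = 1 := by linarith
  have h2 : 2 * j = 1 := by exact_mod_cast h1
  omega

lemma minAngle_lt_maxAngle (i j : ℤ) : minAngle i j < maxAngle i j := by
  by_contra! hc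
  have h1 : IsCorner i j ((j : ℝ) - 1 / 2) (-(i : ℝ) - 1 / 2) := ⟨.inl rfl, .inl rfl⟩
  have h2 : IsCorner i j ((j : ℝ) - 1 / 2) (-(i : ℝ) + 1 / 2) := ⟨.inl rfl, .inr rfl⟩
  have h3 : cornerAngle (isAcross i j) ((j : ℝ) - 1 / 2) (-(i : ℝ) - 1 / 2) =
      cornerAngle (isAcross i j) ((j : ℝ) - 1 / 2) (-(i : ℝ) + 1 / 2) := by
    linarith [minAngle_le h1, minAngle_le h2, le_maxAngle h1, le_maxAngle h2]
  have e1 := sqrt_mul_cos_cornerAngle (isAcross i j) ((j : ℝ) - 1 / 2) (-(i : ℝ) - 1 / 2)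
  have e2 := sqrt_mul_sin_cornerAngle (isAcross i j) ((j : ℝ) - 1 / 2) (-(i : ℝ) - 1 / 2)
  have e3 := sqrt_mul_cos_cornerAngle (isAcross i j) ((j : ℝ) - 1 / 2) (-(i : ℝ) + 1 / 2)
  have e4 := sqrt_mul_sin_cornerAngle (isAcross i j) ((j : ℝ) - 1 / 2) (-(i : ℝ) + 1 / 2)
  rw [h3] at e1 e2
  have hne := half_ne_intCast j
  have hc : Real.cos (cornerAngle (isAcross i j) ((j : ℝ) - 1 / 2) (-(i : ℝ) + 1 / 2)) ≠ 0 := by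
    intro h; rw [h, mul_zero] at e1; exact hne e1.symm
  have h5 := mul_right_cancel₀ hc (e1.trans e3.symm)
  rw [h5, e4] at e2
  linarith

lemma affine_nonneg_of_corners {i j : ℤ} {a b : ℝ} (h : ∀ x y, IsCorner i j x y → 0 ≤ a * x + b * y)
    {x y : ℝ} (hp : (x, y) ∈ cell i j) : 0 ≤ a * x + b * y := by
  have h1 := h _ _ (⟨.inl rfl, .inl rfl⟩ : IsCorner i j ((j : ℝ) - 1 / 2) (-(i : ℝ) - 1 / 2))
  have h2 := h _ _ (⟨.inl rfl, .inr rfl⟩ : IsCorner i j ((j : ℝ) - 1 / 2) (-(i : ℝ) + 1 / 2))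
  have h3 := h _ _ (⟨.inr rfl, .inl rfl⟩ : IsCorner i j ((j : ℝ) + 1 / 2) (-(i : ℝ) - 1 / 2))
  have h4 := h _ _ (⟨.inr rfl, .inr rfl⟩ : IsCorner i j ((j : ℝ) + 1 / 2) (-(i : ℝ) + 1 / 2))
  obtain ⟨hx, hy⟩ := hp
  obtain ⟨hx1, hx2⟩ := abs_le.1 hx
  obtain ⟨hy1, hy2⟩ := abs_le.1 hy
  simp only at hx1 hx2 hy1 hy2
  rcases le_total 0 a with ha | ha <;> rcases le_total 0 b with hb | hb <;> nlinarith

lemma exists_int_abs_add_le_pi (φ : ℝ) : ∃ z : ℤ, |φ + 2 * Real.pi * z| ≤ Real.pi := by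
  have hπ := Real.pi_pos
  refine ⟨-⌊(φ + Real.pi) / (2 * Real.pi)⌋, ?_⟩
  have h1 := Int.floor_le ((φ + Real.pi) / (2 * Real.pi))
  have h2 := Int.lt_floor_add_one ((φ + Real.pi) / (2 * Real.pi))
  rw [le_div_iff₀ (by positivity)] at h1
  rw [div_lt_iff₀ (by positivity)] at h2
  rw [abs_le]
  push_cast
  constructor <;> linarith

lemma cos_add_two_pi_mul (φ : ℝ) (z : ℤ) : Real.cos (φ + 2 * Real.pi * z) = Real.cos φ := by
  rw [mul_comm, Real.cos_add_int_mul_two_pi]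

lemma sin_add_two_pi_mul (φ : ℝ) (z : ℤ) : Real.sin (φ + 2 * Real.pi * z) = Real.sin φ := by
  rw [mul_comm, Real.sin_add_int_mul_two_pi]

lemma sin_nonneg_iff_of_abs_lt {φ : ℝ} (h : |φ| < Real.pi) : 0 ≤ Real.sin φ ↔ 0 ≤ φ := by
  obtain ⟨h1, h2⟩ := abs_lt.1 h
  refine ⟨fun h3 => ?_, fun h3 => Real.sin_nonneg_of_nonneg_of_le_pi h3 h2.le⟩
  by_contra! h4
  linarith [Real.sin_neg_of_neg_of_neg_pi_lt h4 h1]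

/-- The directions of the points of a cell. -/
lemma exists_ray_mem_cell_iff (i j : ℤ) (h : (i, j) ≠ (0, 0)) (θ : ℝ) :
    (∃ ρ : ℝ, 0 < ρ ∧ (ρ * Real.cos θ, ρ * Real.sin θ) ∈ cell i j) ↔
      ∃ z : ℤ, minAngle i j ≤ θ + 2 * Real.pi * z ∧ θ + 2 * Real.pi * z ≤ maxAngle i j := by
  have hπ := Real.pi_pos
  obtain ⟨w, hw⟩ := exists_window i j h
  have hwc : ∀ x y, IsCorner i j x y → |cornerAngle (isAcross i j) x y - w| < Real.pi / 2 :=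
    fun x y hc => (hw x y hc.mem_cell.1 hc.mem_cell.2).2
  obtain ⟨x₁, y₁, hc₁, he₁⟩ := exists_corner_minAngle i j
  obtain ⟨x₂, y₂, hc₂, he₂⟩ := exists_corner_maxAngle i j
  have hmin := hwc _ _ hc₁
  have hmax := hwc _ _ hc₂
  rw [← he₁, abs_lt] at hmin
  rw [← he₂, abs_lt] at hmax
  constructor
  · rintro ⟨ρ, hρ, hp⟩
    have h1 := (hw _ _ hp.1 hp.2).1
    have h2 : 0 < ρ * Real.cos (θ - w) := by rw [Real.cos_sub]; linarith
    have h3 := pos_of_mul_pos_right h2 hρ.le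
    obtain ⟨z, hz⟩ := exists_int_abs_add_le_pi (θ - w)
    refine ⟨z, ?_⟩
    have h4 : |θ + 2 * Real.pi * z - w| < Real.pi / 2 := by
      rw [show θ + 2 * Real.pi * z - w = θ - w + 2 * Real.pi * z by ring]
      refine abs_lt_pi_div_two_of_cos_pos ?_ (by linarith)
      rw [cos_add_two_pi_mul]; exact h3
    rw [← cos_add_two_pi_mul θ z, ← sin_add_two_pi_mul θ z] at hp
    generalize θ + 2 * Real.pi * z = θ' at hp h4
    rw [abs_lt] at h4
    constructor
    · have h5 : 0 ≤ -Real.sin (minAngle i j) * (ρ * Real.cos θ') +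
          Real.cos (minAngle i j) * (ρ * Real.sin θ') := by
        refine affine_nonneg_of_corners (fun x y hc => ?_) hp
        have h6 := hwc x y hc
        have h7 := minAngle_le hc
        rw [abs_lt] at h6
        have h8 : 0 ≤ Real.sin (cornerAngle (isAcross i j) x y - minAngle i j) :=
          Real.sin_nonneg_of_nonneg_of_le_pi (by linarith) (by linarith)
        have h9 := mul_nonneg (Real.sqrt_nonneg (x ^ 2 + y ^ 2)) h8
        rw [Real.sin_sub, mul_sub, ← mul_assoc, ← mul_assoc, sqrt_mul_cos_cornerAngle,
          sqrt_mul_sin_cornerAngle] at h9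
        linarith
      have h6 : 0 ≤ ρ * Real.sin (θ' - minAngle i j) := by rw [Real.sin_sub]; linarith
      have h7 := nonneg_of_mul_nonneg_right h6 hρ
      rw [sin_nonneg_iff_of_abs_lt (by rw [abs_lt]; constructor <;> linarith)] at h7
      linarith
    · have h5 : 0 ≤ Real.sin (maxAngle i j) * (ρ * Real.cos θ') +
          -Real.cos (maxAngle i j) * (ρ * Real.sin θ') := by
        refine affine_nonneg_of_corners (fun x y hc => ?_) hp
        have h6 := hwc x y hc
        have h7 := le_maxAngle hc
        rw [abs_lt] at h6
        have h8 : 0 ≤ Real.sin (maxAngle i j - cornerAngle (isAcross i j) x y) :=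
          Real.sin_nonneg_of_nonneg_of_le_pi (by linarith) (by linarith)
        have h9 := mul_nonneg (Real.sqrt_nonneg (x ^ 2 + y ^ 2)) h8
        have e1 := sqrt_mul_cos_cornerAngle (isAcross i j) x y
        have e2 := sqrt_mul_sin_cornerAngle (isAcross i j) x y
        rw [Real.sin_sub] at h9
        have h10 : Real.sqrt (x ^ 2 + y ^ 2) * (Real.sin (maxAngle i j) *
          Real.cos (cornerAngle (isAcross i j) x y) - Real.cos (maxAngle i j) *
          Real.sin (cornerAngle (isAcross i j) x y)) =
          Real.sin (maxAngle i j) * x + -Real.cos (maxAngle i j) * y := by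
          linear_combination Real.sin (maxAngle i j) * e1 - Real.cos (maxAngle i j) * e2
        rwa [h10] at h9
      have h6 : 0 ≤ ρ * Real.sin (maxAngle i j - θ') := by rw [Real.sin_sub]; linarith
      have h7 := nonneg_of_mul_nonneg_right h6 hρ
      rw [sin_nonneg_iff_of_abs_lt (by rw [abs_lt]; constructor <;> linarith)] at h7
      linarith
  · rintro ⟨z, hz₁, hz₂⟩
    rw [← cos_add_two_pi_mul θ z, ← sin_add_two_pi_mul θ z]
    generalize θ + 2 * Real.pi * z = θ' at hz₁ hz₂
    have hlt := minAngle_lt_maxAngle i j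
    have e1 := sqrt_mul_cos_cornerAngle (isAcross i j) x₁ y₁
    have e2 := sqrt_mul_sin_cornerAngle (isAcross i j) x₁ y₁
    have e3 := sqrt_mul_cos_cornerAngle (isAcross i j) x₂ y₂
    have e4 := sqrt_mul_sin_cornerAngle (isAcross i j) x₂ y₂
    rw [← he₁] at e1 e2
    rw [← he₂] at e3 e4
    have hpos : ∀ x y, IsCorner i j x y → 0 < Real.sqrt (x ^ 2 + y ^ 2) := by
      intro x y hc
      refine Real.sqrt_pos.2 ?_
      have : x ≠ 0 := by
        rcases hc.1 with rfl | rfl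
        · exact half_ne_intCast j
        · have := half_ne_intCast (j + 1)
          push_cast at this
          intro h; apply this; linarith
      positivity
    have r1 := hpos _ _ hc₁
    have r2 := hpos _ _ hc₂
    set s₁ := Real.sqrt (x₁ ^ 2 + y₁ ^ 2)
    set s₂ := Real.sqrt (x₂ ^ 2 + y₂ ^ 2)
    have n1 : 0 ≤ Real.sin (maxAngle i j - θ') :=
      Real.sin_nonneg_of_nonneg_of_le_pi (by linarith) (by linarith)
    have n2 : 0 ≤ Real.sin (θ' - minAngle i j) :=
      Real.sin_nonneg_of_nonneg_of_le_pi (by linarith) (by linarith)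
    have n3 : 0 < Real.sin (maxAngle i j - minAngle i j) :=
      Real.sin_pos_of_pos_of_lt_pi (by linarith) (by linarith)
    have hsum : 0 < s₂ * Real.sin (maxAngle i j - θ') + s₁ * Real.sin (θ' - minAngle i j) := by
      rcases hz₁.eq_or_lt with h1 | h1
      · rw [← h1, sub_self, Real.sin_zero]; positivity
      · have : 0 < Real.sin (θ' - minAngle i j) :=
          Real.sin_pos_of_pos_of_lt_pi (by linarith) (by linarith)
        positivity
    set a := s₂ * Real.sin (maxAngle i j - θ') with ha
    set b := s₁ * Real.sin (θ' - minAngle i j) with hb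
    have ha0 : 0 ≤ a := by positivity
    have hb0 : 0 ≤ b := by positivity
    refine ⟨s₁ * s₂ * Real.sin (maxAngle i j - minAngle i j) / (a + b), by positivity, ?_⟩
    have q1 : s₁ * s₂ * Real.sin (maxAngle i j - minAngle i j) / (a + b) * Real.cos θ' =
        (a * x₁ + b * x₂) / (a + b) := by
      rw [div_mul_eq_mul_div, ← e1, ← e3, ha, hb, Real.sin_sub, Real.sin_sub, Real.sin_sub]
      congr 1; ring
    have q2 : s₁ * s₂ * Real.sin (maxAngle i j - minAngle i j) / (a + b) * Real.sin θ' =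
        (a * y₁ + b * y₂) / (a + b) := by
      rw [div_mul_eq_mul_div, ← e2, ← e4, ha, hb, Real.sin_sub, Real.sin_sub, Real.sin_sub]
      congr 1; ring
    rw [q1, q2]
    obtain ⟨u1, u2⟩ := hc₁.mem_cell
    obtain ⟨u3, u4⟩ := hc₂.mem_cell
    simp only [abs_le] at u1 u2 u3 u4
    clear_value a b
    constructor
    · simp only
      rw [div_sub' hsum.ne', abs_div, abs_of_pos hsum, div_le_iff₀ hsum, abs_le]
      constructor
      · linarith [mul_le_mul_of_nonneg_left u1.1 ha0, mul_le_mul_of_nonneg_left u3.1 hb0]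
      · linarith [mul_le_mul_of_nonneg_left u1.2 ha0, mul_le_mul_of_nonneg_left u3.2 hb0]
    · simp only
      rw [div_add' _ _ _ hsum.ne', abs_div, abs_of_pos hsum, div_le_iff₀ hsum, abs_le]
      constructor
      · linarith [mul_le_mul_of_nonneg_left u2.1 ha0, mul_le_mul_of_nonneg_left u4.1 hb0]
      · linarith [mul_le_mul_of_nonneg_left u2.2 ha0, mul_le_mul_of_nonneg_left u4.2 hb0]

/-- Two points that are close to each other and far from the viewpoint have similar directions. -/
lemma exists_angle_close {ρ ρ' θ θ' D R : ℝ} (hρ : 0 ≤ ρ) (hR : 0 < R) (hρ' : R ≤ ρ')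
    (h₁ : |ρ * Real.cos θ - ρ' * Real.cos θ'| ≤ D) (h₂ : |ρ * Real.sin θ - ρ' * Real.sin θ'| ≤ D) :
    ∃ z : ℤ, |θ - θ' + 2 * Real.pi * z| ≤ 2 * Real.pi * (D / R) := by
  have hπ := Real.pi_pos
  obtain ⟨z, hz⟩ := exists_int_abs_add_le_pi (θ - θ')
  refine ⟨z, ?_⟩
  have hD : 0 ≤ D := (abs_nonneg _).trans h₁
  have hs := sin_add_two_pi_mul (θ - θ') z
  have hc := cos_add_two_pi_mul (θ - θ') z
  generalize θ - θ' + 2 * Real.pi * z = x at *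
  have bound : ∀ φ : ℝ, |Real.cos φ * (ρ * Real.cos θ - ρ' * Real.cos θ')| ≤ D ∧
      |Real.sin φ * (ρ * Real.sin θ - ρ' * Real.sin θ')| ≤ D ∧
      |Real.sin φ * (ρ * Real.cos θ - ρ' * Real.cos θ')| ≤ D ∧
      |Real.cos φ * (ρ * Real.sin θ - ρ' * Real.sin θ')| ≤ D := by
    intro φ
    simp only [abs_mul (Real.cos φ), abs_mul (Real.sin φ)]
    have := Real.abs_cos_le_one φ
    have := Real.abs_sin_le_one φ
    refine ⟨?_, ?_, ?_, ?_⟩ <;>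
    exact (mul_le_of_le_one_left (abs_nonneg _) (by assumption)).trans (by assumption)
  rcases le_or_gt 0 (Real.cos x) with hx | hx
  · have h3 : |x| ≤ Real.pi / 2 := by
      by_contra! h
      have := Real.cos_neg_of_pi_div_two_lt_of_lt h (by linarith)
      rw [Real.cos_abs] at this
      linarith
    have h4 := Real.mul_abs_le_abs_sin h3
    have h5 : ρ' * |Real.sin x| ≤ 2 * D := by
      rw [hs, ← abs_of_pos (hR.trans_le hρ'), ← abs_mul, Real.sin_sub]
      obtain ⟨-, -, b1, b2⟩ := bound θ
      rw [abs_le] at *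
      constructor <;> nlinarith [Real.sin_sq_add_cos_sq θ]
    have h6 : R * (2 / Real.pi * |x|) ≤ 2 * D :=
      (mul_le_mul hρ' h4 (by positivity) (by linarith)).trans h5
    rw [← mul_div_assoc, le_div_iff₀ hR]
    have h7 : R * (2 / Real.pi * |x|) = 2 * (|x| * R) / Real.pi := by ring
    rw [h7, div_le_iff₀ hπ] at h6
    nlinarith
  · obtain ⟨b1, b2, -, -⟩ := bound θ'
    rw [hc, Real.cos_sub] at hx
    have h3 : ρ' ≤ 2 * D := by
      rw [abs_le] at b1 b2
      have := Real.sin_sq_add_cos_sq θ'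
      have h4 : ρ' = ρ' * (Real.sin θ' ^ 2 + Real.cos θ' ^ 2) := by rw [this, mul_one]
      have h5 : ρ * (Real.cos θ * Real.cos θ' + Real.sin θ * Real.sin θ') ≤ 0 :=
        mul_nonpos_of_nonneg_of_nonpos hρ hx.le
      nlinarith
    refine hz.trans ?_
    rw [← mul_div_assoc, le_div_iff₀ hR]
    nlinarith

/-- Distance from the viewpoint in the maximum metric. -/
def supDist (i j : ℤ) : ℕ := max i.natAbs j.natAbs

lemma supDist_sub_half_le_sqrt {i j : ℤ} {x y : ℝ} (h : (x, y) ∈ cell i j) :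
    (supDist i j : ℝ) - 1 / 2 ≤ Real.sqrt (x ^ 2 + y ^ 2) := by
  obtain ⟨h1, h2⟩ := h
  simp only at h1 h2
  have h3 : |x| ≤ Real.sqrt (x ^ 2 + y ^ 2) := Real.abs_le_sqrt (by nlinarith)
  have h4 : |y| ≤ Real.sqrt (x ^ 2 + y ^ 2) := Real.abs_le_sqrt (by nlinarith)
  have h5 : |(j : ℝ)| ≤ |x| + 1 / 2 := by
    rw [abs_sub_comm] at h1
    have := abs_sub_abs_le_abs_sub (j : ℝ) x
    linarith
  have h6 : |(i : ℝ)| ≤ |y| + 1 / 2 := by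
    have := abs_sub_abs_le_abs_sub (i : ℝ) (-y)
    rw [abs_neg, sub_neg_eq_add, add_comm (i : ℝ)] at this
    linarith
  rw [supDist]
  push_cast
  rw [Nat.cast_natAbs, Nat.cast_natAbs, Int.cast_abs, Int.cast_abs]
  rcases max_choice |(i : ℝ)| |(j : ℝ)| with h | h <;> rw [h] <;> linarith

lemma one_le_supDist {i j : ℤ} (h : (i, j) ≠ (0, 0)) : 1 ≤ supDist i j := by
  rw [supDist]
  by_contra! hc
  apply h
  rw [Prod.mk.injEq]
  omega

lemma maxAngle_sub_minAngle_le {i j : ℤ} (h : (i, j) ≠ (0, 0)) :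
    maxAngle i j - minAngle i j ≤ 4 * Real.pi / supDist i j := by
  have hπ := Real.pi_pos
  obtain ⟨w, hw⟩ := exists_window i j h
  obtain ⟨x₁, y₁, hc₁, he₁⟩ := exists_corner_minAngle i j
  obtain ⟨x₂, y₂, hc₂, he₂⟩ := exists_corner_maxAngle i j
  have hmin := (hw x₁ y₁ hc₁.mem_cell.1 hc₁.mem_cell.2).2
  have hmax := (hw x₂ y₂ hc₂.mem_cell.1 hc₂.mem_cell.2).2
  rw [← he₁, abs_lt] at hmin
  rw [← he₂, abs_lt] at hmax
  have hr : (1 : ℝ) ≤ supDist i j := by exact_mod_cast one_le_supDist h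
  have hx : |x₂ - x₁| ≤ 1 := by
    have := hc₁.mem_cell.1; have := hc₂.mem_cell.1
    simp only [abs_le] at *
    constructor <;> linarith
  have hy : |y₂ - y₁| ≤ 1 := by
    have := hc₁.mem_cell.2; have := hc₂.mem_cell.2
    simp only [abs_le] at *
    constructor <;> linarith
  have hlt := minAngle_lt_maxAngle i j
  obtain ⟨z, hz⟩ := exists_angle_close (ρ := Real.sqrt (x₂ ^ 2 + y₂ ^ 2))
    (ρ' := Real.sqrt (x₁ ^ 2 + y₁ ^ 2)) (θ := maxAngle i j) (θ' := minAngle i j) (D := 1)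
    (R := (supDist i j : ℝ) / 2) (Real.sqrt_nonneg _) (by positivity)
    (by linarith [supDist_sub_half_le_sqrt hc₁.mem_cell])
    (by rwa [he₁, he₂, sqrt_mul_cos_cornerAngle, sqrt_mul_cos_cornerAngle])
    (by rwa [he₁, he₂, sqrt_mul_sin_cornerAngle, sqrt_mul_sin_cornerAngle])
  have e : 2 * Real.pi * (1 / ((supDist i j : ℝ) / 2)) = 4 * Real.pi / supDist i j := by
    field_simp; ring
  rw [e] at hz
  refine le_trans ?_ hz
  rcases lt_trichotomy z 0 with h1 | h1 | h1
  · have : (z : ℝ) ≤ -1 := by exact_mod_cast (by omega : z ≤ -1)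
    refine le_trans ?_ (neg_le_abs _)
    nlinarith
  · rw [h1, Int.cast_zero, mul_zero, add_zero]; exact le_abs_self _
  · have : (1 : ℝ) ≤ z := by exact_mod_cast (by omega : 1 ≤ z)
    refine le_trans ?_ (le_abs_self _)
    nlinarith

lemma endSlot_sub_firstSlot_le (m : ℕ) {i j : ℤ} (h : (i, j) ≠ (0, 0)) :
    (endSlot m i j - firstSlot m i j : ℝ) ≤ 64 * (m / supDist i j) + 2 := by
  have hπ := Real.pi_pos
  have h1 := Int.ceil_lt_add_one (maxAngle i j / (2 * Real.pi) * (32 * (m : ℝ)))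
  have h2 := Int.lt_floor_add_one (minAngle i j / (2 * Real.pi) * (32 * (m : ℝ)))
  rw [← firstSlot] at h2
  rw [← endSlot] at h1
  have hr : (1 : ℝ) ≤ supDist i j := by exact_mod_cast one_le_supDist h
  have h3 : (maxAngle i j - minAngle i j) / (2 * Real.pi) * (32 * (m : ℝ)) ≤
      (4 * Real.pi / supDist i j) / (2 * Real.pi) * (32 * (m : ℝ)) := by
    gcongr; exact maxAngle_sub_minAngle_le h
  have h4 : (4 * Real.pi / supDist i j) / (2 * Real.pi) * (32 * (m : ℝ)) = 64 * (m / supDist i j) := by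
    field_simp; norm_num1; ring
  rw [h4, sub_div, sub_mul] at h3
  linarith

/-! ### The recursion -/

lemma sweepRec_one (c : Consts) (depth : ℕ) (i j F : ℤ) (μ : Mem) :
    ((sweepRec c (depth + 1) i j 1 F).exec μ).mem = ((sweepCell c i j).exec μ).mem ∧
    ((sweepRec c (depth + 1) i j 1 F).exec μ).time = 33 + ((sweepCell c i j).exec μ).time ∧
    ((sweepRec c (depth + 1) i j 1 F).exec μ).trace =
      ((touchFrame frameSize F).exec μ).trace ++ ((sweepCell c i j).exec μ).trace := by
  have h := touchFrame_exec frameSize F μ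
  have hv : ((touchFrame frameSize F).exec μ).time = 32 := h.2.1
  simp only [sweepRec, exec_bind (touchFrame _ _), exec_op_bind, Instr.value, Instr.memory,
    Instr.accesses, decide_true, if_true, h.1, hv, List.nil_append, true_and, and_true]
  omega

/-- The recursive call for a quadrant. -/
noncomputable def visitQuadrant (c : Consts) (depth : ℕ) (h F : ℤ) (t : Tile) : Prog Unit := do
  sweepRec c depth t.row t.col h (F + (frameSize : ℤ))
  touchFrame frameSize F

lemma sweepRec_two_pow_succ (c : Consts) (depth d : ℕ) (i j F : ℤ) (μ : Mem) :
    let o := (forEach (visitQuadrant c depth (2 ^ d) F) (quadrants i j (2 ^ d))).exec μ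
    ((sweepRec c (depth + 1) i j (2 ^ (d + 1)) F).exec μ).mem = o.mem ∧
    ((sweepRec c (depth + 1) i j (2 ^ (d + 1)) F).exec μ).time ≤ 130 + o.time ∧
    ((sweepRec c (depth + 1) i j (2 ^ (d + 1)) F).exec μ).trace =
      ((touchFrame frameSize F).exec μ).trace ++ o.trace := by
  have h := touchFrame_exec frameSize F μ
  have hv : ((touchFrame frameSize F).exec μ).time = 32 := h.2.1
  have h1 : ¬ (2 : ℤ) ^ (d + 1) = 1 := by
    have : (0 : ℤ) < 2 ^ d := by positivity
    rw [pow_succ]; omega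
  have h2 : (2 : ℤ) ^ (d + 1) / 2 = 2 ^ d := by rw [pow_succ]; omega
  have hq : List.orderedInsert Tile.Le ⟨i + 2 ^ d, j + 2 ^ d, intervalDist (i + 2 ^ d) (2 ^ d) +
      intervalDist (j + 2 ^ d) (2 ^ d)⟩
    (List.orderedInsert Tile.Le ⟨i, j + 2 ^ d, intervalDist i (2 ^ d) +
        intervalDist (j + 2 ^ d) (2 ^ d)⟩
      (List.orderedInsert Tile.Le ⟨i + 2 ^ d, j, intervalDist (i + 2 ^ d) (2 ^ d) +
          intervalDist j (2 ^ d)⟩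
        (List.orderedInsert Tile.Le ⟨i, j, intervalDist i (2 ^ d) + intervalDist j (2 ^ d)⟩ []))) =
      quadrants i j (2 ^ d) := rfl
  have hf : (fun t : Tile => do
        sweepRec c depth t.row t.col (2 ^ d) (F + (frameSize : ℤ))
        touchFrame frameSize F) = visitQuadrant c depth (2 ^ d) F := rfl
  have t₁ := (computes_tileDist i j (2 ^ d)).time μ
  have t₂ := (computes_tileDist (i + 2 ^ d) j (2 ^ d)).time μ
  have t₃ := (computes_tileDist i (j + 2 ^ d) (2 ^ d)).time μ
  have t₄ := (computes_tileDist (i + 2 ^ d) (j + 2 ^ d) (2 ^ d)).time μ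
  have u₁ := fun t => (computes_insertTile t []).time μ
  have u₂ := fun t t₁ => (computes_insertTile t (List.orderedInsert Tile.Le t₁ [])).time μ
  have u₃ := fun t t₁ t₂ => (computes_insertTile t (List.orderedInsert Tile.Le t₁
    (List.orderedInsert Tile.Le t₂ []))).time μ
  have u₄ := fun t t₁ t₂ t₃ => (computes_insertTile t (List.orderedInsert Tile.Le t₁
    (List.orderedInsert Tile.Le t₂ (List.orderedInsert Tile.Le t₃ [])))).time μ
  simp only [List.orderedInsert_length, List.length_nil, zero_add] at u₁ u₂ u₃ u₄
  simp only [sweepRec, exec_bind (touchFrame _ _), exec_op_bind, Instr.value, Instr.memory,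
    Instr.accesses, h1, decide_false, Bool.false_eq_true, if_false, h.1, hv, h2,
    exec_bind (tileDist _ _ _), (computes_tileDist _ _ _).val, (computes_tileDist _ _ _).mem,
    (computes_tileDist _ _ _).trace, exec_bind (insertTile _ _), (computes_insertTile _ _).val,
    (computes_insertTile _ _).mem, (computes_insertTile _ _).trace, List.nil_append, true_and,
    and_true, hq, hf]
  have v₁ := u₁ ⟨i, j, intervalDist i (2 ^ d) + intervalDist j (2 ^ d)⟩
  have v₂ := u₂ ⟨i + 2 ^ d, j, intervalDist (i + 2 ^ d) (2 ^ d) + intervalDist j (2 ^ d)⟩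
    ⟨i, j, intervalDist i (2 ^ d) + intervalDist j (2 ^ d)⟩
  have v₃ := u₃ ⟨i, j + 2 ^ d, intervalDist i (2 ^ d) + intervalDist (j + 2 ^ d) (2 ^ d)⟩
    ⟨i + 2 ^ d, j, intervalDist (i + 2 ^ d) (2 ^ d) + intervalDist j (2 ^ d)⟩
    ⟨i, j, intervalDist i (2 ^ d) + intervalDist j (2 ^ d)⟩
  have v₄ := u₄ ⟨i + 2 ^ d, j + 2 ^ d, intervalDist (i + 2 ^ d) (2 ^ d) +
      intervalDist (j + 2 ^ d) (2 ^ d)⟩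
    ⟨i, j + 2 ^ d, intervalDist i (2 ^ d) + intervalDist (j + 2 ^ d) (2 ^ d)⟩
    ⟨i + 2 ^ d, j, intervalDist (i + 2 ^ d) (2 ^ d) + intervalDist j (2 ^ d)⟩
    ⟨i, j, intervalDist i (2 ^ d) + intervalDist j (2 ^ d)⟩
  linarith

lemma forEach_cons_exec (body : Tile → Prog Unit) (t : Tile) (ts : List Tile) (μ : Mem) :
    ((forEach body (t :: ts)).exec μ).mem = ((forEach body ts).exec ((body t).exec μ).mem).mem ∧
    ((forEach body (t :: ts)).exec μ).time =
      ((body t).exec μ).time + ((forEach body ts).exec ((body t).exec μ).mem).time ∧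
    ((forEach body (t :: ts)).exec μ).trace =
      ((body t).exec μ).trace ++ ((forEach body ts).exec ((body t).exec μ).mem).trace := by
  simp only [forEach, exec_bind, and_self]

lemma visitQuadrant_exec (c : Consts) (depth : ℕ) (h F : ℤ) (t : Tile) (μ : Mem) :
    let o := (sweepRec c depth t.row t.col h (F + (frameSize : ℤ))).exec μ
    ((visitQuadrant c depth h F t).exec μ).mem = o.mem ∧
    ((visitQuadrant c depth h F t).exec μ).time = o.time + 32 ∧
    ((visitQuadrant c depth h F t).exec μ).trace =
      o.trace ++ ((touchFrame frameSize F).exec o.mem).trace := by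
  simp only [visitQuadrant, exec_bind]
  exact ⟨(touchFrame_exec _ _ _).1, by rw [(touchFrame_exec _ _ _).2.1]; rfl, trivial⟩

/-- The order in which the grid points of a tile of width `2 ^ d` are visited. -/
def sweepOrder : ℕ → ℤ → ℤ → List (ℤ × ℤ)
  | 0, i, j => [(i, j)]
  | d + 1, i, j => (quadrants i j (2 ^ d)).flatMap fun t => sweepOrder d t.row t.col

/-- The memory after the visit of a grid point. -/
noncomputable def visit (m : ℕ) (μ : Mem) (p : ℤ × ℤ) : Mem :=
  ((sweepCell (consts m) p.1 p.2).exec μ).mem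

lemma sweepRec_mem (m d depth : ℕ) (hd : d < depth) (i j F : ℤ) (μ : Mem) :
    ((sweepRec (consts m) depth i j (2 ^ d) F).exec μ).mem =
      (sweepOrder d i j).foldl (visit m) μ := by
  induction d generalizing depth i j F μ with
  | zero =>
    obtain ⟨depth, rfl⟩ := Nat.exists_eq_succ_of_ne_zero (by omega : depth ≠ 0)
    rw [pow_zero, (sweepRec_one _ _ _ _ _ _).1]
    rfl
  | succ d ih =>
    obtain ⟨depth, rfl⟩ := Nat.exists_eq_succ_of_ne_zero (by omega : depth ≠ 0)
    rw [(sweepRec_two_pow_succ _ _ _ _ _ _ _).1, sweepOrder]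
    generalize quadrants i j (2 ^ d) = l
    induction l generalizing μ with
    | nil => rfl
    | cons t l ihl =>
      rw [(forEach_cons_exec _ _ _ _).1, (visitQuadrant_exec _ _ _ _ _ _).1, ih depth (by omega),
        List.flatMap_cons, List.foldl_append, ihl]

/-! ### The order of the sweep -/

lemma quadrants_perm (i j h : ℤ) : (quadrants i j h).Perm
    [⟨i + h, j + h, intervalDist (i + h) h + intervalDist (j + h) h⟩,
      ⟨i, j + h, intervalDist i h + intervalDist (j + h) h⟩,
      ⟨i + h, j, intervalDist (i + h) h + intervalDist j h⟩,
      ⟨i, j, intervalDist i h + intervalDist j h⟩] := by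
  refine (List.perm_orderedInsert _ _ _).trans (List.Perm.cons _ ?_)
  refine (List.perm_orderedInsert _ _ _).trans (List.Perm.cons _ ?_)
  exact (List.perm_orderedInsert _ _ _).trans (List.Perm.cons _ (List.Perm.refl _))

lemma mem_quadrants {i j h : ℤ} {t : Tile} : t ∈ quadrants i j h ↔
    (t.row = i ∨ t.row = i + h) ∧ (t.col = j ∨ t.col = j + h) ∧
      t.key = intervalDist t.row h + intervalDist t.col h := by
  rw [(quadrants_perm i j h).mem_iff]
  obtain ⟨r, c, k⟩ := t
  simp only [List.mem_cons, Tile.mk.injEq, List.not_mem_nil, or_false]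
  constructor
  · rintro (⟨rfl, rfl, rfl⟩ | ⟨rfl, rfl, rfl⟩ | ⟨rfl, rfl, rfl⟩ | ⟨rfl, rfl, rfl⟩) <;> simp
  · rintro ⟨rfl | rfl, rfl | rfl, rfl⟩ <;> simp

lemma quadrants_pairwise {i j h : ℤ} (hh : 0 < h) : (quadrants i j h).Pairwise
    (fun t u => t.key ≤ u.key ∧ (t.row ≠ u.row ∨ t.col ≠ u.col)) := by
  have h1 : (quadrants i j h).Pairwise Tile.Le :=
    ((((List.Pairwise.nil (R := Tile.Le)).orderedInsert _ _).orderedInsert _ _).orderedInsert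
      _ _).orderedInsert _ _
  refine h1.and (((quadrants_perm i j h).pairwise_iff (R := fun t u : Tile =>
    t.row ≠ u.row ∨ t.col ≠ u.col) ?_).2 ?_)
  · intro t u h; exact h.imp Ne.symm Ne.symm
  · simp
    omega

lemma mem_sweepOrder {d : ℕ} {i j x y : ℤ} : (x, y) ∈ sweepOrder d i j ↔
    (i ≤ x ∧ x < i + 2 ^ d) ∧ (j ≤ y ∧ y < j + 2 ^ d) := by
  induction d generalizing i j with
  | zero => simp [sweepOrder]; omega
  | succ d ih =>
    have h2 : (0 : ℤ) < 2 ^ d := by positivity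
    simp only [sweepOrder, List.mem_flatMap, mem_quadrants, ih, pow_succ]
    generalize (2 : ℤ) ^ d = h at *
    constructor
    · rintro ⟨t, ⟨h3 | h3, h4 | h4, -⟩, h5⟩ <;> rw [h3, h4] at h5 <;> omega
    · intro h3
      refine ⟨⟨if x < i + h then i else i + h, if y < j + h then j else j + h,
        intervalDist (if x < i + h then i else i + h) h +
          intervalDist (if y < j + h then j else j + h) h⟩, ⟨?_, ?_, rfl⟩, ?_⟩
      · simp only; split_ifs <;> simp
      · simp only; split_ifs <;> simp
      · simp only; split_ifs <;> omega

/-- `a` lies between `0` and `b`. -/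
def Between (a b : ℤ) : Prop := (0 ≤ a ∧ a ≤ b) ∨ (b ≤ a ∧ a ≤ 0)

lemma intervalDist_le_of_between {a b h x y : ℤ} (hab : a = b ∨ a + h ≤ b ∨ b + h ≤ a)
    (hx : a ≤ x ∧ x < a + h) (hy : b ≤ y ∧ y < b + h) (hyx : Between y x) :
    intervalDist b h ≤ intervalDist a h ∧ (a ≠ b → intervalDist b h < intervalDist a h) := by
  unfold Between at hyx
  unfold intervalDist
  simp only [abs_eq_max_neg]
  split_ifs <;> omega

lemma sweepOrder_pairwise (d : ℕ) (i j : ℤ) : (sweepOrder d i j).Pairwise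
    (fun p q => p ≠ q ∧ ¬ (Between q.1 p.1 ∧ Between q.2 p.2)) := by
  induction d generalizing i j with
  | zero => simp [sweepOrder]
  | succ d ih =>
    have h2 : (0 : ℤ) < 2 ^ d := by positivity
    rw [sweepOrder, List.pairwise_flatMap]
    refine ⟨fun t _ => ih _ _, ?_⟩
    refine List.Pairwise.imp_of_mem ?_ (quadrants_pairwise h2)
    rintro t u ht hu ⟨hk, hne⟩ ⟨x, y⟩ hp ⟨x', y'⟩ hq
    rw [mem_sweepOrder] at hp hq
    rw [mem_quadrants] at ht hu
    obtain ⟨hr, hc, hkt⟩ := ht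
    obtain ⟨hr', hc', hku⟩ := hu
    generalize (2 : ℤ) ^ d = h at *
    constructor
    · rintro ⟨⟩; omega
    · rintro ⟨b1, b2⟩
      obtain ⟨c1, c2⟩ := intervalDist_le_of_between (a := t.row) (b := u.row) (h := h) (by omega)
        hp.1 hq.1 b1
      obtain ⟨c3, c4⟩ := intervalDist_le_of_between (a := t.col) (b := u.col) (h := h) (by omega)
        hp.2 hq.2 b2
      rcases hne with hne | hne
      · have := c2 hne; omega
      · have := c4 hne; omega

/-! ### The whole program -/

lemma slotAddr_bounds {m : ℕ} (hm : 1 ≤ m) (l : ℤ) :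
    2 * ((2 * (m : ℤ) + 1) * (2 * m + 1)) ≤ slotAddr m l ∧
      slotAddr m l < 2 * ((2 * (m : ℤ) + 1) * (2 * m + 1)) + 32 * m := by
  have h1 := Int.emod_nonneg l (by omega : (32 * (m : ℤ)) ≠ 0)
  have h2 := Int.emod_lt_of_pos l (by omega : 0 < (32 * (m : ℤ)))
  rw [slotAddr]
  constructor <;> linarith

/-- The memory after the initialization of the horizon array. -/
noncomputable def initMem (m : ℕ) (μ : Mem) : Mem :=
  ((clearSlots (consts m) (32 * m + 1) 0).exec μ).mem

lemma centrifugalSweep_exec (m : ℕ) : ∃ d, d < 2 * m + 2 ∧ 2 ^ d < 2 * (2 * m + 1) ∧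
    2 * m + 1 ≤ 2 ^ d ∧ ∀ μ,
    let o := (sweepRec (consts m) (2 * m + 2) (-m) (-m) (2 ^ d)
      (2 * ((2 * m + 1) * (2 * m + 1)) + 32 * m)).exec (initMem m μ)
    ((centrifugalSweep m).exec μ).mem = o.mem ∧
    ((centrifugalSweep m).exec μ).time ≤ 132 * m + 30 + o.time ∧
    ((centrifugalSweep m).exec μ).trace =
      ((clearSlots (consts m) (32 * m + 1) 0).exec μ).trace ++ o.trace := by
  obtain ⟨d, h1, h2, h3⟩ := double_spec m (2 * m + 2) 0 (by omega) (by
    rw [pow_zero, one_mul]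
    exact (by omega : 2 * m + 1 ≤ 2 * m + 2).trans Nat.lt_two_pow_self.le)
  refine ⟨d, ?_, h1, h2, fun μ => ?_⟩
  · by_contra! hc
    have h4 := Nat.pow_le_pow_right (by norm_num : 0 < 2) hc
    have h5 := Nat.lt_two_pow_self (n := 2 * m)
    rw [pow_succ, pow_succ] at h4
    omega
  · have hC : (⟨(m : ℤ), 2 * m + 1, 32 * m, (2 * m + 1) * (2 * m + 1),
        2 * ((2 * m + 1) * (2 * m + 1))⟩ : Consts) = consts m := rfl
    have hi : ((clearSlots (consts m) (32 * m + 1) 0).exec μ).mem = initMem m μ := rfl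
    have t1 := (clearSlots_spec m (32 * m + 1) 0 le_rfl (by push_cast; omega) μ).2.1
    have t2 := h3.time (initMem m μ)
    rw [pow_zero] at h3 t2
    simp only [centrifugalSweep, exec_op_bind, Instr.value, Instr.memory, Instr.accesses, hC,
      exec_bind (clearSlots _ _ _), exec_bind (double _ _ _), h3.val, h3.mem, h3.trace,
      List.nil_append, true_and, and_true, hi, zero_sub]
    linarith

/-! ### Slots of the horizon and cells -/

/-- `θ` lies in the interior of the slot `k`. -/
def InSlot (m : ℕ) (k : ℤ) (θ : ℝ) : Prop :=
  (k : ℝ) * (2 * Real.pi / (32 * (m : ℝ))) < θ ∧ θ < ((k : ℝ) + 1) * (2 * Real.pi / (32 * (m : ℝ)))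

/-- Some ray with direction in the interior of the slot `k` meets the cell of `(i, j)`. -/
def Covered (m : ℕ) (k i j : ℤ) : Prop :=
  ∃ θ, InSlot m k θ ∧ ∃ ρ : ℝ, 0 < ρ ∧ (ρ * Real.cos θ, ρ * Real.sin θ) ∈ cell i j

lemma slotAddr_eq_iff {m : ℕ} {k l : ℤ} :
    slotAddr m k = slotAddr m l ↔ ∃ z : ℤ, l = k + 32 * m * z := by
  rw [slotAddr, slotAddr, add_right_inj]
  constructor
  · intro h
    refine ⟨l / (32 * m) - k / (32 * m), ?_⟩
    have h1 := Int.emod_add_mul_ediv k (32 * m)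
    have h2 := Int.emod_add_mul_ediv l (32 * m)
    linarith
  · rintro ⟨z, rfl⟩
    rw [Int.add_mul_emod_self_left]

lemma div_two_pi_mul (m : ℕ) (α : ℝ) :
    α / (2 * Real.pi) * (32 * (m : ℝ)) = α / (2 * Real.pi / (32 * (m : ℝ))) := by
  rw [div_div_eq_mul_div, div_mul_eq_mul_div]

lemma covered_iff {m : ℕ} (hm : 1 ≤ m) {k i j : ℤ} (h : (i, j) ≠ (0, 0)) :
    (∃ l, firstSlot m i j ≤ l ∧ l ≤ endSlot m i j - 1 ∧ slotAddr m k = slotAddr m l) ↔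
      Covered m k i j := by
  have hm' : (0 : ℝ) < m := by exact_mod_cast hm
  have hW : 0 < 2 * Real.pi / (32 * (m : ℝ)) := by positivity
  have hWm : 2 * Real.pi / (32 * (m : ℝ)) * (32 * m) = 2 * Real.pi := by field_simp
  rw [firstSlot, endSlot, div_two_pi_mul, div_two_pi_mul]
  unfold Covered InSlot
  simp only [exists_ray_mem_cell_iff i j h, slotAddr_eq_iff]
  generalize 2 * Real.pi / (32 * (m : ℝ)) = W at *
  have hlt := minAngle_lt_maxAngle i j
  constructor
  · rintro ⟨l, h1, h2, z, rfl⟩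
    have h3 : minAngle i j < ((k + 32 * m * z : ℤ) + 1) * W := by
      rw [← div_lt_iff₀ hW]
      exact (Int.lt_floor_add_one _).trans_le (by exact_mod_cast add_le_add_left h1 1)
    have h4 : ((k + 32 * m * z : ℤ) : ℝ) * W < maxAngle i j := by
      rw [← lt_div_iff₀ hW]
      exact Int.lt_ceil.1 (by omega)
    push_cast at h3 h4
    have h5 : max (minAngle i j) (((k : ℝ) + 32 * m * z) * W) <
        min (maxAngle i j) (((k : ℝ) + 32 * m * z + 1) * W) := by
      rw [max_lt_iff, lt_min_iff, lt_min_iff]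
      refine ⟨⟨hlt, h3⟩, h4, by linarith⟩
    obtain ⟨θ, h6, h7⟩ := exists_between h5
    rw [max_lt_iff] at h6
    rw [lt_min_iff] at h7
    have e : (32 * m * z : ℝ) * W = 2 * Real.pi * z := by rw [← hWm]; ring
    refine ⟨θ - 2 * Real.pi * z, ⟨?_, ?_⟩, z, ?_, ?_⟩ <;> linarith
  · rintro ⟨θ, ⟨h1, h2⟩, z, h3, h4⟩
    have e : (32 * m * z : ℝ) * W = 2 * Real.pi * z := by rw [← hWm]; ring
    refine ⟨k + 32 * m * z, ?_, ?_, z, rfl⟩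
    · rw [← Int.lt_add_one_iff, Int.floor_lt, div_lt_iff₀ hW]
      push_cast
      linarith
    · have : k + 32 * m * z < ⌈maxAngle i j / W⌉ := by
        rw [Int.lt_ceil, lt_div_iff₀ hW]
        push_cast
        linarith
      omega

lemma dist_mul_cos_azim (i j : ℤ) : dist i j * Real.cos (azim (j : ℝ) (-(i : ℝ))) = j := by
  have := sqrt_mul_cos_azim (j : ℝ) (-(i : ℝ))
  rwa [neg_sq] at this

lemma dist_mul_sin_azim (i j : ℤ) : dist i j * Real.sin (azim (j : ℝ) (-(i : ℝ))) = -i := by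
  have := sqrt_mul_sin_azim (j : ℝ) (-(i : ℝ))
  rwa [neg_sq] at this

lemma dist_pos {i j : ℤ} (h : (i, j) ≠ (0, 0)) : 0 < dist i j := by
  refine Real.sqrt_pos.2 ?_
  by_cases hi : i = 0
  · have hj : (j : ℝ) ≠ 0 := by
      intro hj; exact h (by rw [hi, Int.cast_eq_zero.1 hj])
    positivity
  · have hi : (i : ℝ) ≠ 0 := by exact_mod_cast hi
    positivity

lemma slotOf_mul_le {m : ℕ} (hm : 1 ≤ m) (i j : ℤ) :
    (slotOf m i j : ℝ) * (2 * Real.pi / (32 * (m : ℝ))) ≤ azim (j : ℝ) (-(i : ℝ)) := by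
  have hm' : (0 : ℝ) < m := by exact_mod_cast hm
  rw [slotOf, div_two_pi_mul, ← le_div_iff₀ (by positivity)]
  exact Int.floor_le _

lemma lt_slotOf_add_one_mul {m : ℕ} (hm : 1 ≤ m) (i j : ℤ) :
    azim (j : ℝ) (-(i : ℝ)) < ((slotOf m i j : ℝ) + 1) * (2 * Real.pi / (32 * (m : ℝ))) := by
  have hm' : (0 : ℝ) < m := by exact_mod_cast hm
  rw [slotOf, div_two_pi_mul, ← div_lt_iff₀ (by positivity)]
  exact Int.lt_floor_add_one _

lemma slotOf_nonneg (m : ℕ) (i j : ℤ) : 0 ≤ slotOf m i j := by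
  have := azim_nonneg (j : ℝ) (-(i : ℝ))
  exact Int.floor_nonneg.2 (by positivity)

lemma slotOf_lt {m : ℕ} (hm : 1 ≤ m) (i j : ℤ) : slotOf m i j < 32 * m := by
  have hm' : (0 : ℝ) < m := by exact_mod_cast hm
  have := azim_lt (j : ℝ) (-(i : ℝ))
  rw [slotOf, Int.floor_lt, div_mul_eq_mul_div, div_lt_iff₀ (by positivity)]
  push_cast
  nlinarith

lemma dist_le {m : ℕ} {i j : ℤ} (h : InGrid m i j) : dist i j ≤ 2 * m := by
  rw [dist, Real.sqrt_le_left (by positivity)]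
  have h1 : |(i : ℝ)| ≤ m := by exact_mod_cast h.1
  have h2 : |(j : ℝ)| ≤ m := by exact_mod_cast h.2
  nlinarith [sq_abs (i : ℝ), sq_abs (j : ℝ), abs_nonneg (i : ℝ), abs_nonneg (j : ℝ)]

/-- Turning the line of sight within its slot keeps its end in the interior of the cell. -/
lemma abs_sub_lt_of_inSlot {m : ℕ} (hm : 1 ≤ m) {i j : ℤ} (h : InGrid m i j) {θ : ℝ}
    (hθ : InSlot m (slotOf m i j) θ) :
    |dist i j * Real.cos θ - j| < 1 / 2 ∧ |dist i j * Real.sin θ + i| < 1 / 2 := by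
  have hm' : (0 : ℝ) < m := by exact_mod_cast hm
  have h0 : 0 ≤ dist i j := Real.sqrt_nonneg _
  have h1 : |θ - azim (j : ℝ) (-(i : ℝ))| ≤ 2 * Real.pi / (32 * (m : ℝ)) := by
    have := slotOf_mul_le hm i j
    have := lt_slotOf_add_one_mul hm i j
    rw [abs_le]
    constructor <;> linarith [hθ.1, hθ.2]
  have h2 : dist i j * |θ - azim (j : ℝ) (-(i : ℝ))| < 1 / 2 := by
    refine (mul_le_mul (dist_le h) h1 (abs_nonneg _) (by positivity)).trans_lt ?_
    have : 2 * (m : ℝ) * (2 * Real.pi / (32 * (m : ℝ))) = Real.pi / 8 := by field_simp; norm_num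
    rw [this]
    linarith [Real.pi_lt_four]
  constructor
  · have e : dist i j * Real.cos θ - j =
        dist i j * (Real.cos θ - Real.cos (azim (j : ℝ) (-(i : ℝ)))) := by
      rw [mul_sub, dist_mul_cos_azim]
    rw [e, abs_mul, abs_of_nonneg h0]
    exact (mul_le_mul_of_nonneg_left (Real.abs_cos_sub_cos_le _ _) h0).trans_lt h2
  · have e : dist i j * Real.sin θ + i =
        dist i j * (Real.sin θ - Real.sin (azim (j : ℝ) (-(i : ℝ)))) := by
      rw [mul_sub, dist_mul_sin_azim, sub_neg_eq_add]
    rw [e, abs_mul, abs_of_nonneg h0]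
    exact (mul_le_mul_of_nonneg_left (Real.abs_sin_sub_sin_le _ _) h0).trans_lt h2

lemma between_of_le_one {x t : ℝ} {b a : ℤ} (hx : |x - b| < 1 / 2) (h0 : 0 ≤ t) (h1 : t ≤ 1)
    (ha : |t * x - a| ≤ 1 / 2) : Between a b := by
  rw [abs_lt] at hx
  rw [abs_le] at ha
  rcases le_total 0 x with h | h
  · left
    have h2 : 0 ≤ t * x := by positivity
    have h3 : t * x ≤ x := by nlinarith
    have h4 : (-1 : ℝ) < a := by linarith
    have h5 : (a : ℝ) < b + 1 := by linarith
    have h4' : -1 < a := by exact_mod_cast h4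
    have h5' : a < b + 1 := by exact_mod_cast h5
    omega
  · right
    have h2 : t * x ≤ 0 := mul_nonpos_of_nonneg_of_nonpos h0 h
    have h3 : x ≤ t * x := by nlinarith
    have h4 : (a : ℝ) < 1 := by linarith
    have h5 : (b : ℝ) < a + 1 := by linarith
    have h4' : a < 1 := by exact_mod_cast h4
    have h5' : b < a + 1 := by exact_mod_cast h5
    omega

lemma between_of_one_le {x t : ℝ} {b a : ℤ} (hx : |x - b| < 1 / 2) (h1 : 1 ≤ t)
    (ha : |t * x - a| ≤ 1 / 2) : Between b a := by
  rw [abs_lt] at hx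
  rw [abs_le] at ha
  rcases le_total 0 x with h | h
  · left
    have h3 : x ≤ t * x := by nlinarith
    have h4 : (-1 : ℝ) < b := by linarith
    have h5 : (b : ℝ) < a + 1 := by linarith
    have h4' : -1 < b := by exact_mod_cast h4
    have h5' : b < a + 1 := by exact_mod_cast h5
    omega
  · right
    have h3 : t * x ≤ x := by nlinarith
    have h4 : (b : ℝ) < 1 := by linarith
    have h5 : (a : ℝ) < b + 1 := by linarith
    have h4' : b < 1 := by exact_mod_cast h4
    have h5' : a < b + 1 := by exact_mod_cast h5
    omega

lemma zero_not_mem_cell {i j : ℤ} (h : (i, j) ≠ (0, 0)) : ((0 : ℝ), (0 : ℝ)) ∉ cell i j := by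
  rintro ⟨h1, h2⟩
  simp only [zero_sub, abs_neg, zero_add] at h1 h2
  apply h
  have h1' : |(i : ℝ)| < 1 := by linarith
  have h2' : |(j : ℝ)| < 1 := by linarith
  have h1'' : |i| < 1 := by exact_mod_cast h1'
  have h2'' : |j| < 1 := by exact_mod_cast h2'
  rw [Int.abs_lt_one_iff.1 h1'', Int.abs_lt_one_iff.1 h2'']

lemma mem_segment_zero {p e : ℝ × ℝ} :
    p ∈ segment ℝ ((0, 0) : ℝ × ℝ) e ↔ ∃ t : ℝ, 0 ≤ t ∧ t ≤ 1 ∧ p = (t * e.1, t * e.2) := by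
  rw [segment_eq_image]
  simp only [Set.mem_image, Set.mem_Icc]
  constructor
  · rintro ⟨t, ⟨h0, h1⟩, rfl⟩
    exact ⟨t, h0, h1, by ext <;> simp⟩
  · rintro ⟨t, h0, h1, rfl⟩
    exact ⟨t, ⟨h0, h1⟩, by ext <;> simp⟩

/-- Visibility at the angular resolution of the horizon, in terms of the order of the sweep and of
the slots covered by the cells. -/
lemma slotVisible_iff {m : ℕ} (hm : 1 ≤ m) (Z : ℤ → ℤ → ℝ) {i j : ℤ} (h : InGrid m i j)
    (h0 : (i, j) ≠ (0, 0)) (l : List (ℤ × ℤ))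
    (hl : ∀ p : ℤ × ℤ, InGrid m p.1 p.2 → p ≠ (i, j) → Between p.1 i → Between p.2 j → p ∈ l)
    (hl' : ∀ p ∈ l, ¬ (Between i p.1 ∧ Between j p.2)) :
    SlotVisible m Z i j ↔ ∀ p ∈ l, InGrid m p.1 p.2 → p ≠ (0, 0) →
      Covered m (slotOf m i j) p.1 p.2 → elev Z p.1 p.2 < elev Z i j := by
  have hd := dist_pos h0
  constructor
  · rintro hv ⟨i', j'⟩ hp hg hne ⟨θ, hθ, ρ, hρ, hc⟩
    obtain ⟨b1, b2⟩ := abs_sub_lt_of_inSlot hm h hθ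
    rw [show dist i j * Real.sin θ + i = dist i j * Real.sin θ - ((-i : ℤ) : ℝ) by
      push_cast; ring] at b2
    have e : ∀ x, ρ * x = ρ / dist i j * (dist i j * x) := by
      intro x; field_simp
    rw [e, e] at hc
    have hne' : (i', j') ≠ (i, j) := by
      intro heq
      rw [Prod.mk.injEq] at heq
      apply hl' _ hp
      simp only [heq.1, heq.2]
      unfold Between
      omega
    rcases le_or_gt (ρ / dist i j) 1 with h1 | h1
    · refine hv θ hθ.1 hθ.2 i' j' hg hne' hne ⟨_, hc, ?_⟩
      exact mem_segment_zero.2 ⟨_, by positivity, h1, rfl⟩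
    · exfalso
      apply hl' _ hp
      have c2 := hc.2
      simp only at c2
      rw [show ρ / dist i j * (dist i j * Real.sin θ) + i' =
        ρ / dist i j * (dist i j * Real.sin θ) - ((-i' : ℤ) : ℝ) by push_cast; ring] at c2
      have d1 := between_of_one_le b1 h1.le hc.1
      have d2 := between_of_one_le b2 h1.le c2
      unfold Between at *
      simp only
      omega
  · rintro hv θ h1 h2 i' j' hg hne hne0 ⟨p, hc, hs⟩
    obtain ⟨t, ht0, ht1, rfl⟩ := mem_segment_zero.1 hs
    have hθ : InSlot m (slotOf m i j) θ := ⟨h1, h2⟩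
    obtain ⟨b1, b2⟩ := abs_sub_lt_of_inSlot hm h hθ
    rw [show dist i j * Real.sin θ + i = dist i j * Real.sin θ - ((-i : ℤ) : ℝ) by
      push_cast; ring] at b2
    have d1 := between_of_le_one b1 ht0 ht1 hc.1
    have c2 := hc.2
    simp only at c2
    rw [show t * (dist i j * Real.sin θ) + i' =
      t * (dist i j * Real.sin θ) - ((-i' : ℤ) : ℝ) by push_cast; ring] at c2
    have d2 := between_of_le_one b2 ht0 ht1 c2
    refine hv (i', j') (hl _ hg hne ?_ d1) hg hne0 ⟨θ, hθ, t * dist i j, ?_, ?_⟩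
    · unfold Between at *
      simp only
      omega
    · rcases ht0.eq_or_lt with rfl | h3
      · simp only [zero_mul] at hc
        exact absurd hc (zero_not_mem_cell hne0)
      · positivity
    · rw [mul_assoc, mul_assoc]; exact hc

/-! ### Visibility in Van Kreveld's model -/

lemma exists_inSlot_turn {m : ℕ} (hm : 1 ≤ m) (i j : ℤ) {U : Set (ℝ × ℝ)} (hU : IsOpen U) {t : ℝ}
    (h : (t * (j : ℝ), t * -(i : ℝ)) ∈ U) :
    ∃ θ, InSlot m (slotOf m i j) θ ∧ (t * (dist i j * Real.cos θ), t * (dist i j * Real.sin θ)) ∈ U := by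
  have hcont : Continuous fun θ : ℝ =>
      (t * (dist i j * Real.cos θ), t * (dist i j * Real.sin θ)) := by fun_prop
  rw [← dist_mul_cos_azim i j, ← dist_mul_sin_azim i j] at h
  have h1 : ∀ᶠ θ in nhdsWithin (azim (j : ℝ) (-(i : ℝ))) (Set.Ioi (azim (j : ℝ) (-(i : ℝ)))),
      (t * (dist i j * Real.cos θ), t * (dist i j * Real.sin θ)) ∈ U :=
    (hcont.continuousAt.eventually_mem (by
      simpa only [dist_mul_cos_azim, dist_mul_sin_azim] using hU.mem_nhds h)).filter_mono
      nhdsWithin_le_nhds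
  have h2 := Ioo_mem_nhdsGT (lt_slotOf_add_one_mul hm i j)
  obtain ⟨θ, h3, h4⟩ := (h1.and h2).exists
  exact ⟨θ, ⟨(slotOf_mul_le hm i j).trans_lt h4.1, h4.2⟩, h3⟩

lemma SlotVisible.elev_lt {m : ℕ} (hm : 1 ≤ m) {Z : ℤ → ℤ → ℝ} {i j : ℤ}
    (hv : SlotVisible m Z i j) {i' j' : ℤ} (hg : InGrid m i' j') (hne : (i', j') ≠ (i, j))
    (hne0 : (i', j') ≠ (0, 0)) {t : ℝ} (h0 : 0 ≤ t) (h1 : t ≤ 1)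
    (h : (t * (j : ℝ), t * -(i : ℝ)) ∈ interior (cell i' j')) : elev Z i' j' < elev Z i j := by
  obtain ⟨θ, h2, h3⟩ := exists_inSlot_turn hm i j isOpen_interior h
  exact hv θ h2.1 h2.2 i' j' hg hne hne0
    ⟨_, interior_subset h3, mem_segment_zero.2 ⟨t, h0, h1, rfl⟩⟩

lemma SlotVisible.kreveldVisible_interior {m : ℕ} (hm : 1 ≤ m) {Z : ℤ → ℤ → ℝ} {i j : ℤ}
    (hv : SlotVisible m Z i j) : KreveldVisible (fun i' j' => interior (cell i' j')) m Z i j := by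
  rintro i' j' hg hne hne0 ⟨p, hc, hs⟩
  obtain ⟨t, ht0, ht1, rfl⟩ := mem_segment_zero.1 hs
  exact hv.elev_lt hm hg hne hne0 ht0 ht1 hc

lemma mem_interior_cell {i j : ℤ} {x y : ℝ} (hx : |x - j| < 1 / 2) (hy : |y + i| < 1 / 2) :
    (x, y) ∈ interior (cell i j) := by
  have h₁ : IsOpen {p : ℝ × ℝ | |p.1 - (j : ℝ)| < 1 / 2} := isOpen_lt (by fun_prop) (by fun_prop)
  have h₂ : IsOpen {p : ℝ × ℝ | |p.2 + (i : ℝ)| < 1 / 2} := isOpen_lt (by fun_prop) (by fun_prop)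
  refine interior_maximal ?_ (h₁.inter h₂) ⟨hx, hy⟩
  exact fun p hp => ⟨le_of_lt hp.1, le_of_lt hp.2⟩

/-- The azimuth angle of a grid point that is not on an axis or a diagonal is not a rational
multiple of `π`. -/
lemma azim_ne_slot_mul {m : ℕ} (hm : 1 ≤ m) {i j : ℤ} (hi : i ≠ 0) (hj : j ≠ 0) (hij : |i| ≠ |j|)
    (k : ℤ) : (k : ℝ) * (2 * Real.pi / (32 * (m : ℝ))) ≠ azim (j : ℝ) (-(i : ℝ)) := by
  intro h
  have hm' : (0 : ℝ) < m := by exact_mod_cast hm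
  have hi' : (i : ℝ) ≠ 0 := by exact_mod_cast hi
  have hj' : (j : ℝ) ≠ 0 := by exact_mod_cast hj
  have hd : 0 < dist i j := dist_pos (by simp [hi])
  have hd2 : dist i j ^ 2 = (j : ℝ) ^ 2 + (i : ℝ) ^ 2 := Real.sq_sqrt (by positivity)
  have hs : (0 : ℝ) < (j : ℝ) ^ 2 + (i : ℝ) ^ 2 := by positivity
  have hc : Real.cos (2 * azim (j : ℝ) (-(i : ℝ))) * ((j : ℝ) ^ 2 + (i : ℝ) ^ 2) =
      (j : ℝ) ^ 2 - (i : ℝ) ^ 2 := by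
    rw [Real.cos_two_mul]
    have h2 := dist_mul_cos_azim i j
    have h3 : (j : ℝ) ^ 2 = dist i j ^ 2 * Real.cos (azim (j : ℝ) (-(i : ℝ))) ^ 2 := by
      rw [← mul_pow, h2]
    rw [hd2] at h3
    linear_combination -2 * h3
  have hn := niven (θ := 2 * azim (j : ℝ) (-(i : ℝ))) ⟨(k * 4 / (32 * m) : ℚ), by
    rw [← h]; push_cast; field_simp; ring⟩ ⟨((j : ℚ) ^ 2 - (i : ℚ) ^ 2) / ((j : ℚ) ^ 2 + (i : ℚ) ^ 2), by
    push_cast; rw [eq_div_iff hs.ne', hc]⟩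
  have sq3 : ∀ a b : ℤ, b ≠ 0 → a ^ 2 ≠ 3 * b ^ 2 := by
    intro a b hb hab
    have h3 : Irrational (Real.sqrt 3) := by
      simpa using Nat.Prime.irrational_sqrt Nat.prime_three
    apply h3
    refine ⟨|(a : ℚ) / b|, ?_⟩
    have hab' : ((a : ℝ)) ^ 2 = 3 * (b : ℝ) ^ 2 := by exact_mod_cast hab
    have hb' : (b : ℝ) ≠ 0 := by exact_mod_cast hb
    rw [Rat.cast_abs, ← Real.sqrt_sq_eq_abs]
    congr 1
    push_cast
    rw [div_pow, hab']
    field_simp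
  simp only [Set.mem_insert_iff, Set.mem_singleton_iff] at hn
  rcases hn with hn | hn | hn | hn | hn <;> rw [hn] at hc
  · apply hj'; nlinarith
  · have : (i : ℝ) ^ 2 = 3 * (j : ℝ) ^ 2 := by linarith
    exact sq3 i j hj (by exact_mod_cast this)
  · have : (i : ℝ) ^ 2 = (j : ℝ) ^ 2 := by linarith
    have : i ^ 2 = j ^ 2 := by exact_mod_cast this
    exact hij (sq_eq_sq_iff_abs_eq_abs i j |>.1 this)
  · have : (j : ℝ) ^ 2 = 3 * (i : ℝ) ^ 2 := by linarith
    exact sq3 j i hi (by exact_mod_cast this)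
  · apply hi'; nlinarith

lemma eq_zero_of_abs_le_half {a : ℤ} (h : |(a : ℝ)| ≤ 1 / 2) : a = 0 := by
  have h' : |(a : ℝ)| < 1 := by linarith
  exact Int.abs_lt_one_iff.1 (by exact_mod_cast h')

/-- The cells met by a horizontal or vertical line of sight. -/
lemma exists_le_one_of_axis {t : ℝ} {b a : ℤ} (h0 : 0 ≤ t) (h1 : t ≤ 1)
    (h : |t * b - a| ≤ 1 / 2) : ∃ s : ℝ, 0 ≤ s ∧ s ≤ 1 ∧ s * b = a := by
  have hb := between_of_le_one (x := (b : ℝ)) (b := b) (by simp) h0 h1 h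
  rcases hb with ⟨h2, h3⟩ | ⟨h2, h3⟩
  · rcases h2.eq_or_lt with rfl | h4
    · exact ⟨0, le_rfl, zero_le_one, by simp⟩
    · have h5 : (0 : ℝ) < a := by exact_mod_cast h4
      have h6 : (a : ℝ) ≤ b := by exact_mod_cast h3
      exact ⟨a / b, div_nonneg h5.le (by linarith), (div_le_one (by linarith)).2 h6,
        div_mul_cancel₀ _ (by linarith)⟩
  · rcases h3.eq_or_lt with rfl | h4
    · exact ⟨0, le_rfl, zero_le_one, by simp⟩
    · have h5 : (a : ℝ) < 0 := by exact_mod_cast h4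
      have h6 : (b : ℝ) ≤ a := by exact_mod_cast h2
      exact ⟨a / b, div_nonneg_of_nonpos h5.le (by linarith),
        (div_le_one_of_neg (by linarith)).2 h6, div_mul_cancel₀ _ (by linarith)⟩

lemma SlotVisible.kreveldVisible {m : ℕ} (hm : 1 ≤ m) {Z : ℤ → ℤ → ℝ} {i j : ℤ}
    (hv : SlotVisible m Z i j) (hij : |i| ≠ |j|) : KreveldVisible cell m Z i j := by
  rintro i' j' hg hne hne0 ⟨p, hc, hs⟩
  obtain ⟨t, ht0, ht1, rfl⟩ := mem_segment_zero.1 hs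
  obtain ⟨c1, c2⟩ := hc
  simp only at c1 c2
  by_cases hi : i = 0
  · subst hi
    have h1 : i' = 0 := by
      apply eq_zero_of_abs_le_half
      simpa using c2
    obtain ⟨s, hs0, hs1, hs⟩ := exists_le_one_of_axis ht0 ht1 c1
    refine hv.elev_lt hm hg hne hne0 hs0 hs1 (mem_interior_cell ?_ ?_)
    · rw [hs]; simp
    · simp [h1]
  by_cases hj : j = 0
  · subst hj
    have h1 : j' = 0 := by
      apply eq_zero_of_abs_le_half
      simpa using c1
    have c3 : |t * (i : ℝ) - i'| ≤ 1 / 2 := by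
      rw [← abs_neg]; convert c2 using 2; ring
    obtain ⟨s, hs0, hs1, hs⟩ := exists_le_one_of_axis ht0 ht1 c3
    refine hv.elev_lt hm hg hne hne0 hs0 hs1 (mem_interior_cell ?_ ?_)
    · simp [h1]
    · rw [mul_neg, hs]; simp
  · have h1 : InSlot m (slotOf m i j) (azim (j : ℝ) (-(i : ℝ))) :=
      ⟨(slotOf_mul_le hm i j).lt_of_ne (azim_ne_slot_mul hm hi hj hij _),
        lt_slotOf_add_one_mul hm i j⟩
    refine hv _ h1.1 h1.2 i' j' hg hne hne0 ⟨(t * (j : ℝ), t * -(i : ℝ)), ⟨c1, c2⟩, ?_⟩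
    rw [dist_mul_cos_azim, dist_mul_sin_azim]
    exact hs

/-! ### The contents of the memory -/

lemma elevAddr_bounds {m : ℕ} {i j : ℤ} (h : InGrid m i j) :
    0 ≤ elevAddr m i j ∧ elevAddr m i j < (2 * m + 1) * (2 * m + 1) := by
  obtain ⟨h1, h2⟩ := h
  rw [abs_le] at h1 h2
  rw [elevAddr]
  constructor <;> nlinarith

lemma elevAddr_inj {m : ℕ} {i j i' j' : ℤ} (h : InGrid m i j) (h' : InGrid m i' j')
    (he : elevAddr m i j = elevAddr m i' j') : (i, j) = (i', j') := by
  obtain ⟨h1, h2⟩ := h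
  obtain ⟨h3, h4⟩ := h'
  rw [abs_le] at h1 h2 h3 h4
  rw [elevAddr, elevAddr] at he
  have hi : i = i' := by
    rcases lt_trichotomy i i' with h | h | h
    · nlinarith
    · exact h
    · nlinarith
  subst hi
  rw [Prod.mk.injEq]
  exact ⟨rfl, by linarith⟩

lemma visAddr_eq (m : ℕ) (i j : ℤ) :
    visAddr m i j = (2 * m + 1) * (2 * m + 1) + elevAddr m i j := by
  rw [visAddr, sq]

/-- Grid points whose elevation enters the horizon. -/
def Counted (m : ℕ) (p : ℤ × ℤ) : Prop := InGrid m p.1 p.2 ∧ p ≠ (0, 0)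

lemma Counted.one_le {m : ℕ} {p : ℤ × ℤ} (h : Counted m p) : 1 ≤ m := by
  by_contra! hc
  obtain ⟨⟨h1, h2⟩, h3⟩ := h
  rw [abs_le] at h1 h2
  exact h3 (Prod.ext (by simp only; omega) (by simp only; omega))

lemma visit_of_counted {m : ℕ} {Z : ℤ → ℤ → ℝ} {μ : Mem} (hμ : HoldsTerrain m Z μ) {p : ℤ × ℤ}
    (hp : Counted m p) (a : ℤ) : visit m μ p a =
      open scoped Classical in
      if ∃ l, firstSlot m p.1 p.2 ≤ l ∧ l ≤ endSlot m p.1 p.2 - 1 ∧ a = slotAddr m l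
        then max (visStep m p.1 p.2 μ a) (elev Z p.1 p.2 : EReal) else visStep m p.1 p.2 μ a := by
  obtain ⟨i, j⟩ := p
  obtain ⟨hg, h0⟩ := hp
  have hi := (abs_le.1 hg.1).2
  have hj := (abs_le.1 hg.2).2
  have hz : Real.arctan ((μ (elevAddr m i j)).toReal / dist i j) = elev Z i j := by
    rw [hμ i j hg, EReal.toReal_coe]; rfl
  rw [visit, (sweepCell_exec_of_inGrid m i j hi hj h0 μ).1, (sweepPoint_exec m i j μ).1, hz,
    horizonStep, (raiseSlots_spec m _ _ _ _ (by
      have := Int.self_le_toNat (endSlot m i j - firstSlot m i j + 1); omega) _).1]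

lemma visStep_of_ne {m : ℕ} {i j a : ℤ} {μ : Mem} (h : a ≠ visAddr m i j) :
    visStep m i j μ a = μ a := by
  rw [visStep, Function.update_of_ne h]

/-- Address of the slot `k` of the horizon array. -/
lemma slotAddr_of_lt {m : ℕ} {k : ℤ} (h0 : 0 ≤ k) (h : k < 32 * m) :
    slotAddr m k = 2 * ((2 * m + 1) * (2 * m + 1)) + k := by
  rw [slotAddr, Int.emod_eq_of_lt h0 h]

lemma slotAddr_ne_visAddr {m : ℕ} (hm : 1 ≤ m) {i j : ℤ} (h : InGrid m i j) (l : ℤ) :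
    slotAddr m l ≠ visAddr m i j := by
  have h1 := slotAddr_bounds hm l
  have h2 := elevAddr_bounds h
  rw [visAddr_eq]
  linarith

lemma slotAddr_ne_elevAddr {m : ℕ} (hm : 1 ≤ m) {i j : ℤ} (h : InGrid m i j) (l : ℤ) :
    slotAddr m l ≠ elevAddr m i j := by
  have h1 := slotAddr_bounds hm l
  have h2 := elevAddr_bounds h
  linarith

lemma elevAddr_ne_visAddr {m : ℕ} {i j i' j' : ℤ} (h : InGrid m i j) (h' : InGrid m i' j') :
    elevAddr m i j ≠ visAddr m i' j' := by
  have h1 := elevAddr_bounds h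
  have h2 := elevAddr_bounds h'
  rw [visAddr_eq]
  linarith

lemma visAddr_inj {m : ℕ} {i j i' j' : ℤ} (h : InGrid m i j) (h' : InGrid m i' j')
    (he : visAddr m i j = visAddr m i' j') : (i, j) = (i', j') := by
  rw [visAddr_eq, visAddr_eq, add_right_inj] at he
  exact elevAddr_inj h h' he

lemma visit_zero (m : ℕ) (μ : Mem) : visit m μ (0, 0) = Function.update μ (visAddr m 0 0) 1 :=
  (sweepCell_exec_zero m μ).1

lemma inGrid_zero (m : ℕ) : InGrid m 0 0 := by simp [InGrid]

lemma visit_of_not_inGrid {m : ℕ} {p : ℤ × ℤ} (hp : -(m : ℤ) ≤ p.1 ∧ -(m : ℤ) ≤ p.2)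
    (h : ¬ InGrid m p.1 p.2) (μ : Mem) : visit m μ p = μ := by
  refine (sweepCell_exec_of_not_inGrid m p.1 p.2 (fun h' => h ?_) μ).1
  exact ⟨abs_le.2 ⟨hp.1, h'.1⟩, abs_le.2 ⟨hp.2, h'.2⟩⟩

lemma visit_elevAddr {m : ℕ} {Z : ℤ → ℤ → ℝ} {μ : Mem} (hμ : HoldsTerrain m Z μ) {p : ℤ × ℤ}
    (hp : -(m : ℤ) ≤ p.1 ∧ -(m : ℤ) ≤ p.2) : HoldsTerrain m Z (visit m μ p) := by
  intro i j hg
  rw [← hμ i j hg]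
  by_cases h : InGrid m p.1 p.2
  · by_cases h0 : p = (0, 0)
    · rw [h0, visit_zero, Function.update_of_ne (elevAddr_ne_visAddr hg (inGrid_zero m))]
    · have hc : Counted m p := ⟨h, h0⟩
      rw [visit_of_counted hμ hc, if_neg, visStep_of_ne (elevAddr_ne_visAddr hg h)]
      rintro ⟨l, -, -, hl⟩
      exact slotAddr_ne_elevAddr hc.one_le hg l hl.symm
  · rw [visit_of_not_inGrid hp h]

lemma visit_visAddr {m : ℕ} {Z : ℤ → ℤ → ℝ} {μ : Mem} (hμ : HoldsTerrain m Z μ) {p : ℤ × ℤ}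
    (hp : -(m : ℤ) ≤ p.1 ∧ -(m : ℤ) ≤ p.2) {i j : ℤ} (hg : InGrid m i j) (hne : p ≠ (i, j)) :
    visit m μ p (visAddr m i j) = μ (visAddr m i j) := by
  by_cases h : InGrid m p.1 p.2
  · by_cases h0 : p = (0, 0)
    · rw [h0, visit_zero, Function.update_of_ne]
      intro he
      exact hne (h0.trans (visAddr_inj hg (inGrid_zero m) he).symm)
    · have hc : Counted m p := ⟨h, h0⟩
      rw [visit_of_counted hμ hc, if_neg, visStep_of_ne]
      · intro he; exact hne (visAddr_inj hg h he).symm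
      · rintro ⟨l, -, -, hl⟩
        exact slotAddr_ne_visAddr hc.one_le hg l hl.symm
  · rw [visit_of_not_inGrid hp h]

open scoped Classical in
lemma visit_visAddr_self {m : ℕ} {Z : ℤ → ℤ → ℝ} {μ : Mem} (hμ : HoldsTerrain m Z μ) {i j : ℤ}
    (hc : Counted m (i, j)) : visit m μ (i, j) (visAddr m i j) =
      if μ (slotAddr m (slotOf m i j)) < (elev Z i j : EReal) then 1 else 0 := by
  rw [visit_of_counted hμ hc, if_neg]
  · rw [visStep, Function.update_self,
      slotAddr_of_lt (slotOf_nonneg m i j) (slotOf_lt hc.one_le i j), hμ i j hc.1,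
      EReal.toReal_coe]
    rfl
  · rintro ⟨l, -, -, hl⟩
    exact slotAddr_ne_visAddr hc.one_le hc.1 l hl.symm

lemma visit_slotAddr_lt_iff {m : ℕ} (hm : 1 ≤ m) {Z : ℤ → ℤ → ℝ} {μ : Mem}
    (hμ : HoldsTerrain m Z μ) {p : ℤ × ℤ} (hp : -(m : ℤ) ≤ p.1 ∧ -(m : ℤ) ≤ p.2) (k : ℤ) (x : EReal) :
    visit m μ p (slotAddr m k) < x ↔ μ (slotAddr m k) < x ∧
      (Counted m p → Covered m k p.1 p.2 → (elev Z p.1 p.2 : EReal) < x) := by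
  by_cases h : InGrid m p.1 p.2
  · by_cases h0 : p = (0, 0)
    · subst h0
      rw [visit_zero, Function.update_of_ne (slotAddr_ne_visAddr hm (inGrid_zero m) k)]
      simp [Counted]
    · have hc : Counted m p := ⟨h, h0⟩
      rw [visit_of_counted hμ hc, visStep_of_ne (slotAddr_ne_visAddr hm h k)]
      have hi := covered_iff hm (k := k) (i := p.1) (j := p.2) h0
      split_ifs with hcov
      · rw [max_lt_iff]
        simp [hc, hi.1 hcov]
      · have : ¬ Covered m k p.1 p.2 := fun h' => hcov (hi.2 h')
        simp [this]
  · rw [visit_of_not_inGrid hp h]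
    simp [Counted, h]

lemma foldl_visit_spec {m : ℕ} {Z : ℤ → ℤ → ℝ} {μ : Mem} (hμ : HoldsTerrain m Z μ)
    (l : List (ℤ × ℤ)) (hl : ∀ p ∈ l, -(m : ℤ) ≤ p.1 ∧ -(m : ℤ) ≤ p.2) :
    HoldsTerrain m Z (l.foldl (visit m) μ) ∧
    (1 ≤ m → ∀ k x, l.foldl (visit m) μ (slotAddr m k) < x ↔ μ (slotAddr m k) < x ∧
      ∀ p ∈ l, Counted m p → Covered m k p.1 p.2 → (elev Z p.1 p.2 : EReal) < x) ∧
    ∀ i j, InGrid m i j → (i, j) ∉ l →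
      l.foldl (visit m) μ (visAddr m i j) = μ (visAddr m i j) := by
  induction l generalizing μ with
  | nil => exact ⟨hμ, by simp, by simp⟩
  | cons p l ih =>
    have hp := hl p (by simp)
    obtain ⟨h1, h2, h3⟩ := ih (visit_elevAddr hμ hp) (fun q hq => hl q (by simp [hq]))
    refine ⟨h1, fun hm k x => ?_, fun i j hg hij => ?_⟩
    · rw [List.foldl_cons, h2 hm, visit_slotAddr_lt_iff hm hμ hp, and_assoc]
      simp
    · rw [List.mem_cons, not_or] at hij
      rw [List.foldl_cons, h3 i j hg hij.2, visit_visAddr hμ hp hg (Ne.symm hij.1)]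

lemma initMem_spec {m : ℕ} {Z : ℤ → ℤ → ℝ} {μ : Mem} (hμ : HoldsTerrain m Z μ) :
    HoldsTerrain m Z (initMem m μ) ∧
      ∀ k : ℤ, 0 ≤ k → k < 32 * m → initMem m μ (slotAddr m k) = ⊥ := by
  classical
  have h := (clearSlots_spec m (32 * m + 1) 0 le_rfl (by push_cast; omega) μ).1
  constructor
  · intro i j hg
    rw [initMem, h, if_neg, hμ i j hg]
    rintro ⟨l, h1, h2, h3⟩
    exact slotAddr_ne_elevAddr (by omega) hg l h3.symm
  · intro k h1 h2
    rw [initMem, h, if_pos ⟨k, h1, h2, rfl⟩]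

lemma centrifugalSweep_mem (m : ℕ) : ∃ d, 2 * m + 1 ≤ 2 ^ d ∧ ∀ μ,
    ((centrifugalSweep m).exec μ).mem =
      (sweepOrder d (-m) (-m)).foldl (visit m) (initMem m μ) := by
  obtain ⟨d, h1, -, h2, h3⟩ := centrifugalSweep_exec m
  exact ⟨d, h2, fun μ => by rw [(h3 μ).1, sweepRec_mem m d _ h1]⟩

open scoped Classical in
/-- The visibility grid that is computed. -/
theorem centrifugalSweep_visAddr (m : ℕ) (Z : ℤ → ℤ → ℝ) (μ : Mem) (hμ : HoldsTerrain m Z μ) :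
    ((centrifugalSweep m).exec μ).mem (visAddr m 0 0) = 1 ∧
    ∀ i j : ℤ, InGrid m i j → (i, j) ≠ (0, 0) →
      ((centrifugalSweep m).exec μ).mem (visAddr m i j) = if SlotVisible m Z i j then 1 else 0 := by
  obtain ⟨d, hd, hmem⟩ := centrifugalSweep_mem m
  have hd' : 2 * (m : ℤ) + 1 ≤ 2 ^ d := by exact_mod_cast hd
  obtain ⟨hi1, hi2⟩ := initMem_spec hμ
  have hrange : ∀ p ∈ sweepOrder d (-(m : ℤ)) (-(m : ℤ)), -(m : ℤ) ≤ p.1 ∧ -(m : ℤ) ≤ p.2 := by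
    rintro ⟨x, y⟩ hp
    rw [mem_sweepOrder] at hp
    exact ⟨hp.1.1, hp.2.1⟩
  have hall : ∀ p : ℤ × ℤ, InGrid m p.1 p.2 → p ∈ sweepOrder d (-(m : ℤ)) (-(m : ℤ)) := by
    rintro ⟨x, y⟩ ⟨h1, h2⟩
    rw [abs_le] at h1 h2
    rw [mem_sweepOrder]
    simp only at h1 h2
    omega
  have hpw := sweepOrder_pairwise d (-(m : ℤ)) (-(m : ℤ))
  have key : ∀ i j, InGrid m i j → ∃ l : List (ℤ × ℤ), (∀ p ∈ l, -(m : ℤ) ≤ p.1 ∧ -(m : ℤ) ≤ p.2) ∧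
      (∀ p : ℤ × ℤ, InGrid m p.1 p.2 → p ≠ (i, j) → Between p.1 i → Between p.2 j → p ∈ l) ∧
      (∀ p ∈ l, ¬ (Between i p.1 ∧ Between j p.2)) ∧
      ((centrifugalSweep m).exec μ).mem (visAddr m i j) =
        visit m (l.foldl (visit m) (initMem m μ)) (i, j) (visAddr m i j) := by
    intro i j hg
    obtain ⟨l, l', he⟩ := List.append_of_mem (hall (i, j) hg)
    rw [he] at hpw hrange hall
    rw [List.pairwise_append, List.pairwise_cons] at hpw
    obtain ⟨-, ⟨hp1, -⟩, hp2⟩ := hpw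
    have hr : ∀ p ∈ l, -(m : ℤ) ≤ p.1 ∧ -(m : ℤ) ≤ p.2 := fun p hp => hrange p (by simp [hp])
    refine ⟨l, hr, ?_, ?_, ?_⟩
    · intro p hg' hne b1 b2
      have h1 := hall p hg'
      simp only [List.mem_append, List.mem_cons] at h1
      rcases h1 with h1 | h1 | h1
      · exact h1
      · exact absurd h1 hne
      · exact absurd ⟨b1, b2⟩ (hp1 p h1).2
    · intro p hp
      exact (hp2 p hp (i, j) (by simp)).2
    · rw [hmem, he, List.foldl_append, List.foldl_cons]
      refine (foldl_visit_spec (Z := Z) ?_ l' fun p hp => hrange p (by simp [hp])).2.2 i j hg ?_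
      · exact visit_elevAddr (foldl_visit_spec hi1 l hr).1 (hrange (i, j) (by simp))
      · intro hmem'
        exact (hp1 _ hmem').1 rfl
  constructor
  · obtain ⟨l, -, -, -, h⟩ := key 0 0 (inGrid_zero m)
    rw [h, visit_zero, Function.update_self]
  · intro i j hg h0
    obtain ⟨l, h1, h2, h3, h⟩ := key i j hg
    have hc : Counted m (i, j) := ⟨hg, h0⟩
    have hm := hc.one_le
    obtain ⟨f1, f2, -⟩ := foldl_visit_spec hi1 l h1
    rw [h, visit_visAddr_self f1 hc]
    refine if_congr ?_ rfl rfl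
    rw [f2 hm, hi2 _ (slotOf_nonneg m i j) (slotOf_lt hm i j),
      slotVisible_iff hm Z hg h0 l h2 h3]
    simp only [EReal.bot_lt_coe, true_and, EReal.coe_lt_coe_iff, Counted, and_imp]

/-! ### Running time -/

/-- Upper bound for the cost of a grid point, together with its share of the cost of the
recursion. -/
noncomputable def weight (m : ℕ) (p : ℤ × ℤ) : ℝ := 230 + 448 * ((m : ℝ) / supDist p.1 p.2)

lemma weight_nonneg (m : ℕ) (p : ℤ × ℤ) : 0 ≤ weight m p := by
  rw [weight]; positivity

lemma sweepCell_time (m : ℕ) (i j : ℤ) (μ : Mem) :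
    (((sweepCell (consts m) i j).exec μ).time : ℝ) ≤ 95 + 448 * ((m : ℝ) / supDist i j) := by
  have h0 : 0 ≤ (m : ℝ) / supDist i j := by positivity
  by_cases h : i ≤ m ∧ j ≤ m
  · by_cases hz : (i, j) = (0, 0)
    · rw [Prod.mk.injEq] at hz
      rw [hz.1, hz.2] at h0 ⊢
      have : (((sweepCell (consts m) 0 0).exec μ).time : ℝ) ≤ 10 := by
        exact_mod_cast (sweepCell_exec_zero m μ).2.1
      linarith
    · rw [(sweepCell_exec_of_inGrid m i j h.1 h.2 hz μ).2.1]
      have h1 := (sweepPoint_exec m i j μ).2.1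
      rw [horizonStep] at h1
      have h2 := (raiseSlots_spec m (Real.arctan ((μ (elevAddr m i j)).toReal / dist i j))
        (endSlot m i j - 1) (endSlot m i j - firstSlot m i j + 1).toNat (firstSlot m i j) (by
        have := Int.self_le_toNat (endSlot m i j - firstSlot m i j + 1); omega)
        (visStep m i j μ)).2.1
      have h3 := h1.trans (Nat.add_le_add_left h2 70)
      have h4 : (((sweepPoint (consts m) i j).exec μ).time : ℝ) ≤
          70 + 7 * ((endSlot m i j - firstSlot m i j + 1).toNat : ℝ) := by exact_mod_cast h3
      have h5 := endSlot_sub_firstSlot_le m hz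
      have h6 : ((endSlot m i j - firstSlot m i j + 1).toNat : ℝ) ≤
          64 * ((m : ℝ) / supDist i j) + 3 := by
        rcases le_total 0 (endSlot m i j - firstSlot m i j + 1) with hn | hn
        · have : (((endSlot m i j - firstSlot m i j + 1).toNat : ℤ) : ℝ) =
              ((endSlot m i j - firstSlot m i j + 1 : ℤ) : ℝ) := by rw [Int.toNat_of_nonneg hn]
          rw [Int.cast_natCast] at this
          rw [this]
          push_cast
          linarith
        · rw [Int.toNat_of_nonpos hn]
          push_cast
          linarith
      push_cast
      linarith
  · have : (((sweepCell (consts m) i j).exec μ).time : ℝ) ≤ 2 := by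
      exact_mod_cast (sweepCell_exec_of_not_inGrid m i j h μ).2.1
    linarith

lemma sweepRec_time (m d depth : ℕ) (hd : d < depth) (i j F : ℤ) (μ : Mem) :
    (((sweepRec (consts m) depth i j (2 ^ d) F).exec μ).time : ℝ) + 100 ≤
      ((sweepOrder d i j).map (weight m)).sum := by
  induction d generalizing depth i j F μ with
  | zero =>
    obtain ⟨depth, rfl⟩ := Nat.exists_eq_succ_of_ne_zero (by omega : depth ≠ 0)
    rw [pow_zero, (sweepRec_one _ _ _ _ _ _).2.1]
    have := sweepCell_time m i j μ
    simp only [sweepOrder, List.map_cons, List.map_nil, List.sum_cons, List.sum_nil, weight]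
    push_cast
    linarith
  | succ d ih =>
    obtain ⟨depth, rfl⟩ := Nat.exists_eq_succ_of_ne_zero (by omega : depth ≠ 0)
    have h1 := (sweepRec_two_pow_succ (consts m) depth d i j F μ).2.1
    have hlen : (quadrants i j (2 ^ d)).length = 4 := (quadrants_perm i j (2 ^ d)).length_eq
    have key : ∀ (l : List Tile) (μ : Mem),
        (((forEach (visitQuadrant (consts m) depth (2 ^ d) F) l).exec μ).time : ℝ) +
          68 * l.length ≤ ((l.flatMap fun t => sweepOrder d t.row t.col).map (weight m)).sum := by
      intro l
      induction l with
      | nil => intro μ; simp [forEach]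
      | cons t l ihl =>
        intro μ
        rw [(forEach_cons_exec _ _ _ _).2.1, (visitQuadrant_exec _ _ _ _ _ _).2.1]
        have h2 := ih depth (by omega) t.row t.col (F + (frameSize : ℤ)) μ
        have h3 := ihl ((visitQuadrant (consts m) depth (2 ^ d) F t).exec μ).mem
        rw [List.flatMap_cons, List.map_append, List.sum_append, List.length_cons]
        push_cast
        linarith
    have h2 := key (quadrants i j (2 ^ d)) μ
    have h3 : (((sweepRec (consts m) (depth + 1) i j (2 ^ (d + 1)) F).exec μ).time : ℝ) ≤
      130 + (((forEach (visitQuadrant (consts m) depth (2 ^ d) F)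
        (quadrants i j (2 ^ d))).exec μ).time : ℝ) := by exact_mod_cast h1
    rw [hlen] at h2
    rw [sweepOrder]
    push_cast at h2
    linarith

lemma sum_div_supDist_le (m ρ : ℕ) :
    ∑ p ∈ Finset.Icc (-(ρ : ℤ × ℤ)) ρ, (m : ℝ) / supDist p.1 p.2 ≤ 8 * m * ρ := by
  induction ρ with
  | zero =>
    have : Finset.Icc (-((0 : ℕ) : ℤ × ℤ)) ((0 : ℕ) : ℤ × ℤ) = {0} := by simp
    rw [this]
    simp [supDist]
  | succ ρ ih =>
    rw [← Nat.succ_eq_add_one, ← Finset.box_succ_disjUnion, Finset.sum_disjUnion]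
    have h : ∑ p ∈ (Finset.box (ρ + 1) : Finset (ℤ × ℤ)), (m : ℝ) / supDist p.1 p.2 = 8 * m := by
      have h1 : ∀ p ∈ (Finset.box (ρ + 1) : Finset (ℤ × ℤ)),
          (m : ℝ) / supDist p.1 p.2 = m / ((ρ + 1 : ℕ) : ℝ) := by
        intro p hp
        rw [Int.mem_box] at hp
        rw [supDist, hp]
      rw [Finset.sum_congr rfl h1, Finset.sum_const, Int.card_box (by omega), nsmul_eq_mul]
      push_cast
      field_simp
    rw [h]
    push_cast
    linarith

lemma mem_Icc_of_supDist_le {p : ℤ × ℤ} {ρ : ℕ} (h : supDist p.1 p.2 ≤ ρ) :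
    p ∈ Finset.Icc (-(ρ : ℤ × ℤ)) ρ := by
  rw [supDist] at h
  rw [Finset.mem_Icc, Prod.le_def, Prod.le_def]
  simp only [Prod.fst_neg, Prod.fst_natCast, Prod.snd_neg, Prod.snd_natCast]
  omega

open scoped Classical in
lemma sum_weight_le (m ρ : ℕ) (l : List (ℤ × ℤ)) (hl : l.Nodup) :
    (l.map fun p => if supDist p.1 p.2 ≤ ρ then weight m p else 0).sum ≤
      230 * (2 * ρ + 1) ^ 2 + 3584 * (m * ρ) := by
  rw [← List.sum_toFinset _ hl, ← Finset.sum_filter]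
  have h1 : l.toFinset.filter (fun p => supDist p.1 p.2 ≤ ρ) ⊆ Finset.Icc (-(ρ : ℤ × ℤ)) ρ := by
    intro p hp
    exact mem_Icc_of_supDist_le (Finset.mem_filter.1 hp).2
  refine (Finset.sum_le_sum_of_subset_of_nonneg h1 fun p _ _ => weight_nonneg m p).trans ?_
  unfold weight
  rw [Finset.sum_add_distrib, ← Finset.mul_sum, Finset.sum_const]
  have h2 : (Finset.Icc (-(ρ : ℤ × ℤ)) ρ).card = (2 * ρ + 1) ^ 2 := by
    rw [Finset.card_Icc_prod]
    simp only [Prod.fst_neg, Prod.fst_natCast, Prod.snd_neg, Prod.snd_natCast, Int.card_Icc]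
    rw [sq]
    congr 1 <;> omega
  rw [h2, nsmul_eq_mul]
  push_cast
  have := sum_div_supDist_le m ρ
  linarith

lemma sweepOrder_nodup (d : ℕ) (i j : ℤ) : (sweepOrder d i j).Nodup :=
  (sweepOrder_pairwise d i j).imp fun h => h.1

lemma supDist_le_of_mem_sweepOrder {m d : ℕ} (hd : 2 ^ d < 2 * (2 * m + 1)) {p : ℤ × ℤ}
    (hp : p ∈ sweepOrder d (-m) (-m)) : supDist p.1 p.2 ≤ 3 * m + 1 := by
  obtain ⟨x, y⟩ := p
  have hd' : (2 : ℤ) ^ d < 2 * (2 * m + 1) := by exact_mod_cast hd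
  rw [mem_sweepOrder] at hp
  rw [supDist]
  omega

lemma sum_weight_sweepOrder_le {m d : ℕ} (hd : 2 ^ d < 2 * (2 * m + 1)) :
    ((sweepOrder d (-m) (-m)).map (weight m)).sum ≤ 8000 * (2 * (m : ℝ) + 1) ^ 2 := by
  classical
  have h := sum_weight_le m (3 * m + 1) _ (sweepOrder_nodup d (-m) (-m))
  rw [List.map_congr_left (g := weight m) fun p hp =>
    if_pos (supDist_le_of_mem_sweepOrder hd hp)] at h
  refine h.trans ?_
  push_cast
  have : (0 : ℝ) ≤ m := by positivity
  nlinarith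

theorem centrifugalSweep_time (m : ℕ) (μ : Mem) :
    ((centrifugalSweep m).exec μ).time ≤ 9000 * (2 * m + 1) ^ 2 := by
  obtain ⟨d, h1, h2, -, h3⟩ := centrifugalSweep_exec m
  have h4 := (h3 μ).2.1
  have h5 := sweepRec_time m d _ h1 (-m) (-m) (2 * ((2 * m + 1) * (2 * m + 1)) + 32 * m)
    (initMem m μ)
  have h6 := sum_weight_sweepOrder_le h2
  have h7 : (((centrifugalSweep m).exec μ).time : ℝ) ≤ 132 * m + 30 +
    (((sweepRec (consts m) (2 * m + 2) (-m) (-m) (2 ^ d)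
      (2 * ((2 * m + 1) * (2 * m + 1)) + 32 * m)).exec (initMem m μ)).time : ℝ) := by
    exact_mod_cast h4
  have h8 : (((centrifugalSweep m).exec μ).time : ℝ) ≤ 9000 * (2 * (m : ℝ) + 1) ^ 2 := by
    have : (0 : ℝ) ≤ m := by positivity
    nlinarith
  exact_mod_cast h8

lemma length_trace_le {α : Type} (p : Prog α) (μ : Mem) : (p.exec μ).trace.length ≤ (p.exec μ).time := by
  induction p generalizing μ with
  | ret a => simp [Prog.exec]
  | step i k ih =>
    have h := ih (i.value μ) (i.memory μ)
    have : i.accesses.length ≤ 1 := by cases i <;> simp [Instr.accesses]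
    simp only [Prog.exec, List.length_append]
    omega

/-! ### Memory accesses -/

/-- Some ray with direction in the closed slot `k` meets the cell of `(i, j)`. -/
def Touched (m : ℕ) (k i j : ℤ) : Prop :=
  ∃ θ, (k : ℝ) * (2 * Real.pi / (32 * (m : ℝ))) ≤ θ ∧
    θ ≤ ((k : ℝ) + 1) * (2 * Real.pi / (32 * (m : ℝ))) ∧
    ∃ ρ : ℝ, 0 ≤ ρ ∧ (ρ * Real.cos θ, ρ * Real.sin θ) ∈ cell i j

lemma Covered.touched {m : ℕ} {k i j : ℤ} (h : Covered m k i j) : Touched m k i j := by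
  obtain ⟨θ, hθ, ρ, hρ, hc⟩ := h
  exact ⟨θ, hθ.1.le, hθ.2.le, ρ, hρ.le, hc⟩

lemma touched_slotOf {m : ℕ} (hm : 1 ≤ m) (i j : ℤ) : Touched m (slotOf m i j) i j := by
  refine ⟨_, slotOf_mul_le hm i j, (lt_slotOf_add_one_mul hm i j).le, dist i j,
    Real.sqrt_nonneg _, ?_⟩
  rw [dist_mul_cos_azim, dist_mul_sin_azim]
  constructor <;> simp

/-- The addresses used for the grid point `p`. -/
def UsedFor (m : ℕ) (a : ℤ) (p : ℤ × ℤ) : Prop :=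
  a = elevAddr m p.1 p.2 ∨ a = visAddr m p.1 p.2 ∨
    Counted m p ∧ ∃ l, a = slotAddr m l ∧ Touched m l p.1 p.2

lemma sweepCell_trace {m : ℕ} {i j : ℤ} (hi : -(m : ℤ) ≤ i) (hj : -(m : ℤ) ≤ j) (μ : Mem)
    {e : ℤ × Bool} (he : e ∈ ((sweepCell (consts m) i j).exec μ).trace) :
    InGrid m i j ∧ UsedFor m e.1 (i, j) := by
  by_cases h : i ≤ m ∧ j ≤ m
  · have hg : InGrid m i j := ⟨abs_le.2 ⟨hi, h.1⟩, abs_le.2 ⟨hj, h.2⟩⟩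
    refine ⟨hg, ?_⟩
    by_cases hz : (i, j) = (0, 0)
    · rw [Prod.mk.injEq] at hz
      rw [hz.1, hz.2, (sweepCell_exec_zero m μ).2.2, List.mem_singleton] at he
      rw [hz.1, hz.2, he]
      exact .inr (.inl rfl)
    · have hc : Counted m (i, j) := ⟨hg, hz⟩
      rw [(sweepCell_exec_of_inGrid m i j h.1 h.2 hz μ).2.2, (sweepPoint_exec m i j μ).2.2] at he
      simp only [List.cons_append, List.nil_append, List.mem_cons] at he
      rcases he with rfl | rfl | rfl | he
      · exact .inl rfl
      · refine .inr (.inr ⟨hc, slotOf m i j, ?_, touched_slotOf hc.one_le i j⟩)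
        rw [slotAddr_of_lt (slotOf_nonneg m i j) (slotOf_lt hc.one_le i j)]
      · exact .inr (.inl rfl)
      · rw [horizonStep] at he
        obtain ⟨l, h1, h2, h3⟩ := (raiseSlots_spec m _ _ _ _ (by
          have := Int.self_le_toNat (endSlot m i j - firstSlot m i j + 1); omega) _).2.2 e he
        exact .inr (.inr ⟨hc, l, h3, ((covered_iff hc.one_le hz).1 ⟨l, h1, h2, rfl⟩).touched⟩)
  · rw [(sweepCell_exec_of_not_inGrid m i j h μ).2.2] at he
    simp at he

lemma sweepRec_trace (m d depth : ℕ) (hd : d < depth) {i j : ℤ} (hi : -(m : ℤ) ≤ i)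
    (hj : -(m : ℤ) ≤ j) (F : ℤ) (μ : Mem) {e : ℤ × Bool}
    (he : e ∈ ((sweepRec (consts m) depth i j (2 ^ d) F).exec μ).trace) :
    (F ≤ e.1 ∧ e.1 < F + (16 * (d + 1) : ℕ)) ∨
      ∃ p ∈ sweepOrder d i j, InGrid m p.1 p.2 ∧ UsedFor m e.1 p := by
  induction d generalizing depth i j F μ with
  | zero =>
    obtain ⟨depth, rfl⟩ := Nat.exists_eq_succ_of_ne_zero (by omega : depth ≠ 0)
    rw [pow_zero, (sweepRec_one _ _ _ _ _ _).2.2, List.mem_append] at he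
    rcases he with he | he
    · left
      simpa [frameSize] using (touchFrame_exec _ _ _).2.2 e he
    · right
      exact ⟨(i, j), by simp [sweepOrder], sweepCell_trace hi hj μ he⟩
  | succ d ih =>
    obtain ⟨depth, rfl⟩ := Nat.exists_eq_succ_of_ne_zero (by omega : depth ≠ 0)
    have hframe : ∀ μ : Mem, e ∈ ((touchFrame frameSize F).exec μ).trace →
        F ≤ e.1 ∧ e.1 < F + (16 * (d + 1 + 1) : ℕ) := by
      intro μ he
      have := (touchFrame_exec _ _ _).2.2 e he
      simp only [frameSize] at this
      push_cast at this ⊢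
      omega
    rw [(sweepRec_two_pow_succ _ _ _ _ _ _ _).2.2, List.mem_append] at he
    rcases he with he | he
    · exact .inl (hframe μ he)
    · rw [sweepOrder]
      have hq : ∀ t ∈ quadrants i j (2 ^ d), -(m : ℤ) ≤ t.row ∧ -(m : ℤ) ≤ t.col := by
        intro t ht
        have h2 : (0 : ℤ) < 2 ^ d := by positivity
        obtain ⟨h3, h4, -⟩ := mem_quadrants.1 ht
        omega
      generalize quadrants i j (2 ^ d) = l at he hq
      induction l generalizing μ with
      | nil => simp [forEach] at he
      | cons t l ihl =>
        rw [(forEach_cons_exec _ _ _ _).2.2, (visitQuadrant_exec _ _ _ _ _ _).2.2,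
          List.mem_append, List.mem_append] at he
        have ht := hq t (by simp)
        rcases he with (he | he) | he
        · rcases ih depth (by omega) ht.1 ht.2 _ μ he with h | ⟨p, hp, h⟩
          · left
            simp only [frameSize] at h
            push_cast at h ⊢
            omega
          · right
            exact ⟨p, List.mem_flatMap.2 ⟨t, by simp, hp⟩, h⟩
        · exact .inl (hframe _ he)
        · rcases ihl _ he fun u hu => hq u (by simp [hu]) with h | ⟨p, hp, h⟩
          · exact .inl h
          · right
            refine ⟨p, ?_, h⟩
            rw [List.flatMap_cons, List.mem_append]
            exact .inr hp

/-- The blocks of `w` intervals of `w` addresses each. -/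
lemma exists_finset_rows (B : ℕ) (hB : 1 ≤ B) (w : ℕ) (f : ℤ → ℤ) (i : ℤ) :
    ∃ A : Finset ℤ, (A.card : ℝ) ≤ w * (w / B + 2) ∧
      ∀ x, i ≤ x → x < i + w → ∀ a, f x ≤ a → a < f x + w → a / (B : ℤ) ∈ A := by
  choose A hA hA' using fun x => exists_finset_blocks B hB (f x) w
  refine ⟨(Finset.Ico i (i + w)).biUnion A, ?_, fun x h1 h2 a h3 h4 => ?_⟩
  · have h1 : (((Finset.Ico i (i + w)).biUnion A).card : ℝ) ≤
        ∑ x ∈ Finset.Ico i (i + w), ((A x).card : ℝ) := by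
      exact_mod_cast Finset.card_biUnion_le
    refine h1.trans ((Finset.sum_le_sum fun x _ => hA x).trans ?_)
    rw [Finset.sum_const, Int.card_Ico, nsmul_eq_mul]
    simp
  · exact Finset.mem_biUnion.2 ⟨x, Finset.mem_Ico.2 ⟨h1, h2⟩, hA' x a h3 h4⟩

/-- The blocks of an interval of slots, numbered cyclically. -/
lemma exists_finset_slots (m : ℕ) (hm : 1 ≤ m) (B : ℕ) (hB : 1 ≤ B) (a : ℤ) (L : ℕ) :
    ∃ A : Finset ℤ, (A.card : ℝ) ≤ 2 * (L / B + 2) ∧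
      ∀ l, a ≤ l → l < a + L → slotAddr m l / (B : ℤ) ∈ A := by
  have hBr : (0 : ℝ) < B := by exact_mod_cast hB
  by_cases hL : L ≤ 32 * m
  · set b : ℤ := 2 * ((2 * m + 1) * (2 * m + 1))
    obtain ⟨A, hA, hA'⟩ := exists_finset_blocks B hB (b + a - 32 * m * (a / (32 * m))) L
    obtain ⟨A₁, hA₁, hA₁'⟩ := exists_finset_blocks B hB (b + a - 32 * m * (a / (32 * m) + 1)) L
    refine ⟨A ∪ A₁, ?_, fun l h1 h2 => ?_⟩
    · have : ((A ∪ A₁).card : ℝ) ≤ A.card + A₁.card := by exact_mod_cast Finset.card_union_le _ _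
      linarith
    · have hN : (0 : ℤ) < 32 * m := by omega
      have h3 : slotAddr m l = b + l - 32 * m * (l / (32 * m)) := by
        rw [slotAddr, Int.emod_def]; ring
      have h4 : a / (32 * m) ≤ l / (32 * m) := Int.ediv_le_ediv hN h1
      have h5 : l / (32 * m) < a / (32 * m) + 2 := by
        rw [Int.ediv_lt_iff_lt_mul hN]
        have h6 := Int.lt_ediv_add_one_mul_self a hN
        have h7 : (L : ℤ) ≤ 32 * m := by exact_mod_cast hL
        linarith
      rw [Finset.mem_union, h3]
      rcases (by omega : l / (32 * m) = a / (32 * m) ∨ l / (32 * m) = a / (32 * m) + 1) with h | h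
      · rw [h]; left; exact hA' _ (by linarith) (by linarith)
      · rw [h]; right; exact hA₁' _ (by linarith) (by linarith)
  · obtain ⟨A, hA, hA'⟩ := exists_finset_blocks B hB (2 * ((2 * m + 1) * (2 * m + 1))) (32 * m)
    refine ⟨A, hA.trans ?_, fun l _ _ => ?_⟩
    · have h1 : ((32 * m : ℕ) : ℝ) / B ≤ L / B := by
        gcongr; omega
      have h2 : (0 : ℝ) ≤ L / B := by positivity
      linarith
    · obtain ⟨h1, h2⟩ := slotAddr_bounds hm l
      exact hA' _ h1 (by push_cast; linarith)

/-- A tile all of whose blocks fit into main memory. -/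
lemma loads_tile {m : ℕ} {B : ℕ} (hB : 1 ≤ B) {cap d depth : ℕ} (hd : d < depth) {i j : ℤ}
    (hi : -(m : ℤ) ≤ i) (hj : -(m : ℤ) ≤ j) (F : ℤ) (μ : Mem) (S : Finset ℤ) {σ : ℝ}
    (hσ : (S.card : ℝ) ≤ σ)
    (hS : ∀ p ∈ sweepOrder d i j, Counted m p → ∀ l, Touched m l p.1 p.2 →
      slotAddr m l / (B : ℤ) ∈ S)
    (hcap : 2 * ((2 : ℝ) ^ d * (2 ^ d / B + 2)) + σ + (16 * (d + 1) / B + 2) ≤ cap) :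
    Loads cap B ((sweepRec (consts m) depth i j (2 ^ d) F).exec μ).trace
      (2 * ((2 : ℝ) ^ d * (2 ^ d / B + 2)) + σ + (16 * (d + 1) / B + 2)) := by
  obtain ⟨A₁, h₁, h₁'⟩ := exists_finset_rows B hB (2 ^ d) (fun x => elevAddr m x j) i
  obtain ⟨A₂, h₂, h₂'⟩ := exists_finset_rows B hB (2 ^ d) (fun x => visAddr m x j) i
  obtain ⟨A₃, h₃, h₃'⟩ := exists_finset_blocks B hB F (16 * (d + 1))
  push_cast at h₁ h₂ h₃ h₁' h₂'
  have hcard : ((A₁ ∪ A₂ ∪ S ∪ A₃).card : ℝ) ≤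
      2 * ((2 : ℝ) ^ d * (2 ^ d / B + 2)) + σ + (16 * (d + 1) / B + 2) := by
    have e1 : ((A₁ ∪ A₂ ∪ S ∪ A₃).card : ℝ) ≤ (A₁ ∪ A₂ ∪ S).card + A₃.card := by
      exact_mod_cast Finset.card_union_le _ _
    have e2 : ((A₁ ∪ A₂ ∪ S).card : ℝ) ≤ (A₁ ∪ A₂).card + S.card := by
      exact_mod_cast Finset.card_union_le _ _
    have e3 : ((A₁ ∪ A₂).card : ℝ) ≤ A₁.card + A₂.card := by
      exact_mod_cast Finset.card_union_le _ _
    linarith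
  refine (loads_of_card_le (A₁ ∪ A₂ ∪ S ∪ A₃) ?_ ?_).mono hcard
  · exact_mod_cast hcard.trans hcap
  · intro e he
    simp only [Finset.mem_union]
    rcases sweepRec_trace m d depth hd hi hj F μ he with h | ⟨⟨x, y⟩, hp, hg, hu⟩
    · exact .inr (h₃' _ h.1 h.2)
    · have hp' := mem_sweepOrder.1 hp
      rcases hu with hu | hu | ⟨hc, l, hu, ht⟩
      · refine .inl (.inl (.inl (h₁' x hp'.1.1 hp'.1.2 _ ?_ ?_))) <;> rw [hu] <;>
          simp only [elevAddr] <;> linarith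
      · refine .inl (.inl (.inr (h₂' x hp'.1.1 hp'.1.2 _ ?_ ?_))) <;> rw [hu] <;>
          simp only [visAddr, elevAddr] <;> linarith
      · rw [hu]
        exact .inl (.inr (hS _ hp hc l ht))

/-- The slots of a tile at distance at least `R` from the viewpoint. -/
lemma exists_slots_of_far_tile {m : ℕ} (hm : 1 ≤ m) {d : ℕ} {i j : ℤ} {R : ℝ} (hR : 0 < R)
    (hRij : R ≤ supDist i j) : ∃ a : ℤ, ∀ p ∈ sweepOrder d i j, ∀ l, Touched m l p.1 p.2 →
      ∃ l', slotAddr m l = slotAddr m l' ∧ a ≤ l' ∧ l' < a + (2 * ⌈32 * m * 2 ^ d / R⌉₊ + 3 : ℕ) := by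
  have hm' : (0 : ℝ) < m := by exact_mod_cast hm
  have hW : 0 < 2 * Real.pi / (32 * (m : ℝ)) := by positivity
  have hWm : 2 * Real.pi / (32 * (m : ℝ)) * (32 * m) = 2 * Real.pi := by field_simp
  unfold Touched
  generalize 2 * Real.pi / (32 * (m : ℝ)) = W at *
  have hk1 := Int.floor_le (azim (j : ℝ) (-(i : ℝ)) / W)
  have hk2 := Int.lt_floor_add_one (azim (j : ℝ) (-(i : ℝ)) / W)
  rw [le_div_iff₀ hW] at hk1
  rw [div_lt_iff₀ hW] at hk2
  refine ⟨⌊azim (j : ℝ) (-(i : ℝ)) / W⌋ - (⌈32 * m * 2 ^ d / R⌉₊ + 1 : ℕ), ?_⟩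
  rintro ⟨x, y⟩ hp l ⟨θ, h1, h2, ρ, hρ, hc1, hc2⟩
  rw [mem_sweepOrder] at hp
  simp only at hc1 hc2
  have hdist : R ≤ dist i j := by
    refine hRij.trans ?_
    have h3 : |(j : ℝ)| ≤ dist i j := Real.abs_le_sqrt (by nlinarith)
    have h4 : |(i : ℝ)| ≤ dist i j := Real.abs_le_sqrt (by nlinarith)
    rw [supDist]
    push_cast
    rw [Nat.cast_natAbs, Nat.cast_natAbs, Int.cast_abs, Int.cast_abs]
    exact max_le h4 h3
  have hx1 : (i : ℝ) ≤ x := by exact_mod_cast hp.1.1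
  have hx2 : (x : ℝ) + 1 ≤ i + 2 ^ d := by exact_mod_cast hp.1.2
  have hy1 : (j : ℝ) ≤ y := by exact_mod_cast hp.2.1
  have hy2 : (y : ℝ) + 1 ≤ j + 2 ^ d := by exact_mod_cast hp.2.2
  rw [abs_le] at hc1 hc2
  obtain ⟨z, hz⟩ := exists_angle_close (θ := θ) (θ' := azim (j : ℝ) (-(i : ℝ))) (D := 2 ^ d) hρ hR
    hdist (by rw [dist_mul_cos_azim, abs_le]; constructor <;> linarith)
    (by rw [dist_mul_sin_azim, abs_le]; constructor <;> linarith)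
  refine ⟨l + 32 * m * z, slotAddr_eq_iff.2 ⟨z, rfl⟩, ?_⟩
  have e : (32 * m * z : ℝ) * W = 2 * Real.pi * z := by rw [← hWm]; ring
  have hL := Nat.le_ceil (32 * m * 2 ^ d / R : ℝ)
  have hδ : 2 * Real.pi * (2 ^ d / R) ≤ (⌈32 * m * 2 ^ d / R⌉₊ : ℝ) * W := by
    refine le_trans (le_of_eq ?_) (mul_le_mul_of_nonneg_right hL hW.le)
    rw [← hWm]; ring
  generalize ⌈32 * m * 2 ^ d / R⌉₊ = L at *
  generalize ⌊azim (j : ℝ) (-(i : ℝ)) / W⌋ = k at *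
  rw [abs_le] at hz
  have u1 : (k : ℝ) * W ≤ (l + 32 * m * z + 1 + L) * W := by linarith
  have u2 : (l + 32 * m * z : ℝ) * W < (k + 1 + L) * W := by linarith
  have v1 := le_of_mul_le_mul_right u1 hW
  have v2 := lt_of_mul_lt_mul_right u2 hW.le
  have w1 : k ≤ l + 32 * m * z + 1 + L := by exact_mod_cast v1
  have w2 : l + 32 * m * z < k + 1 + L := by exact_mod_cast v2
  push_cast
  omega

/-! ### Block transfers of the recursion -/

/-- The subtiles of width `2 ^ e` of a tile of width `2 ^ (e + k)`. -/
def subtiles (e : ℕ) : ℕ → ℤ → ℤ → List (ℤ × ℤ)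
  | 0, i, j => [(i, j)]
  | k + 1, i, j => (quadrants i j (2 ^ (e + k))).flatMap fun t => subtiles e k t.row t.col

lemma length_subtiles (e k : ℕ) (i j : ℤ) : (subtiles e k i j).length = 4 ^ k := by
  induction k generalizing i j with
  | zero => rfl
  | succ k ih =>
    have hlen : (quadrants i j (2 ^ (e + k))).length = 4 := (quadrants_perm _ _ _).length_eq
    rw [subtiles, List.length_flatMap]
    simp only [ih, List.map_const', hlen, List.sum_replicate, smul_eq_mul, pow_succ']

lemma sweepOrder_add (e k : ℕ) (i j : ℤ) :
    sweepOrder (e + k) i j = (subtiles e k i j).flatMap fun τ => sweepOrder e τ.1 τ.2 := by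
  induction k generalizing i j with
  | zero => simp [subtiles]
  | succ k ih =>
    rw [← add_assoc, sweepOrder, subtiles, List.flatMap_assoc]
    simp only [ih]

lemma sum_map_flatMap {α β : Type} (l : List α) (f : α → List β) (g : β → ℝ) :
    ((l.flatMap f).map g).sum = (l.map fun a => ((f a).map g).sum).sum := by
  induction l with
  | nil => simp
  | cons a l ih => simp [ih]

lemma loads_touchFrame (cap B : ℕ) (F : ℤ) (μ : Mem) :
    Loads cap B ((touchFrame frameSize F).exec μ).trace 32 := by
  refine (loads_length cap B _).mono ?_
  have h1 := length_trace_le (touchFrame frameSize F) μ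
  have h2 : ((touchFrame frameSize F).exec μ).time = 32 := (touchFrame_exec _ _ _).2.1
  rw [h2] at h1
  exact_mod_cast h1

lemma loads_sweepRec {m cap B e : ℕ} (N : ℤ × ℤ → ℝ)
    (h : ∀ i j : ℤ, -(m : ℤ) ≤ i → -(m : ℤ) ≤ j → ∀ depth, e < depth → ∀ F μ,
      Loads cap B ((sweepRec (consts m) depth i j (2 ^ e) F).exec μ).trace (N (i, j)))
    (k depth : ℕ) (hd : e + k < depth) {i j : ℤ} (hi : -(m : ℤ) ≤ i) (hj : -(m : ℤ) ≤ j) (F : ℤ)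
    (μ : Mem) : Loads cap B ((sweepRec (consts m) depth i j (2 ^ (e + k)) F).exec μ).trace
      (((subtiles e k i j).map fun τ => 54 + N τ).sum - 54) := by
  induction k generalizing depth i j F μ with
  | zero => simpa [subtiles] using h i j hi hj depth hd F μ
  | succ k ih =>
    obtain ⟨depth, rfl⟩ := Nat.exists_eq_succ_of_ne_zero (by omega : depth ≠ 0)
    have hlen : (quadrants i j (2 ^ (e + k))).length = 4 := (quadrants_perm _ _ _).length_eq
    have hq : ∀ t ∈ quadrants i j (2 ^ (e + k)), -(m : ℤ) ≤ t.row ∧ -(m : ℤ) ≤ t.col := by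
      intro t ht
      have h2 : (0 : ℤ) < 2 ^ (e + k) := by positivity
      obtain ⟨h3, h4, -⟩ := mem_quadrants.1 ht
      omega
    have key : ∀ (l : List Tile), (∀ t ∈ l, -(m : ℤ) ≤ t.row ∧ -(m : ℤ) ≤ t.col) → ∀ μ : Mem,
        Loads cap B ((forEach (visitQuadrant (consts m) depth (2 ^ (e + k)) F) l).exec μ).trace
          (((l.flatMap fun t => subtiles e k t.row t.col).map fun τ => 54 + N τ).sum -
            22 * l.length) := by
      intro l
      induction l with
      | nil => intro _ μ; simpa [forEach] using loads_nil cap B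
      | cons t l ihl =>
        intro hl μ
        have ht := hl t (by simp)
        rw [(forEach_cons_exec _ _ _ _).2.2, (visitQuadrant_exec _ _ _ _ _ _).2.2]
        have h1 := ih depth (by omega) ht.1 ht.2 (F + (frameSize : ℤ)) μ
        have h2 := ihl (fun u hu => hl u (by simp [hu]))
          ((visitQuadrant (consts m) depth (2 ^ (e + k)) F t).exec μ).mem
        refine ((h1.append (loads_touchFrame cap B F _)).append h2).mono ?_
        rw [List.flatMap_cons, List.map_append, List.sum_append, List.length_cons]
        push_cast
        linarith
    rw [← add_assoc, (sweepRec_two_pow_succ _ _ _ _ _ _ _).2.2, subtiles]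
    refine ((loads_touchFrame cap B F μ).append (key _ hq μ)).mono ?_
    rw [hlen]
    push_cast
    linarith

lemma sum_map_subtiles (e k : ℕ) (i j : ℤ) (a : ℝ) (g : ℤ × ℤ → ℝ) :
    ((subtiles e k i j).map fun τ => a + ((sweepOrder e τ.1 τ.2).map g).sum).sum =
      4 ^ k * a + ((sweepOrder (e + k) i j).map g).sum := by
  rw [sweepOrder_add, sum_map_flatMap, List.sum_map_add]
  simp [length_subtiles]

/-- If the footprint of the whole computation fits into main memory, then every block is loaded
at most once. -/
lemma loads_whole {m B cap : ℕ} (hB : 1 ≤ B) (hcap : 34 * ((2 * (m : ℝ) + 1) ^ 2 / B) + 2 ≤ cap)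
    (μ : Mem) : Loads cap B ((centrifugalSweep m).exec μ).trace
      (34 * ((2 * (m : ℝ) + 1) ^ 2 / B) + 2) := by
  obtain ⟨d, hd, -, -, h⟩ := centrifugalSweep_exec m
  obtain ⟨A, hA, hA'⟩ := exists_finset_blocks B hB 0
    (2 * ((2 * m + 1) * (2 * m + 1)) + 32 * m + 16 * (d + 1))
  have hcard : (A.card : ℝ) ≤ 34 * ((2 * (m : ℝ) + 1) ^ 2 / B) + 2 := by
    refine hA.trans ?_
    rw [← mul_div_assoc]
    have : 2 * ((2 * m + 1) * (2 * m + 1)) + 32 * m + 16 * (d + 1) ≤ 34 * (2 * m + 1) ^ 2 := by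
      nlinarith
    have h' : ((2 * ((2 * m + 1) * (2 * m + 1)) + 32 * m + 16 * (d + 1) : ℕ) : ℝ) ≤
        34 * (2 * (m : ℝ) + 1) ^ 2 := by exact_mod_cast this
    gcongr
  refine (loads_of_card_le A (by exact_mod_cast hcard.trans hcap) ?_).mono hcard
  intro e he
  rw [(h μ).2.2, List.mem_append] at he
  have key : 0 ≤ e.1 ∧
      e.1 < (2 * ((2 * m + 1) * (2 * m + 1)) + 32 * m + 16 * (d + 1) : ℕ) := by
    push_cast
    rcases he with he | he
    · obtain ⟨l, h1, h2, h3⟩ := (clearSlots_spec m (32 * m + 1) 0 le_rfl (by push_cast; omega)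
        μ).2.2 e he
      have h4 := slotAddr_bounds (by omega : 1 ≤ m) l
      rw [h3]
      constructor <;> nlinarith
    · rcases sweepRec_trace m d _ hd le_rfl le_rfl _ _ he with h1 | ⟨p, -, hg, hu⟩
      · push_cast at h1
        constructor <;> nlinarith
      · have hb := elevAddr_bounds hg
        rcases hu with hu | hu | ⟨hc, l, hu, -⟩
        · rw [hu]; constructor <;> nlinarith
        · rw [hu, visAddr_eq]; constructor <;> nlinarith
        · have h4 := slotAddr_bounds hc.one_le l
          rw [hu]; constructor <;> nlinarith
  exact hA' _ key.1 (by linarith [key.2])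

/-- A tile fits into main memory together with the whole horizon. -/
lemma loads_tile_of_small {m B cap e : ℕ} (hB : 1 ≤ B) {δ : ℝ} (hm : (m : ℝ) ≤ δ * B ^ 2)
    (hw : (2 : ℝ) ^ e ≤ δ * B) (hδ : δ ≤ 1 / 80) (hcap : 38 * (δ * B) + 9 ≤ cap) {i j : ℤ}
    (hi : -(m : ℤ) ≤ i) (hj : -(m : ℤ) ≤ j) {depth : ℕ} (hd : e < depth) (F : ℤ) (μ : Mem) :
    Loads cap B ((sweepRec (consts m) depth i j (2 ^ e) F).exec μ).trace (38 * (δ * B) + 9) := by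
  have hBr : (0 : ℝ) < B := by exact_mod_cast hB
  obtain ⟨S, hS, hS'⟩ := exists_finset_blocks B hB (2 * ((2 * m + 1) * (2 * m + 1))) (32 * m)
  have h1 : (2 : ℝ) ^ e / B ≤ 1 / 80 := by
    rw [div_le_iff₀ hBr]
    exact hw.trans (mul_le_mul_of_nonneg_right hδ hBr.le)
  have h2 : ((e : ℝ) + 1) / B ≤ 2 ^ e / B := by
    gcongr
    exact_mod_cast Nat.lt_two_pow_self
  have h3 : ((32 * m : ℕ) : ℝ) / B ≤ 32 * (δ * B) := by
    rw [div_le_iff₀ hBr]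
    push_cast
    nlinarith
  have h4 : 16 * ((e : ℝ) + 1) / B = 16 * (((e : ℝ) + 1) / B) := by ring
  have h5 : (0 : ℝ) < 2 ^ e := by positivity
  have hle : 2 * ((2 : ℝ) ^ e * (2 ^ e / B + 2)) + (32 * (δ * B) + 2) + (16 * (e + 1) / B + 2) ≤
      38 * (δ * B) + 9 := by
    rw [h4]
    nlinarith
  refine (loads_tile hB hd hi hj F μ S (hS.trans (add_le_add_left h3 2)) ?_ (hle.trans hcap)).mono
    hle
  intro p _ hc l _
  have hb := slotAddr_bounds hc.one_le l
  exact hS' _ hb.1 (by push_cast; exact hb.2)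

open scoped Classical in
/-- A tile near the viewpoint is charged for its running time; a tile far from the viewpoint fits
into main memory together with the slots that it uses. -/
lemma loads_tile_of_large {m B cap e : ℕ} (hB : 100 ≤ B) {δ : ℝ} (hm : δ * B ^ 2 < m)
    (hw : (2 : ℝ) ^ e ≤ δ * B) (hδ : δ ≤ 1 / 80) (hcap : 38 * (δ * B) + 9 ≤ cap) {i j : ℤ}
    (hi : -(m : ℤ) ≤ i) (hj : -(m : ℤ) ≤ j) {depth : ℕ} (hd : e < depth) (F : ℤ) (μ : Mem) :
    Loads cap B ((sweepRec (consts m) depth i j (2 ^ e) F).exec μ).trace (38 * (δ * B) + 9 +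
      ((sweepOrder e i j).map fun p =>
        if supDist p.1 p.2 ≤ ⌈128 * (m : ℝ) / B⌉₊ then weight m p else 0).sum) := by
  have hB100 : (100 : ℝ) ≤ B := by exact_mod_cast hB
  have hBr : (0 : ℝ) < B := by linarith
  have hδ0 : 0 < δ * B := lt_of_lt_of_le (by positivity) hw
  have hρ := Nat.le_ceil (128 * (m : ℝ) / B)
  have hmr : (0 : ℝ) < m := lt_of_le_of_lt (by nlinarith) hm
  have hm1 : 1 ≤ m := by exact_mod_cast hmr
  generalize ⌈128 * (m : ℝ) / B⌉₊ = ρ at *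
  have h5 : (0 : ℝ) < 2 ^ e := by positivity
  by_cases hnear : ∀ p ∈ sweepOrder e i j, supDist p.1 p.2 ≤ ρ
  · rw [List.map_congr_left (g := weight m) fun p hp => if_pos (hnear p hp)]
    refine (loads_length cap B _).mono ?_
    have h1 : ((((sweepRec (consts m) depth i j (2 ^ e) F).exec μ).trace.length : ℕ) : ℝ) ≤
        ((sweepRec (consts m) depth i j (2 ^ e) F).exec μ).time := by
      exact_mod_cast length_trace_le _ μ
    have h2 := sweepRec_time m e depth hd i j F μ
    linarith
  · have hsum : 0 ≤ ((sweepOrder e i j).map fun p =>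
        if supDist p.1 p.2 ≤ ρ then weight m p else 0).sum := by
      refine List.sum_nonneg fun x hx => ?_
      obtain ⟨p, -, rfl⟩ := List.mem_map.1 hx
      split_ifs
      · exact weight_nonneg m p
      · exact le_rfl
    push Not at hnear
    obtain ⟨⟨x, y⟩, hp, hfar⟩ := hnear
    have hp' := mem_sweepOrder.1 hp
    have hsup : supDist x y ≤ supDist i j + 2 ^ e := by
      have : ((2 ^ e : ℕ) : ℤ) = 2 ^ e := by push_cast; rfl
      rw [← this] at hp'
      generalize 2 ^ e = w at *
      rw [supDist, supDist]
      omega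
    have hsup' : (supDist x y : ℝ) ≤ supDist i j + 2 ^ e := by exact_mod_cast hsup
    have hfar' : (ρ : ℝ) < supDist x y := by exact_mod_cast hfar
    have hρ' : 128 * (m : ℝ) ≤ ρ * B := by rwa [div_le_iff₀ hBr] at hρ
    have hρw : 2 * (2 : ℝ) ^ e ≤ ρ := by
      by_contra! hc
      nlinarith
    have hρ0 : (0 : ℝ) < ρ := by linarith
    obtain ⟨a, ha⟩ := exists_slots_of_far_tile hm1 (d := e) (i := i) (j := j) (R := (ρ : ℝ) / 2)
      (by positivity) (by linarith)
    obtain ⟨S, hS, hS'⟩ := exists_finset_slots m hm1 B (by omega) a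
      (2 * ⌈32 * m * 2 ^ e / ((ρ : ℝ) / 2)⌉₊ + 3)
    have hceil : (⌈32 * m * 2 ^ e / ((ρ : ℝ) / 2)⌉₊ : ℝ) ≤ B * 2 ^ e / 2 + 1 := by
      refine (Nat.ceil_lt_add_one (by positivity)).le.trans (add_le_add_left ?_ 1)
      rw [div_le_iff₀ (by positivity)]
      nlinarith
    have hlen : ((2 * ⌈32 * m * 2 ^ e / ((ρ : ℝ) / 2)⌉₊ + 3 : ℕ) : ℝ) / B ≤ 2 ^ e + 1 := by
      rw [div_le_iff₀ hBr]
      push_cast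
      nlinarith
    have hσ : (S.card : ℝ) ≤ 2 * (δ * B) + 6 := by linarith
    have h1 : (2 : ℝ) ^ e / B ≤ 1 / 80 := by
      rw [div_le_iff₀ hBr]
      exact hw.trans (mul_le_mul_of_nonneg_right hδ hBr.le)
    have h2 : ((e : ℝ) + 1) / B ≤ 2 ^ e / B := by
      gcongr
      exact_mod_cast Nat.lt_two_pow_self
    have h4 : 16 * ((e : ℝ) + 1) / B = 16 * (((e : ℝ) + 1) / B) := by ring
    have hw1 : (1 : ℝ) ≤ 2 ^ e := one_le_pow₀ (by norm_num)
    have hle : 2 * ((2 : ℝ) ^ e * (2 ^ e / B + 2)) + (2 * (δ * B) + 6) + (16 * (e + 1) / B + 2) ≤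
        38 * (δ * B) + 9 := by
      rw [h4]
      nlinarith
    refine (loads_tile (by omega) hd hi hj F μ S hσ ?_ (hle.trans hcap)).mono (by linarith)
    intro p hp _ l ht
    obtain ⟨l', h1, h2, h3⟩ := ha p hp l ht
    rw [h1]
    exact hS' l' h2 h3

/-- The total over all tiles, when the width of the tiles is proportional to the block size. -/
lemma loads_centrifugalSweep_of_tiles {m B cap d e : ℕ} (hB : 100 ≤ B) {δ K : ℝ} (hδ0 : 0 < δ)
    (hδ : δ ≤ 1 / 80) (he : e ≤ d) (hw : δ * B < 2 ^ (e + 1)) (hdB : δ * B < 2 ^ d)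
    (hdm : d < 2 * m + 2) (hd : 2 ^ d < 2 * (2 * m + 1)) (g : ℤ × ℤ → ℝ)
    (hg : ((sweepOrder d (-m) (-m)).map g).sum ≤ K * ((2 * (m : ℝ) + 1) ^ 2 / B))
    (h : ∀ i j : ℤ, -(m : ℤ) ≤ i → -(m : ℤ) ≤ j → ∀ depth, e < depth → ∀ F μ,
      Loads cap B ((sweepRec (consts m) depth i j (2 ^ e) F).exec μ).trace
        (38 * (δ * B) + 9 + ((sweepOrder e i j).map g).sum)) (F : ℤ) (μ μ' : Mem) :
    Loads cap B (((clearSlots (consts m) (32 * m + 1) 0).exec μ).trace ++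
        ((sweepRec (consts m) (2 * m + 2) (-m) (-m) (2 ^ d) F).exec μ').trace)
      ((128 / δ + 32 / δ ^ 2 + K) * ((2 * (m : ℝ) + 1) ^ 2 / B)) := by
  have hB100 : (100 : ℝ) ≤ B := by exact_mod_cast hB
  have hBr : (0 : ℝ) < B := by linarith
  obtain ⟨k, rfl⟩ := Nat.exists_eq_add_of_le he
  have h1 := loads_sweepRec (m := m) (cap := cap) (B := B) (e := e)
    (fun τ => 38 * (δ * B) + 9 + ((sweepOrder e τ.1 τ.2).map g).sum) h k _ hdm le_rfl le_rfl F μ'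
  simp only [← add_assoc] at h1
  rw [sum_map_subtiles] at h1
  have h2 : Loads cap B ((clearSlots (consts m) (32 * m + 1) 0).exec μ).trace (128 * m + 4) := by
    refine (loads_length cap B _).mono ?_
    have t1 := (clearSlots_spec m (32 * m + 1) 0 le_rfl (by push_cast; omega) μ).2.1
    have t2 := (length_trace_le _ _).trans t1
    have t3 : ((((clearSlots (consts m) (32 * m + 1) 0).exec μ).trace.length : ℕ) : ℝ) ≤
      4 * (32 * m + 1) := by exact_mod_cast t2
    linarith
  refine (h2.append h1).mono ?_
  have hm0 : (0 : ℝ) ≤ m := by positivity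
  have hd' : (2 : ℝ) ^ (e + k) < 2 * (2 * m + 1) := by exact_mod_cast hd
  have hδB : 0 < δ * B := by positivity
  have e1 : 128 * (m : ℝ) + 4 ≤ 128 / δ * ((2 * (m : ℝ) + 1) ^ 2 / B) := by
    rw [div_mul_div_comm, le_div_iff₀ hδB]
    have : δ * B ≤ 2 * (2 * m + 1) := (hdB.trans hd').le
    nlinarith
  have e2 : (4 : ℝ) ^ k * (54 + (38 * (δ * B)) + 9) ≤ 32 / δ ^ 2 * ((2 * (m : ℝ) + 1) ^ 2 / B) := by
    have p1 : (4 : ℝ) ^ k = 2 ^ k * 2 ^ k := by rw [← mul_pow]; norm_num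
    have p2 : (2 : ℝ) ^ k * (δ * B) ≤ 4 * (2 * m + 1) := by
      have : (2 : ℝ) ^ k * (δ * B) ≤ 2 ^ k * 2 ^ (e + 1) := by gcongr
      have p3 : (2 : ℝ) ^ k * 2 ^ (e + 1) = 2 * 2 ^ (e + k) := by
        rw [pow_add, pow_add]; ring
      linarith
    have p4 : (2 : ℝ) ^ k * (δ * B) * (2 ^ k * (δ * B)) ≤ 4 * (2 * m + 1) * (4 * (2 * m + 1)) := by
      gcongr
    have p5 : 54 + (38 * (δ * B)) + 9 ≤ 2 * B := by nlinarith
    have p6 : (4 : ℝ) ^ k * (54 + (38 * (δ * B)) + 9) ≤ 4 ^ k * (2 * B) := by gcongr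
    refine p6.trans ?_
    rw [div_mul_div_comm, le_div_iff₀ (by positivity), p1]
    nlinarith
  have e3 : 54 + 38 * (δ * (B : ℝ)) + 9 = 54 + (38 * (δ * B)) + 9 := by ring
  linarith

lemma sum_bound_le {m B : ℕ} {δ : ℝ} (hB : (1 : ℝ) ≤ B) (hδ : 1 ≤ δ * B) (hm : δ * B ^ 2 < m) :
    230 * (2 * (⌈128 * (m : ℝ) / B⌉₊ : ℝ) + 1) ^ 2 + 3584 * (m * (⌈128 * (m : ℝ) / B⌉₊ : ℝ)) ≤
      20000000 * ((2 * (m : ℝ) + 1) ^ 2 / B) := by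
  have hρ := (Nat.ceil_lt_add_one (by positivity : 0 ≤ 128 * (m : ℝ) / B)).le
  have hρ0 : (0 : ℝ) ≤ ⌈128 * (m : ℝ) / B⌉₊ := Nat.cast_nonneg _
  have hm0 : (0 : ℝ) ≤ m := Nat.cast_nonneg _
  have hu : 1 ≤ (m : ℝ) / B := by
    rw [le_div_iff₀ (by linarith)]
    have : 1 * (B : ℝ) ≤ δ * B * B := by gcongr
    linarith
  have hum : (m : ℝ) / B ≤ m := div_le_self hm0 hB
  have hX : 4 * ((m : ℝ) / B * m) ≤ (2 * (m : ℝ) + 1) ^ 2 / B := by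
    rw [div_mul_eq_mul_div, ← mul_div_assoc]
    gcongr
    linarith
  rw [mul_div_assoc] at hρ hρ0 ⊢
  generalize (m : ℝ) / B = u at *
  generalize (⌈128 * u⌉₊ : ℝ) = ρ at *
  have q1 : 2 * ρ + 1 ≤ 259 * u := by linarith
  have q2 : (2 * ρ + 1) ^ 2 ≤ 259 * u * (259 * m) := by
    rw [sq]
    exact mul_le_mul q1 (by linarith) (by linarith) (by linarith)
  have q3 : (m : ℝ) * ρ ≤ m * (129 * u) := by gcongr; linarith
  have q4 : 0 ≤ u * m := by nlinarith
  linarith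

/-- The bound for the number of blocks loaded. -/
theorem loads_centrifugalSweep {c : ℝ} (hc : 0 < c) (hc1 : c ≤ 1) {m M B : ℕ} (hB : 1 ≤ B)
    (hM : c * (B : ℝ) ^ 2 ≤ M) (μ : Mem) :
    Loads (M / B) B ((centrifugalSweep m).exec μ).trace
      ((900000 / c + 36 + 128 / (c / 80) + 32 / (c / 80) ^ 2 + 20000000) *
        scan ((2 * m + 1) ^ 2) B) := by
  classical
  have hBr : (1 : ℝ) ≤ B := by exact_mod_cast hB
  have hs1 : (2 * (m : ℝ) + 1) ^ 2 / B ≤ scan ((2 * m + 1) ^ 2) B := by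
    have := Nat.le_ceil ((((2 * m + 1) ^ 2 : ℕ) : ℝ) / B)
    rw [scan]
    push_cast at this ⊢
    exact this
  have hs2 : (1 : ℝ) ≤ scan ((2 * m + 1) ^ 2) B := by
    have : 0 < scan ((2 * m + 1) ^ 2) B := Nat.ceil_pos.2 (by positivity)
    exact_mod_cast this
  generalize (scan ((2 * m + 1) ^ 2) B : ℝ) = s at hs1 hs2 ⊢
  have hX : 0 ≤ (2 * (m : ℝ) + 1) ^ 2 / B := by positivity
  have k1 : 0 < 900000 / c := by positivity
  have k2 : 0 < 128 / (c / 80) := by positivity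
  have k3 : 0 < 32 / (c / 80) ^ 2 := by positivity
  have hmono : ∀ K : ℝ, 0 ≤ K → K ≤ 900000 / c + 36 + 128 / (c / 80) + 32 / (c / 80) ^ 2 + 20000000 →
      K * ((2 * (m : ℝ) + 1) ^ 2 / B) ≤
        (900000 / c + 36 + 128 / (c / 80) + 32 / (c / 80) ^ 2 + 20000000) * s :=
    fun K h0 h => mul_le_mul h hs1 hX (h0.trans h)
  rcases lt_or_ge (B : ℝ) (100 / c) with hBc | hBc
  · refine (loads_length _ B _).mono (le_trans ?_ (hmono (900000 / c) k1.le (by linarith)))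
    have h1 : ((((centrifugalSweep m).exec μ).trace.length : ℕ) : ℝ) ≤ 9000 * (2 * m + 1) ^ 2 := by
      exact_mod_cast (length_trace_le _ μ).trans (centrifugalSweep_time m μ)
    refine h1.trans ?_
    rw [div_mul_div_comm, le_div_iff₀ (by positivity)]
    rw [lt_div_iff₀ hc] at hBc
    have : (0 : ℝ) ≤ (2 * m + 1) ^ 2 := by positivity
    nlinarith
  · have hB100 : 100 ≤ B := by
      have : (100 : ℝ) ≤ 100 / c := (le_div_iff₀ hc).2 (by linarith)
      exact_mod_cast this.trans hBc
    rw [div_le_iff₀ hc] at hBc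
    have hcap : c * B - 1 ≤ ((M / B : ℕ) : ℝ) := by
      have h1 : M < (M / B + 1) * B := by
        rw [mul_comm]; exact Nat.lt_mul_div_succ M hB
      have h2 : (M : ℝ) < (((M / B : ℕ) : ℝ) + 1) * B := by exact_mod_cast h1
      have h3 : c * B * B < (((M / B : ℕ) : ℝ) + 1) * B := by nlinarith
      linarith [lt_of_mul_lt_mul_right h3 (by linarith)]
    generalize M / B = cap at hcap ⊢
    set δ := c / 80 with hδ
    have hδ0 : 0 < δ := by positivity
    have hδ1 : δ ≤ 1 / 80 := by rw [hδ]; linarith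
    have hcδ : c = 80 * δ := by rw [hδ]; ring
    rw [hcδ] at hcap hBc
    have hcap' : 38 * (δ * B) + 9 ≤ cap := by linarith
    obtain ⟨d, hd1, hd2, hd3, hex⟩ := centrifugalSweep_exec m
    rcases le_or_gt ((2 : ℝ) ^ d) (δ * B) with hfit | hfit
    · refine (loads_whole hB ?_ μ).mono ?_
      · have h1 : 2 * (m : ℝ) + 1 ≤ 2 ^ d := by exact_mod_cast hd3
        have h2 : (2 * (m : ℝ) + 1) ^ 2 ≤ (δ * B) ^ 2 := by
          gcongr; exact h1.trans hfit
        have h3 : (2 * (m : ℝ) + 1) ^ 2 / B ≤ δ * (δ * B) := by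
          rw [div_le_iff₀ (by linarith)]; nlinarith
        nlinarith
      · nlinarith
    · obtain ⟨e, he1, he2⟩ := exists_nat_pow_near (x := δ * B) (y := (2 : ℝ)) (by linarith)
        (by norm_num)
      have hed : e ≤ d := by
        by_contra! h
        have : (2 : ℝ) ^ d ≤ 2 ^ e := pow_le_pow_right₀ (by norm_num) h.le
        linarith
      rw [(hex μ).2.2]
      rcases le_or_gt (m : ℝ) (δ * B ^ 2) with hm | hm
      · refine (loads_centrifugalSweep_of_tiles (K := 0) hB100 hδ0 hδ1 hed he2 hfit hd1 hd2
          (fun _ => 0) (by simp) ?_ _ _ _).mono (hmono _ (by positivity) (by linarith))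
        intro i j hi hj depth hdep F μ
        simpa using loads_tile_of_small hB hm he1 hδ1 hcap' hi hj hdep F μ
      · refine (loads_centrifugalSweep_of_tiles (K := 20000000) hB100 hδ0 hδ1 hed he2 hfit hd1 hd2
          (fun p => if supDist p.1 p.2 ≤ ⌈128 * (m : ℝ) / B⌉₊ then weight m p else 0) ?_ ?_
          _ _ _).mono (hmono _ (by positivity) (by linarith))
        · refine (sum_weight_le m _ _ (sweepOrder_nodup _ _ _)).trans ?_
          exact sum_bound_le (by linarith) (by linarith) hm
        · intro i j hi hj depth hdep F μ
          exact loads_tile_of_large hB100 hm he1 hδ1 hcap' hi hj hdep F μ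

end CentrifugalSweep

open CentrifugalSweep in
open scoped Classical in
theorem mainTheorem5 :
    -- running time `O(n)`, where `n = (2m + 1)²`
    (∃ C : ℕ, ∀ (m : ℕ) (Z : ℤ → ℤ → ℝ) (μ : Mem), HoldsTerrain m Z μ →
      ((centrifugalSweep m).exec μ).time ≤ C * (2 * m + 1) ^ 2) ∧
    -- `O(scan n)` block transfers for all `M` and `B` with a tall cache, `M ≥ c B²`
    (∀ c : ℝ, 0 < c → ∃ C : ℕ, ∀ (m : ℕ) (Z : ℤ → ℤ → ℝ) (μ : Mem), HoldsTerrain m Z μ →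
      ∀ M B : ℕ, 1 ≤ B → c * (B : ℝ) ^ 2 ≤ (M : ℝ) →
        blockTransfers M B ((centrifugalSweep m).exec μ).trace ≤ C * scan ((2 * m + 1) ^ 2) B) ∧
    -- the visibility grid that is computed
    (∀ (m : ℕ) (Z : ℤ → ℤ → ℝ) (μ : Mem), HoldsTerrain m Z μ →
      ((centrifugalSweep m).exec μ).mem (visAddr m 0 0) = 1 ∧
      ∀ i j : ℤ, InGrid m i j → (i, j) ≠ (0, 0) →
        ((centrifugalSweep m).exec μ).mem (visAddr m i j) =
            (if SlotVisible m Z i j then 1 else 0) ∧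
        (((centrifugalSweep m).exec μ).mem (visAddr m i j) = 1 →
          KreveldVisible (fun i' j' => interior (cell i' j')) m Z i j ∧
          (|i| ≠ |j| → KreveldVisible cell m Z i j))) := by
  refine ⟨⟨9000, fun m _ μ _ => centrifugalSweep_time m μ⟩, fun c hc => ?_, fun m Z μ hμ => ?_⟩
  · have hc' : 0 < min c 1 := lt_min hc one_pos
    refine ⟨⌈2 * (900000 / min c 1 + 36 + 128 / (min c 1 / 80) + 32 / (min c 1 / 80) ^ 2 +
      20000000)⌉₊, fun m _ μ _ M B hB hM => ?_⟩
    have hM' : min c 1 * (B : ℝ) ^ 2 ≤ M :=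
      (mul_le_mul_of_nonneg_right (min_le_left c 1) (by positivity)).trans hM
    have h := (loads_centrifugalSweep hc' (min_le_right c 1) hB hM' μ (m := m)).blockTransfers_le
    rw [← mul_assoc] at h
    have h1 := h.trans (mul_le_mul_of_nonneg_right (Nat.le_ceil _) (Nat.cast_nonneg _))
    exact_mod_cast h1
  · obtain ⟨h0, h1⟩ := centrifugalSweep_visAddr m Z μ hμ
    refine ⟨h0, fun i j hg hne => ⟨h1 i j hg hne, fun hv => ?_⟩⟩
    have hm : 1 ≤ m := Counted.one_le (p := (i, j)) ⟨hg, hne⟩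
    rw [h1 i j hg hne] at hv
    have hs : SlotVisible m Z i j := by
      by_contra h
      rw [if_neg h] at hv
      exact zero_ne_one hv
    exact ⟨hs.kreveldVisible_interior hm, hs.kreveldVisible hm⟩
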